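/- **Conventions.** A *finite ringed poset* is a finite poset $X$ with a functor $x\mapsto\mathcal O_{X,x}$ from $X$ to commutative rings; a morphism $f\colon X\to Y$ is a monotone map together with ring maps $f^\sharp_x\colon\mathcal O_{Y,f(x)}\to\mathcal O_{X,x}$ compatible with the restriction maps. Write $U_x=\{z\in X: z\ge x\}$, with the restricted rings. $X$ is a *schematic space* if all restriction maps $\mathcal O_{X,x}\to\mathcal O_{X,y}$ ($x\le y$) are flat and, for all $t\le x,y$, the map $\mathcal O_{X,x}\otimes_{\mathcal O_{X,t}}\mathcal O_{X,y}\to\prod_{z\ge x,y}\mathcal O_{X,z}$ is faithfully flat. A morphism $f\colon X\to Y$ of schematic spaces is *schematic* if, for all $x\in X$ and $y\ge f(x)$, the map $\mathcal O_{X,x}\otimes_{\mathcal O_{Y,f(x)}}\mathcal O_{Y,y}\to\prod_{z\in U_x\cap f^{-1}(U_y)}\mathcal O_{X,z}$ induces a surjection on prime spectra. Let $\mathbf{SchFin}$ be the category of schematic spaces and schematic morphisms; it has fibered products. Put $\operatorname{Spec}(X)=\operatorname{colim}_{x\in X}\operatorname{Spec}(\mathcal O_{X,x})$ (colimit in locally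 ringed spaces). A schematic morphism $f$ is a *qc-isomorphism* if $\operatorname{Spec}(f)$ is an isomorphism; it is *flat* if all $f^\sharp_x$ are flat; it is a *flat immersion* if it is flat and its diagonal $X\to X\times_YX$ is a qc-isomorphism. A *covering by flat immersions* of $X$ is a finite family of flat immersions $\{f_i\colon U_i\to X\}_{i\in I}$ such that the maps $\operatorname{Spec}(f_i)$ are jointly surjective. Its *nerve datum* $\mathcal U$ has as underlying poset $|\mathcal U|$ the non-empty subsets $\Delta\subseteq I$ ordered by inclusion, and $\mathcal U(\Delta)$ is the fibered product over $X$ of the $U_i$, $i\in\Delta$, with the projections $\mathcal U(\Delta')\to\mathcal U(\Delta)$ for $\Delta\subseteq\Delta'$. Let $\mathfrak C$ be a category (resp. a strict 2-category). A *geometric datum* is a functor (resp. a pseudofunctor, $\mathbf{SchFin}$ having only identity 2-cells) $\mathfrak{Dat}\colon\mathbf{SchFin}\to\mathfrak C$ which maps qc-isomorphisms to isomorphisms (resp. equivalences). For every schematic space $X$ and $x\in X$, the projection $U_x\to(\star,\mathcal O_{X,x})$ to the one-point space is a qc-isomorphism, and one has $$\mathfrak{Dat}(\star,\mathcal O_{X,x})\xleftarrow{\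 \sim\ }\mathfrak{Dat}(U_x)\to\mathfrak{Dat}(X).$$ The datum $\mathfrak{Dat}$ *satisfies internal descent* if, for every schematic space $X$, these arrows exhibit $\mathfrak{Dat}(X)$ as the colimit (resp. bicolimit) $\operatorname{colim}_{x\in X}\mathfrak{Dat}(\star,\mathcal O_{X,x})$. **Proposition (External descent for nerves).** Let $X$ be a schematic space, $\{f_i\colon U_i\to X\}_{i\in I}$ a covering by flat immersions with nerve datum $\mathcal U$, and $\mathfrak{Dat}\colon\mathbf{SchFin}\to\mathfrak C$ a geometric datum, with values in a category (resp. a strict 2-category) $\mathfrak C$, which satisfies internal descent. Then the natural maps $\mathfrak{Dat}(\mathcal U(\Delta))\to\mathfrak{Dat}(X)$ exhibit $\mathfrak{Dat}(X)$ as the colimit (resp. bicolimit) of $\Delta\mapsto\mathfrak{Dat}(\mathcal U(\Delta))$; that is, the natural map $$\operatorname{colim}_{\Delta\in|\mathcal U|}\mathfrak{Dat}(\mathcal U(\Delta))\longrightarrow\mathfrak{Dat}(X)$$ is an isomorphism (resp. an equivalence). -/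

import Mathlib

open CategoryTheory CategoryTheory.Limits Opposite

universe u v w t v' w'

namespace SchematicAux

lemma exists_prime {A B C P : CommRingCat.{u}} {f : A ⟶ B} {g : A ⟶ C} {i : B ⟶ P} {j : C ⟶ P}
    (h : IsPushout f g i j) (p : PrimeSpectrum B) (q : PrimeSpectrum C)
    (hpq : PrimeSpectrum.comap f.hom p = PrimeSpectrum.comap g.hom q) :
    ∃ r : PrimeSpectrum P, PrimeSpectrum.comap i.hom r = p ∧ PrimeSpectrum.comap j.hom r = q :=
  AlgebraicGeometry.Scheme.exists_preimage_of_isPullback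
    (AlgebraicGeometry.isPullback_SpecMap_of_isPushout f g i j h) p q hpq

lemma comap_comp_apply {A B C : CommRingCat.{u}} (f : A ⟶ B) (g : B ⟶ C) (p : PrimeSpectrum C) :
    PrimeSpectrum.comap (f ≫ g).hom p = PrimeSpectrum.comap f.hom (PrimeSpectrum.comap g.hom p) :=
  rfl

lemma comap_injective_of_epi {A B : CommRingCat.{u}} (f : A ⟶ B) [Epi f] :
    Function.Injective (PrimeSpectrum.comap f.hom) := by
  intro p q hpq
  obtain ⟨r, hp, hq⟩ := exists_prime (IsPushout.of_hasPushout f f) p q hpq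
  have : pushout.inl f f = pushout.inr f f := by
    rw [← cancel_epi f, pushout.condition]
  rw [← hp, ← hq, this]

lemma flat_of_epi_comp {A B C : CommRingCat.{u}} (f : A ⟶ B) (g : B ⟶ C) [Epi f]
    (h : (f ≫ g).hom.Flat) : g.hom.Flat := by
  have hp : IsPushout f (f ≫ g) g (𝟙 C) := by
    refine ⟨⟨by simp⟩, ⟨PushoutCocone.IsColimit.mk _ (fun s => s.inr) (fun s => ?_)
      (fun s => by simp) (fun s m _ hm => by simpa using hm)⟩⟩
    rw [← cancel_epi f, s.condition]
    simp
  rw [← CommRingCat.flat_iff] at h ⊢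
  exact MorphismProperty.of_isPushout hp h

lemma epi_inl {A B C P : CommRingCat.{u}} {f : A ⟶ B} {g : A ⟶ C} {i : B ⟶ P} {j : C ⟶ P}
    (h : IsPushout f g i j) [Epi g] : Epi i := by
  constructor
  intro Z a b hab
  apply h.hom_ext hab
  rw [← cancel_epi g, ← reassoc_of% h.w, hab, reassoc_of% h.w]

lemma flat_pi {A : Type u} [CommRing A] {ι : Type u} [Finite ι] {B : ι → Type u}
    [∀ i, CommRing (B i)] (f : ∀ i, A →+* B i) (h : ∀ i, (f i).Flat) : (RingHom.pi f).Flat := by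
  classical
  let _ := fun i => (f i).toAlgebra
  have hh : ∀ i, Module.Flat A (B i) := h
  have := Fintype.ofFinite ι
  have : Module.Flat A (∀ i, B i) :=
    Module.Flat.of_linearEquiv (DirectSum.linearEquivFunOnFintype A ι B).symm
  exact this

end SchematicAux

/-- A finite ringed poset: a finite poset `X` together with a functor `𝒪 : X ⥤ CommRing`
(equivalently, a sheaf of commutative rings on `X` for the topology of up-sets, with stalk
`𝒪 x` at `x`). -/
structure RingedPoset where
  carrier : Type u
  [order : PartialOrder carrier]
  [finite : Finite carrier]
  O : carrier ⥤ CommRingCat.{u}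

namespace RingedPoset

attribute [instance] RingedPoset.order RingedPoset.finite

instance : CoeSort RingedPoset.{u} (Type u) := ⟨RingedPoset.carrier⟩

/-- The restriction morphism `𝒪 x ⟶ 𝒪 y` for `x ≤ y`. -/
def res (X : RingedPoset.{u}) {x y : X} (h : x ≤ y) : X.O.obj x ⟶ X.O.obj y :=
  X.O.map (homOfLE h)

/-- A morphism of ringed posets: a monotone map `f` and a natural transformation
`f⁻¹ 𝒪_Y ⟶ 𝒪_X`. -/
@[ext]
structure Hom (X Y : RingedPoset.{u}) where
  base : X →o Y
  sharp : base.monotone.functor ⋙ Y.O ⟶ X.O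

/-- The ring map `f^♯_x : 𝒪_{Y, f x} ⟶ 𝒪_{X, x}`. -/
def Hom.stalk {X Y : RingedPoset.{u}} (f : Hom X Y) (x : X) :
    Y.O.obj (f.base x) ⟶ X.O.obj x :=
  f.sharp.app x

instance : Category RingedPoset.{u} where
  Hom := Hom
  id X := ⟨OrderHom.id, ⟨fun x => 𝟙 _, fun x y h => by simp; rfl⟩⟩
  comp {X Y Z} f g := ⟨g.base.comp f.base,
    ⟨fun x => g.stalk (f.base x) ≫ f.stalk x, fun x y h => by
      have h1 : Z.res _ ≫ g.stalk (f.base y) = g.stalk (f.base x) ≫ Y.res _ :=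
        g.sharp.naturality (homOfLE (f.base.monotone (leOfHom h)))
      have h2 : Y.res _ ≫ f.stalk y = f.stalk x ≫ X.res _ := f.sharp.naturality h
      change Z.res (g.base.monotone (f.base.monotone (leOfHom h))) ≫ g.stalk (f.base y) ≫
        f.stalk y = (g.stalk (f.base x) ≫ f.stalk x) ≫ X.res (leOfHom h)
      rw [Category.assoc, ← h2, reassoc_of% h1]⟩⟩
  id_comp f := by
    refine Hom.ext rfl (heq_of_eq ?_)
    ext x : 2
    exact Category.comp_id _
  comp_id f := by
    refine Hom.ext rfl (heq_of_eq ?_)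
    ext x : 2
    exact Category.id_comp _
  assoc f g h := by
    refine Hom.ext rfl (heq_of_eq ?_)
    ext x : 2
    exact (Category.assoc _ _ _).symm

@[simp] lemma id_base (X : RingedPoset.{u}) (x : X) : Hom.base (𝟙 X) x = x := rfl

@[simp] lemma comp_base {X Y Z : RingedPoset.{u}} (f : X ⟶ Y) (g : Y ⟶ Z) (x : X) :
    Hom.base (f ≫ g) x = g.base (f.base x) := rfl

lemma id_stalk (X : RingedPoset.{u}) (x : X) : Hom.stalk (𝟙 X) x = 𝟙 (X.O.obj x) := rfl

lemma comp_stalk {X Y Z : RingedPoset.{u}} (f : X ⟶ Y) (g : Y ⟶ Z) (x : X) :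
    Hom.stalk (f ≫ g) x = g.stalk (f.base x) ≫ f.stalk x := rfl

lemma stalk_res {X Y : RingedPoset.{u}} (f : X ⟶ Y) {x y : X} (h : x ≤ y) :
    Y.res (f.base.monotone h) ≫ f.stalk y = f.stalk x ≫ X.res h :=
  f.sharp.naturality (homOfLE h)

@[simp] lemma res_self (X : RingedPoset.{u}) (x : X) (h : x ≤ x) : X.res h = 𝟙 _ :=
  X.O.map_id x

@[simp] lemma res_res (X : RingedPoset.{u}) {x y z : X} (h : x ≤ y) (h' : y ≤ z) :
    X.res h ≫ X.res h' = X.res (h.trans h') :=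
  (X.O.map_comp _ _).symm

/-- Morphisms of ringed posets agree if they agree on points and on stalks. -/
lemma hom_ext {X Y : RingedPoset.{u}} {f g : X ⟶ Y} (h : ∀ x, f.base x = g.base x)
    (h' : ∀ x, f.stalk x = Y.res (h x).le ≫ g.stalk x) : f = g := by
  obtain ⟨fb, fs⟩ := f
  obtain ⟨gb, gs⟩ := g
  obtain rfl : fb = gb := OrderHom.ext _ _ (funext h)
  refine Hom.ext rfl (heq_of_eq ?_)
  ext x : 2
  have := h' x
  rw [res_self] at this
  exact this.trans (Category.id_comp _)

/-- For `t ≤ x, y`, the canonical ring map `𝒪 x ⊗[𝒪 t] 𝒪 y ⟶ ∏_{z ≥ x, y} 𝒪 z`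
(the tensor product is the pushout of commutative rings). -/
noncomputable def tensorToProd (X : RingedPoset.{u}) {t x y : X} (hx : t ≤ x) (hy : t ≤ y) :
    pushout (X.res hx) (X.res hy) ⟶ CommRingCat.of (∀ z : {z : X // x ≤ z ∧ y ≤ z}, X.O.obj z) :=
  pushout.desc
    (CommRingCat.ofHom (RingHom.pi fun z => (X.res z.2.1).hom))
    (CommRingCat.ofHom (RingHom.pi fun z => (X.res z.2.2).hom))
    (by
      ext a z
      change ((X.res hx ≫ X.res z.2.1).hom a) = ((X.res hy ≫ X.res z.2.2).hom a)
      rw [res_res, res_res])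

/-- A finite ringed poset is a schematic space if its restriction maps are flat and the maps
`𝒪 x ⊗[𝒪 t] 𝒪 y ⟶ ∏_{z ≥ x, y} 𝒪 z`, `t ≤ x, y`, are faithfully flat. -/
structure IsSchematic (X : RingedPoset.{u}) : Prop where
  flat : ∀ {x y : X} (h : x ≤ y), (X.res h).hom.Flat
  faithfullyFlat : ∀ {t x y : X} (hx : t ≤ x) (hy : t ≤ y),
    (X.tensorToProd hx hy).hom.FaithfullyFlat

/-- For `y ≥ f x`, the canonical ring map
`𝒪_{X, x} ⊗[𝒪_{Y, f x}] 𝒪_{Y, y} ⟶ ∏_{z ≥ x, f z ≥ y} 𝒪_{X, z}`. -/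
noncomputable def Hom.tensorToProd {X Y : RingedPoset.{u}} (f : X ⟶ Y) {x : X} {y : Y}
    (h : f.base x ≤ y) :
    pushout (f.stalk x) (Y.res h) ⟶
      CommRingCat.of (∀ z : {z : X // x ≤ z ∧ y ≤ f.base z}, X.O.obj z) :=
  pushout.desc
    (CommRingCat.ofHom (RingHom.pi fun z => (X.res z.2.1).hom))
    (CommRingCat.ofHom (RingHom.pi fun z => (Y.res z.2.2 ≫ f.stalk z.1).hom))
    (by
      ext a z
      change ((f.stalk x ≫ X.res z.2.1).hom a) = ((Y.res h ≫ Y.res z.2.2 ≫ f.stalk z.1).hom a)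
      rw [← stalk_res, ← Category.assoc, res_res])

/-- A morphism `f : X ⟶ Y` is schematic if the maps
`𝒪_{X, x} ⊗[𝒪_{Y, f x}] 𝒪_{Y, y} ⟶ ∏_{z ≥ x, f z ≥ y} 𝒪_{X, z}`, `y ≥ f x`, induce surjections
between the prime spectra. -/
def Hom.IsSchematic {X Y : RingedPoset.{u}} (f : X ⟶ Y) : Prop :=
  ∀ (x : X) (y : Y) (h : f.base x ≤ y),
    Function.Surjective (PrimeSpectrum.comap (Hom.tensorToProd f h).hom)

/-! ### Pointwise form of the schematic conditions -/

section Pointwise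

open SchematicAux

/-- The image of `Spec 𝒪 y` in `Spec 𝒪 x`, for `x ≤ y`. -/
def im (X : RingedPoset.{u}) {x y : X} (h : x ≤ y) : Set (PrimeSpectrum (X.O.obj x)) :=
  Set.range (PrimeSpectrum.comap (X.res h).hom)

lemma IsSchematic.epi {X : RingedPoset.{u}} (hX : X.IsSchematic) {x y : X} (h : x ≤ y) :
    Epi (X.res h) := by
  have hinj := (hX.faithfullyFlat h h).injective
  have key : pushout.inl (X.res h) (X.res h) = pushout.inr (X.res h) (X.res h) := by
    ext a
    apply hinj
    change ((pushout.inl _ _ ≫ X.tensorToProd h h).hom a) =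
      ((pushout.inr _ _ ≫ X.tensorToProd h h).hom a)
    rw [tensorToProd, pushout.inl_desc, pushout.inr_desc]
  constructor
  intro Z a b hab
  have h1 : pushout.inl _ _ ≫ pushout.desc a b hab = a := pushout.inl_desc _ _ _
  have h2 : pushout.inr _ _ ≫ pushout.desc a b hab = b := pushout.inr_desc _ _ _
  rw [key] at h1
  exact h1.symm.trans h2

lemma IsSchematic.exists_le {X : RingedPoset.{u}} (hX : X.IsSchematic) {t x y : X} (hx : t ≤ x)
    (hy : t ≤ y) {p : PrimeSpectrum (X.O.obj t)} (hpx : p ∈ X.im hx) (hpy : p ∈ X.im hy) :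
    ∃ (z : X) (_ : x ≤ z) (_ : y ≤ z) (h : t ≤ z), p ∈ X.im h := by
  obtain ⟨q, rfl⟩ := hpx
  obtain ⟨q', hq'⟩ := hpy
  obtain ⟨r, hr, -⟩ := exists_prime (IsPushout.of_hasPushout (X.res hx) (X.res hy)) q q' hq'.symm
  obtain ⟨s, rfl⟩ := (RingHom.FaithfullyFlat.iff_flat_and_comap_surjective.1
    (hX.faithfullyFlat hx hy)).2 r
  obtain ⟨z, w, rfl⟩ := PrimeSpectrum.exists_comap_evalRingHom_eq s
  refine ⟨z.1, z.2.1, z.2.2, hx.trans z.2.1, w, ?_⟩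
  rw [← hr, ← res_res X hx z.2.1]
  have : X.res z.2.1 = pushout.inl _ _ ≫ X.tensorToProd hx hy ≫
      CommRingCat.ofHom (Pi.evalRingHom (fun z : {z : X // x ≤ z ∧ y ≤ z} => X.O.obj z) z) := by
    rw [tensorToProd, pushout.inl_desc_assoc]
    rfl
  rw [this]
  rfl

/-- Pointwise criterion for being schematic. -/
lemma isSchematic_of {X : RingedPoset.{u}} (hf : ∀ {x y : X} (h : x ≤ y), (X.res h).hom.Flat)
    (he : ∀ {x y : X} (h : x ≤ y), Epi (X.res h))
    (hp : ∀ {t x y : X} (hx : t ≤ x) (hy : t ≤ y) {p : PrimeSpectrum (X.O.obj t)},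
      p ∈ X.im hx → p ∈ X.im hy → ∃ (z : X) (_ : x ≤ z) (_ : y ≤ z) (h : t ≤ z), p ∈ X.im h) :
    X.IsSchematic := by
  refine ⟨hf, fun {t x y} hx hy => ?_⟩
  have := he hx
  have := he hy
  have hpo := IsPushout.of_hasPushout (X.res hx) (X.res hy)
  have := epi_inl hpo
  have key (z : {z : X // x ≤ z ∧ y ≤ z}) : pushout.inl _ _ ≫ X.tensorToProd hx hy ≫
      CommRingCat.ofHom (Pi.evalRingHom (fun z : {z : X // x ≤ z ∧ y ≤ z} => X.O.obj z) z) =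
      X.res z.2.1 := by
    rw [tensorToProd, pushout.inl_desc_assoc]
    rfl
  rw [RingHom.FaithfullyFlat.iff_flat_and_comap_surjective]
  constructor
  · refine flat_pi (fun z => (Pi.evalRingHom
      (fun z : {z : X // x ≤ z ∧ y ≤ z} => X.O.obj z) z).comp (X.tensorToProd hx hy).hom)
      (fun z => ?_)
    refine flat_of_epi_comp (pushout.inl (X.res hx) (X.res hy)) (X.tensorToProd hx hy ≫
      CommRingCat.ofHom (Pi.evalRingHom (fun z : {z : X // x ≤ z ∧ y ≤ z} => X.O.obj z) z)) ?_
    rw [key]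
    exact hf _
  · intro r
    have hr1 : PrimeSpectrum.comap (X.res hx ≫ pushout.inl (X.res hx) (X.res hy)).hom r
        ∈ X.im hx := ⟨PrimeSpectrum.comap (pushout.inl (X.res hx) (X.res hy)).hom r, rfl⟩
    have hr2 : PrimeSpectrum.comap (X.res hx ≫ pushout.inl (X.res hx) (X.res hy)).hom r
        ∈ X.im hy := by
      rw [pushout.condition]
      exact ⟨PrimeSpectrum.comap (pushout.inr (X.res hx) (X.res hy)).hom r, rfl⟩
    obtain ⟨z, hxz, hyz, htz, w, hw⟩ := hp hx hy hr1 hr2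
    refine ⟨PrimeSpectrum.comap (CommRingCat.ofHom (Pi.evalRingHom
      (fun z : {z : X // x ≤ z ∧ y ≤ z} => X.O.obj z) ⟨z, hxz, hyz⟩)).hom w, ?_⟩
    apply comap_injective_of_epi (X.res hx ≫ pushout.inl (X.res hx) (X.res hy))
    rw [← hw, ← res_res X hx hxz, ← key ⟨z, hxz, hyz⟩]
    rfl

lemma Hom.IsSchematic.exists_le {X Y : RingedPoset.{u}} {f : X ⟶ Y} (hf : Hom.IsSchematic f)
    {x : X} {y : Y} (h : f.base x ≤ y) {p : PrimeSpectrum (X.O.obj x)}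
    (hp : PrimeSpectrum.comap (f.stalk x).hom p ∈ Y.im h) :
    ∃ (z : X) (h : x ≤ z) (_ : y ≤ f.base z), p ∈ X.im h := by
  obtain ⟨q, hq⟩ := hp
  obtain ⟨r, rfl, -⟩ := exists_prime (IsPushout.of_hasPushout (f.stalk x) (Y.res h)) p q hq.symm
  obtain ⟨s, rfl⟩ := hf x y h r
  obtain ⟨z, w, rfl⟩ := PrimeSpectrum.exists_comap_evalRingHom_eq s
  refine ⟨z.1, z.2.1, z.2.2, w, ?_⟩
  have : X.res z.2.1 = pushout.inl _ _ ≫ Hom.tensorToProd f h ≫ CommRingCat.ofHom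
      (Pi.evalRingHom (fun z : {z : X // x ≤ z ∧ y ≤ f.base z} => X.O.obj z) z) := by
    rw [Hom.tensorToProd, pushout.inl_desc_assoc]
    rfl
  rw [this]
  rfl

/-- Pointwise criterion for a morphism to be schematic. -/
lemma Hom.isSchematic_of {X Y : RingedPoset.{u}} {f : X ⟶ Y} (hY : Y.IsSchematic)
    (hp : ∀ {x : X} {y : Y} (h : f.base x ≤ y) {p : PrimeSpectrum (X.O.obj x)},
      PrimeSpectrum.comap (f.stalk x).hom p ∈ Y.im h →
        ∃ (z : X) (h : x ≤ z) (_ : y ≤ f.base z), p ∈ X.im h) :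
    Hom.IsSchematic f := by
  intro x y h r
  have := hY.epi h
  have := epi_inl (IsPushout.of_hasPushout (f.stalk x) (Y.res h))
  obtain ⟨z, hxz, hyz, w, hw⟩ := hp h
    (p := PrimeSpectrum.comap (pushout.inl (f.stalk x) (Y.res h)).hom r) (by
      refine ⟨PrimeSpectrum.comap (pushout.inr (f.stalk x) (Y.res h)).hom r, ?_⟩
      change PrimeSpectrum.comap (Y.res h ≫ pushout.inr (f.stalk x) (Y.res h)).hom r =
        PrimeSpectrum.comap (f.stalk x ≫ pushout.inl (f.stalk x) (Y.res h)).hom r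
      rw [pushout.condition])
  refine ⟨PrimeSpectrum.comap (CommRingCat.ofHom (Pi.evalRingHom
      (fun z : {z : X // x ≤ z ∧ y ≤ f.base z} => X.O.obj z) ⟨z, hxz, hyz⟩)).hom w, ?_⟩
  apply comap_injective_of_epi (pushout.inl (f.stalk x) (Y.res h))
  rw [← hw]
  have : X.res hxz = pushout.inl _ _ ≫ Hom.tensorToProd f h ≫ CommRingCat.ofHom
      (Pi.evalRingHom (fun z : {z : X // x ≤ z ∧ y ≤ f.base z} => X.O.obj z) ⟨z, hxz, hyz⟩) := by
    rw [Hom.tensorToProd, pushout.inl_desc_assoc]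
    rfl
  rw [this]
  rfl

/-- A point of `Spec 𝒪 y`, `t ≤ y ≤ z`, comes from `Spec 𝒪 z` as soon as its image in `Spec 𝒪 t`
does. -/
lemma IsSchematic.mem_im {X : RingedPoset.{u}} (hX : X.IsSchematic) {t y z : X} (hty : t ≤ y)
    (hyz : y ≤ z) {p : PrimeSpectrum (X.O.obj y)}
    (h : PrimeSpectrum.comap (X.res hty).hom p ∈ X.im (hty.trans hyz)) : p ∈ X.im hyz := by
  obtain ⟨q, hq⟩ := h
  have := hX.epi hty
  refine ⟨q, comap_injective_of_epi (X.res hty) ?_⟩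
  rw [← hq, ← res_res X hty hyz]
  rfl

lemma im_mono (X : RingedPoset.{u}) {x y z : X} (hy : x ≤ y) (hyz : y ≤ z)
    {p : PrimeSpectrum (X.O.obj x)} (h : p ∈ X.im (hy.trans hyz)) : p ∈ X.im hy := by
  obtain ⟨q, rfl⟩ := h
  exact ⟨PrimeSpectrum.comap (X.res hyz).hom q, by rw [← res_res X hy hyz]; rfl⟩

lemma Hom.comap_mem_im {X Y : RingedPoset.{u}} (f : X ⟶ Y) {x x' : X} (h : x ≤ x')
    {p : PrimeSpectrum (X.O.obj x)} (hp : p ∈ X.im h) :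
    PrimeSpectrum.comap (f.stalk x).hom p ∈ Y.im (f.base.monotone h) := by
  obtain ⟨q, rfl⟩ := hp
  refine ⟨PrimeSpectrum.comap (f.stalk x').hom q, ?_⟩
  change PrimeSpectrum.comap (Y.res (f.base.monotone h) ≫ f.stalk x').hom q = _
  rw [stalk_res]
  rfl

lemma mem_im_self (X : RingedPoset.{u}) (x : X) (p : PrimeSpectrum (X.O.obj x)) :
    p ∈ X.im (le_refl x) := ⟨p, by rw [res_self]; rfl⟩

lemma id_isSchematic {X : RingedPoset.{u}} (hX : X.IsSchematic) : Hom.IsSchematic (𝟙 X) :=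
  Hom.isSchematic_of hX fun {_ y} h _ hp => ⟨y, h, le_refl y, hp⟩

lemma comp_isSchematic {X Y Z : RingedPoset.{u}} {f : X ⟶ Y} {g : Y ⟶ Z} (hZ : Z.IsSchematic)
    (hf : Hom.IsSchematic f) (hg : Hom.IsSchematic g) : Hom.IsSchematic (f ≫ g) := by
  refine Hom.isSchematic_of hZ fun {x z} h p hp => ?_
  obtain ⟨y, hy, hyz, hpy⟩ := hg.exists_le (x := f.base x) h
    (p := PrimeSpectrum.comap (Hom.stalk f x).hom p) hp
  obtain ⟨w, hw, hwy, hpw⟩ := hf.exists_le hy hpy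
  exact ⟨w, hw, hyz.trans (g.base.monotone hwy), hpw⟩

end Pointwise

end RingedPoset

namespace SchematicAux

section

variable {A B C P A' B' C' P' : CommRingCat.{u}} {a : A ⟶ B} {b : A ⟶ C} {i : B ⟶ P} {j : C ⟶ P}
  {a' : A' ⟶ B'} {b' : A' ⟶ C'} {i' : B' ⟶ P'} {j' : C' ⟶ P'}
  {α : A ⟶ A'} {β : B ⟶ B'} {γ : C ⟶ C'} {π : P ⟶ P'}

/-- For epimorphisms `A ⟶ A'`, `B ⟶ B'`, `C ⟶ C'`, the ring `B' ⊗[A'] C'` is obtained from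
`B ⊗[A] C` by two successive base changes, along `B ⟶ B'` and `C ⟶ C'`. -/
lemma exists_iso (h : IsPushout a b i j) (h' : IsPushout a' b' i' j') [Epi α]
    (ha : a ≫ β = α ≫ a') (hb : b ≫ γ = α ≫ b') (hi : i ≫ π = β ≫ i') (hj : j ≫ π = γ ≫ j') :
    ∃ e : pushout (j ≫ pushout.inl i β) γ ≅ P',
      pushout.inl i β ≫ pushout.inl (j ≫ pushout.inl i β) γ ≫ e.hom = π ∧
      pushout.inr i β ≫ pushout.inl (j ≫ pushout.inl i β) γ ≫ e.hom = i' ∧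
      pushout.inr (j ≫ pushout.inl i β) γ ≫ e.hom = j' := by
  have hA : a' ≫ pushout.inr i β ≫ pushout.inl (j ≫ pushout.inl i β) γ =
      b' ≫ pushout.inr (j ≫ pushout.inl i β) γ := by
    rw [← cancel_epi α, ← reassoc_of% ha, ← reassoc_of% hb, ← pushout.condition_assoc,
      ← pushout.condition, reassoc_of% h.w, Category.assoc]
  have w1 : j ≫ pushout.inl i β ≫ pushout.desc π i' hi = γ ≫ j' := by
    rw [pushout.inl_desc, hj]
  refine ⟨⟨pushout.desc (pushout.desc π i' hi) j' (by rw [Category.assoc, w1]),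
    h'.desc _ _ hA, ?_, ?_⟩, ?_, ?_, ?_⟩
  · apply pushout.hom_ext
    · apply pushout.hom_ext
      · rw [pushout.inl_desc_assoc, pushout.inl_desc_assoc, Category.comp_id]
        apply h.hom_ext
        · rw [reassoc_of% hi, h'.inl_desc, pushout.condition_assoc]
        · rw [reassoc_of% hj, h'.inr_desc, ← pushout.condition, Category.assoc]
      · rw [pushout.inl_desc_assoc, pushout.inr_desc_assoc, Category.comp_id, h'.inl_desc]
    · rw [pushout.inr_desc_assoc, h'.inr_desc, Category.comp_id]
  · apply h'.hom_ext
    · rw [h'.inl_desc_assoc, Category.assoc, pushout.inl_desc, pushout.inr_desc, Category.comp_id]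
    · rw [h'.inr_desc_assoc, pushout.inr_desc, Category.comp_id]
  · simp only [pushout.inl_desc]
  · simp only [pushout.inl_desc, pushout.inr_desc]
  · simp only [pushout.inr_desc]

lemma tensor_epi (h : IsPushout a b i j) (h' : IsPushout a' b' i' j') [Epi α] [Epi β] [Epi γ]
    (ha : a ≫ β = α ≫ a') (hb : b ≫ γ = α ≫ b') (hi : i ≫ π = β ≫ i') (hj : j ≫ π = γ ≫ j') :
    Epi π := by
  obtain ⟨e, rfl, -, -⟩ := exists_iso h h' ha hb hi hj
  have := epi_inl (IsPushout.of_hasPushout i β)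
  have := epi_inl (IsPushout.of_hasPushout (j ≫ pushout.inl i β) γ)
  infer_instance

lemma tensor_flat (h : IsPushout a b i j) (h' : IsPushout a' b' i' j') [Epi α]
    (hβ : β.hom.Flat) (hγ : γ.hom.Flat)
    (ha : a ≫ β = α ≫ a') (hb : b ≫ γ = α ≫ b') (hi : i ≫ π = β ≫ i') (hj : j ≫ π = γ ≫ j') :
    π.hom.Flat := by
  obtain ⟨e, rfl, -, -⟩ := exists_iso h h' ha hb hi hj
  rw [← CommRingCat.flat_iff] at hβ hγ
  have h1 := MorphismProperty.of_isPushout (IsPushout.of_hasPushout i β) hβ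
  have h2 := MorphismProperty.of_isPushout (IsPushout.of_hasPushout (j ≫ pushout.inl i β) γ) hγ
  rw [CommRingCat.flat_iff] at h1 h2
  have h3 : e.hom.hom.Flat :=
    RingHom.Flat.of_bijective (ConcreteCategory.bijective_of_isIso e.hom)
  exact RingHom.Flat.comp h1 (RingHom.Flat.comp h2 h3)

lemma tensor_range (h : IsPushout a b i j) (h' : IsPushout a' b' i' j') [Epi α]
    (ha : a ≫ β = α ≫ a') (hb : b ≫ γ = α ≫ b') (hi : i ≫ π = β ≫ i') (hj : j ≫ π = γ ≫ j')
    (p : PrimeSpectrum P)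
    (h1 : PrimeSpectrum.comap i.hom p ∈ Set.range (PrimeSpectrum.comap β.hom))
    (h2 : PrimeSpectrum.comap j.hom p ∈ Set.range (PrimeSpectrum.comap γ.hom)) :
    p ∈ Set.range (PrimeSpectrum.comap π.hom) := by
  obtain ⟨e, rfl, -, -⟩ := exists_iso h h' ha hb hi hj
  obtain ⟨q, hq⟩ := h1
  obtain ⟨q', hq'⟩ := h2
  obtain ⟨r, rfl, -⟩ := exists_prime (IsPushout.of_hasPushout i β) p q hq.symm
  obtain ⟨s, rfl, -⟩ := exists_prime (IsPushout.of_hasPushout (j ≫ pushout.inl i β) γ) r q' hq'.symm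
  refine ⟨PrimeSpectrum.comap e.inv.hom s, ?_⟩
  change PrimeSpectrum.comap ((pushout.inl i β ≫ pushout.inl (j ≫ pushout.inl i β) γ ≫ e.hom) ≫
    e.inv).hom s = _
  simp only [Category.assoc, Iso.hom_inv_id, Category.comp_id]
  rfl

end

end SchematicAux

/-- The category of (finite) schematic spaces: objects. -/
structure SchFin where
  toRingedPoset : RingedPoset.{u}
  isSchematic : toRingedPoset.IsSchematic

namespace SchFin

instance : CoeSort SchFin.{u} (Type u) := ⟨fun X => X.toRingedPoset.carrier⟩

/-- Schematic morphisms. -/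
@[ext]
structure Hom (X Y : SchFin.{u}) where
  hom : X.toRingedPoset ⟶ Y.toRingedPoset
  isSchematic : RingedPoset.Hom.IsSchematic hom

instance : Category SchFin.{u} where
  Hom := Hom
  id X := ⟨𝟙 X.toRingedPoset, RingedPoset.id_isSchematic X.isSchematic⟩
  comp {_ _ Z} f g :=
    ⟨f.hom ≫ g.hom, RingedPoset.comp_isSchematic Z.isSchematic f.isSchematic g.isSchematic⟩

@[simp] lemma id_hom (X : SchFin.{u}) : Hom.hom (𝟙 X) = 𝟙 X.toRingedPoset := rfl

@[simp] lemma comp_hom {X Y Z : SchFin.{u}} (f : X ⟶ Y) (g : Y ⟶ Z) :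
    Hom.hom (f ≫ g) = f.hom ≫ g.hom := rfl

lemma hom_ext {X Y : SchFin.{u}} {f g : X ⟶ Y} (h : f.hom = g.hom) : f = g := Hom.ext h

/-- The ring `𝒪_{X, x}`. -/
abbrev O (X : SchFin.{u}) (x : X) : CommRingCat.{u} := X.toRingedPoset.O.obj x

end SchFin

/-! ### Fibered products -/

namespace RingedPoset

lemma stalk_congr {X Y : RingedPoset.{u}} {f g : X ⟶ Y} (h : f = g) (x : X) :
    f.stalk x = Y.res (le_of_eq (by rw [h])) ≫ g.stalk x := by
  subst h
  rw [res_self, Category.id_comp]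

section FiberProduct

variable {X Y Z : RingedPoset.{u}} (f : X ⟶ Z) (g : Y ⟶ Z)

/-- The fibered product of ringed posets: pairs `(x, y)` with `f x = g y`, and the rings
`𝒪_{X, x} ⊗[𝒪_{Z, f x}] 𝒪_{Y, y}`. -/
noncomputable def fiberProduct : RingedPoset.{u} where
  carrier := {w : X × Y // f.base w.1 = g.base w.2}
  O :=
    { obj := fun w => pushout (f.stalk w.1.1) (Z.res w.2.le ≫ g.stalk w.1.2)
      map := fun {w w'} h => pushout.desc
        (X.res (leOfHom h).1 ≫ pushout.inl (f.stalk w'.1.1) (Z.res w'.2.le ≫ g.stalk w'.1.2))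
        (Y.res (leOfHom h).2 ≫ pushout.inr (f.stalk w'.1.1) (Z.res w'.2.le ≫ g.stalk w'.1.2))
        (by
          rw [← Category.assoc, ← Category.assoc, Category.assoc (Z.res _), ← stalk_res,
            ← stalk_res, Category.assoc, pushout.condition, ← Category.assoc, ← Category.assoc,
            ← Category.assoc, res_res, res_res])
      map_id := fun w => by
        apply pushout.hom_ext
        · rw [pushout.inl_desc, res_self, Category.id_comp, Category.comp_id]
        · rw [pushout.inr_desc, res_self, Category.id_comp, Category.comp_id]
      map_comp := fun {w w' w''} h h' => by
        apply pushout.hom_ext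
        · rw [pushout.inl_desc, pushout.inl_desc_assoc, Category.assoc, pushout.inl_desc,
            ← Category.assoc, res_res]
        · rw [pushout.inr_desc, pushout.inr_desc_assoc, Category.assoc, pushout.inr_desc,
            ← Category.assoc, res_res] }

namespace fiberProduct

noncomputable def fst : fiberProduct f g ⟶ X where
  base := ⟨fun w => w.1.1, fun _ _ h => h.1⟩
  sharp := ⟨fun w => pushout.inl (f.stalk w.1.1) (Z.res w.2.le ≫ g.stalk w.1.2),
    fun _ _ _ => (pushout.inl_desc ..).symm⟩

noncomputable def snd : fiberProduct f g ⟶ Y where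
  base := ⟨fun w => w.1.2, fun _ _ h => h.2⟩
  sharp := ⟨fun w => pushout.inr (f.stalk w.1.1) (Z.res w.2.le ≫ g.stalk w.1.2),
    fun _ _ _ => (pushout.inr_desc ..).symm⟩

variable {f g}

lemma isPushout (w : fiberProduct f g) :
    IsPushout (f.stalk w.1.1) (Z.res w.2.le ≫ g.stalk w.1.2) ((fst f g).stalk w)
      ((snd f g).stalk w) :=
  IsPushout.of_hasPushout _ _

variable (f g) in
lemma condition : fst f g ≫ f = snd f g ≫ g := by
  refine hom_ext (fun w => w.2) (fun w => ?_)
  exact (isPushout w).w.trans (Category.assoc _ _ _)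

/-- The morphism to the fibered product given by its universal property. -/
noncomputable def lift {T : RingedPoset.{u}} (a : T ⟶ X) (b : T ⟶ Y) (h : a ≫ f = b ≫ g) :
    T ⟶ fiberProduct f g where
  base := ⟨fun t => ⟨(a.base t, b.base t),
      congrArg (fun φ : T ⟶ Z => Hom.base φ t) h⟩,
    fun _ _ h => ⟨a.base.monotone h, b.base.monotone h⟩⟩
  sharp := ⟨fun t => pushout.desc (a.stalk t) (b.stalk t)
    ((stalk_congr h t).trans (Category.assoc _ _ _).symm), fun t t' h => by
      apply pushout.hom_ext
      · refine (pushout.inl_desc_assoc _ _ _ _).trans ?_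
        refine ((Category.assoc _ _ _).trans (congrArg _ (pushout.inl_desc _ _ _))).trans ?_
        refine (stalk_res a (leOfHom h)).trans ?_
        exact (pushout.inl_desc_assoc _ _ _ _).symm
      · refine (pushout.inr_desc_assoc _ _ _ _).trans ?_
        refine ((Category.assoc _ _ _).trans (congrArg _ (pushout.inr_desc _ _ _))).trans ?_
        refine (stalk_res b (leOfHom h)).trans ?_
        exact (pushout.inr_desc_assoc _ _ _ _).symm⟩

lemma lift_fst {T : RingedPoset.{u}} (a : T ⟶ X) (b : T ⟶ Y) (h : a ≫ f = b ≫ g) :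
    lift a b h ≫ fst f g = a := by
  refine RingedPoset.hom_ext (fun _ => rfl) (fun t => ?_)
  refine (pushout.inl_desc _ _ _ : _ = a.stalk t).trans ?_
  exact ((congrArg (· ≫ a.stalk t) (X.res_self _ _)).trans (Category.id_comp _)).symm

lemma lift_snd {T : RingedPoset.{u}} (a : T ⟶ X) (b : T ⟶ Y) (h : a ≫ f = b ≫ g) :
    lift a b h ≫ snd f g = b := by
  refine RingedPoset.hom_ext (fun _ => rfl) (fun t => ?_)
  refine (pushout.inr_desc _ _ _ : _ = b.stalk t).trans ?_
  exact ((congrArg (· ≫ b.stalk t) (Y.res_self _ _)).trans (Category.id_comp _)).symm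

lemma hom_ext {T : RingedPoset.{u}} {c d : T ⟶ fiberProduct f g}
    (h1 : c ≫ fst f g = d ≫ fst f g) (h2 : c ≫ snd f g = d ≫ snd f g) : c = d := by
  have hb : ∀ t, c.base t = d.base t := fun t => Subtype.ext (Prod.ext
    (congrArg (fun φ : T ⟶ X => Hom.base φ t) h1) (congrArg (fun φ : T ⟶ Y => Hom.base φ t) h2))
  refine RingedPoset.hom_ext hb (fun t => ?_)
  apply (isPushout (c.base t)).hom_ext
  · refine (stalk_congr h1 t).trans ?_
    refine ((Category.assoc _ _ _).symm.trans (congrArg (· ≫ d.stalk t)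
      (stalk_res (fst f g) (hb t).le))).trans (Category.assoc _ _ _)
  · refine (stalk_congr h2 t).trans ?_
    refine ((Category.assoc _ _ _).symm.trans (congrArg (· ≫ d.stalk t)
      (stalk_res (snd f g) (hb t).le))).trans (Category.assoc _ _ _)

end fiberProduct

end FiberProduct

end RingedPoset

namespace RingedPoset

lemma im_trans (X : RingedPoset.{u}) {x y z : X} (hx : x ≤ y) (hy : y ≤ z)
    {q : PrimeSpectrum (X.O.obj y)} (h : q ∈ X.im hy) :
    PrimeSpectrum.comap (X.res hx).hom q ∈ X.im (hx.trans hy) := by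
  obtain ⟨r, rfl⟩ := h
  exact ⟨r, by rw [← res_res X hx hy]; rfl⟩

namespace fiberProduct

open SchematicAux

variable {X Y Z : RingedPoset.{u}} {f : X ⟶ Z} {g : Y ⟶ Z}

lemma res_sq (w w' : fiberProduct f g) (h : w ≤ w') :
    (Z.res w.2.le ≫ g.stalk w.1.2) ≫ Y.res h.2 =
      Z.res (f.base.monotone h.1) ≫ Z.res w'.2.le ≫ g.stalk w'.1.2 := by
  rw [Category.assoc, ← stalk_res, ← Category.assoc, ← Category.assoc, res_res, res_res]

lemma epi_res (hX : X.IsSchematic) (hY : Y.IsSchematic) (hZ : Z.IsSchematic)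
    {w w' : fiberProduct f g} (h : w ≤ w') : Epi ((fiberProduct f g).res h) := by
  have := hX.epi h.1
  have := hY.epi h.2
  have := hZ.epi (f.base.monotone h.1)
  exact tensor_epi (isPushout w) (isPushout w') (stalk_res f h.1).symm (res_sq w w' h)
    (stalk_res (fst f g) h).symm (stalk_res (snd f g) h).symm

lemma flat_res (hX : X.IsSchematic) (hY : Y.IsSchematic) (hZ : Z.IsSchematic)
    {w w' : fiberProduct f g} (h : w ≤ w') : ((fiberProduct f g).res h).hom.Flat := by
  have := hZ.epi (f.base.monotone h.1)
  exact tensor_flat (isPushout w) (isPushout w') (hX.flat h.1) (hY.flat h.2)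
    (stalk_res f h.1).symm (res_sq w w' h)
    (stalk_res (fst f g) h).symm (stalk_res (snd f g) h).symm

lemma mem_im (hZ : Z.IsSchematic) {w w' : fiberProduct f g} (h : w ≤ w')
    (p : PrimeSpectrum ((fiberProduct f g).O.obj w))
    (h1 : PrimeSpectrum.comap ((fst f g).stalk w).hom p ∈ X.im h.1)
    (h2 : PrimeSpectrum.comap ((snd f g).stalk w).hom p ∈ Y.im h.2) :
    p ∈ (fiberProduct f g).im h := by
  have := hZ.epi (f.base.monotone h.1)
  exact tensor_range (isPushout w) (isPushout w') (stalk_res f h.1).symm (res_sq w w' h)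
    (stalk_res (fst f g) h).symm (stalk_res (snd f g) h).symm p h1 h2

section Zigzag

variable {w : fiberProduct f g} {p : PrimeSpectrum ((fiberProduct f g).O.obj w)}

lemma comap_left {u : X} (hu : w.1.1 ≤ u) {q : PrimeSpectrum (X.O.obj u)}
    (hq : PrimeSpectrum.comap (X.res hu).hom q = PrimeSpectrum.comap ((fst f g).stalk w).hom p) :
    PrimeSpectrum.comap (Z.res (f.base.monotone hu)).hom
        (PrimeSpectrum.comap (f.stalk u).hom q) =
      PrimeSpectrum.comap (f.stalk w.1.1 ≫ (fst f g).stalk w).hom p := by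
  change PrimeSpectrum.comap (Z.res (f.base.monotone hu) ≫ f.stalk u).hom q =
    PrimeSpectrum.comap (f.stalk w.1.1).hom (PrimeSpectrum.comap ((fst f g).stalk w).hom p)
  refine Eq.trans ?_ (congrArg (PrimeSpectrum.comap (f.stalk w.1.1).hom) hq)
  rw [stalk_res]
  rfl

lemma comap_right {v : Y} (hv : w.1.2 ≤ v) {q : PrimeSpectrum (Y.O.obj v)}
    (hq : PrimeSpectrum.comap (Y.res hv).hom q = PrimeSpectrum.comap ((snd f g).stalk w).hom p) :
    PrimeSpectrum.comap (Z.res (w.2.le.trans (g.base.monotone hv))).hom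
        (PrimeSpectrum.comap (g.stalk v).hom q) =
      PrimeSpectrum.comap (f.stalk w.1.1 ≫ (fst f g).stalk w).hom p := by
  rw [(isPushout w).w]
  change PrimeSpectrum.comap (Z.res (w.2.le.trans (g.base.monotone hv)) ≫ g.stalk v).hom q =
    PrimeSpectrum.comap (Z.res w.2.le ≫ g.stalk w.1.2).hom
      (PrimeSpectrum.comap ((snd f g).stalk w).hom p)
  refine Eq.trans ?_ (congrArg (PrimeSpectrum.comap (Z.res w.2.le ≫ g.stalk w.1.2).hom) hq)
  rw [← comap_comp_apply, Category.assoc, ← stalk_res, ← Category.assoc, res_res]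

lemma mem_left {u : X} (hu : w.1.1 ≤ u)
    (h : PrimeSpectrum.comap ((fst f g).stalk w).hom p ∈ X.im hu) :
    PrimeSpectrum.comap (f.stalk w.1.1 ≫ (fst f g).stalk w).hom p ∈
      Z.im (f.base.monotone hu) := by
  obtain ⟨q, hq⟩ := h
  exact ⟨_, comap_left hu hq⟩

lemma mem_right {v : Y} (hv : w.1.2 ≤ v)
    (h : PrimeSpectrum.comap ((snd f g).stalk w).hom p ∈ Y.im hv) :
    PrimeSpectrum.comap (f.stalk w.1.1 ≫ (fst f g).stalk w).hom p ∈
      Z.im (w.2.le.trans (g.base.monotone hv)) := by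
  obtain ⟨q, hq⟩ := h
  exact ⟨_, comap_right hv hq⟩

lemma step_left (hZ : Z.IsSchematic) (hf : Hom.IsSchematic f) {u : X} (hu : w.1.1 ≤ u)
    (h : PrimeSpectrum.comap ((fst f g).stalk w).hom p ∈ X.im hu) {c : Z} (hc : f.base u ≤ c)
    (hpc : PrimeSpectrum.comap (f.stalk w.1.1 ≫ (fst f g).stalk w).hom p ∈
      Z.im ((f.base.monotone hu).trans hc)) :
    ∃ (u' : X) (h' : u ≤ u') (_ : c ≤ f.base u'),
      PrimeSpectrum.comap ((fst f g).stalk w).hom p ∈ X.im (hu.trans h') := by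
  obtain ⟨q, hq⟩ := h
  obtain ⟨u', h', hcu, hqu⟩ := hf.exists_le hc (p := q)
    (hZ.mem_im (f.base.monotone hu) hc (by rwa [comap_left hu hq]))
  exact ⟨u', h', hcu, hq ▸ im_trans X hu h' hqu⟩

lemma step_right (hZ : Z.IsSchematic) (hg : Hom.IsSchematic g) {v : Y} (hv : w.1.2 ≤ v)
    (h : PrimeSpectrum.comap ((snd f g).stalk w).hom p ∈ Y.im hv) {c : Z} (hc : g.base v ≤ c)
    (hpc : PrimeSpectrum.comap (f.stalk w.1.1 ≫ (fst f g).stalk w).hom p ∈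
      Z.im ((w.2.le.trans (g.base.monotone hv)).trans hc)) :
    ∃ (v' : Y) (h' : v ≤ v') (_ : c ≤ g.base v'),
      PrimeSpectrum.comap ((snd f g).stalk w).hom p ∈ Y.im (hv.trans h') := by
  obtain ⟨q, hq⟩ := h
  obtain ⟨v', h', hcv, hqv⟩ := hg.exists_le hc (p := q)
    (hZ.mem_im (w.2.le.trans (g.base.monotone hv)) hc (by rwa [comap_right hv hq]))
  exact ⟨v', h', hcv, hq ▸ im_trans Y hv h' hqv⟩

lemma zigzag_aux (hZ : Z.IsSchematic) (hf : Hom.IsSchematic f) (hg : Hom.IsSchematic g) (v : Y) :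
    ∀ (u : X) (hu : w.1.1 ≤ u) (hv : w.1.2 ≤ v),
      PrimeSpectrum.comap ((fst f g).stalk w).hom p ∈ X.im hu →
      PrimeSpectrum.comap ((snd f g).stalk w).hom p ∈ Y.im hv →
      g.base v ≤ f.base u →
      ∃ (w' : fiberProduct f g) (h : w ≤ w'), u ≤ w'.1.1 ∧ v ≤ w'.1.2 ∧
        p ∈ (fiberProduct f g).im h := by
  induction v using WellFoundedGT.induction with
  | _ v ih =>
    intro u hu hv hpu hpv hle
    by_cases heq : f.base u = g.base v
    · exact ⟨⟨(u, v), heq⟩, ⟨hu, hv⟩, le_refl _, le_refl _, mem_im hZ _ _ hpu hpv⟩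
    · obtain ⟨v', hvv', huv', hpv'⟩ := step_right hZ hg hv hpv hle (mem_left hu hpu)
      obtain ⟨u', huu', hvu', hpu'⟩ := step_left hZ hf hu hpu huv' (mem_right (hv.trans hvv') hpv')
      have hlt : v < v' := lt_of_le_of_ne hvv' (by
        rintro rfl
        exact heq (le_antisymm huv' hle))
      obtain ⟨w', h, h1, h2, h3⟩ := ih v' hlt u' (hu.trans huu') (hv.trans hvv') hpu' hpv' hvu'
      exact ⟨w', h, huu'.trans h1, hvv'.trans h2, h3⟩

lemma zigzag (hZ : Z.IsSchematic) (hf : Hom.IsSchematic f) (hg : Hom.IsSchematic g) {u : X} {v : Y}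
    (hu : w.1.1 ≤ u) (hv : w.1.2 ≤ v)
    (hpu : PrimeSpectrum.comap ((fst f g).stalk w).hom p ∈ X.im hu)
    (hpv : PrimeSpectrum.comap ((snd f g).stalk w).hom p ∈ Y.im hv) :
    ∃ (w' : fiberProduct f g) (h : w ≤ w'), u ≤ w'.1.1 ∧ v ≤ w'.1.2 ∧
      p ∈ (fiberProduct f g).im h := by
  obtain ⟨c, huc, hvc, h0, hc⟩ := hZ.exists_le _ _ (mem_left hu hpu) (mem_right hv hpv)
  obtain ⟨u', huu', hcu', hpu'⟩ := step_left hZ hf hu hpu huc hc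
  obtain ⟨w', h, h1, h2, h3⟩ := zigzag_aux hZ hf hg v u' (hu.trans huu') hv hpu' hpv
    (hvc.trans hcu')
  exact ⟨w', h, huu'.trans h1, h2, h3⟩

end Zigzag

lemma isSchematic (hX : X.IsSchematic) (hY : Y.IsSchematic) (hZ : Z.IsSchematic)
    (hf : Hom.IsSchematic f) (hg : Hom.IsSchematic g) : (fiberProduct f g).IsSchematic := by
  refine isSchematic_of (flat_res hX hY hZ) (epi_res hX hY hZ) fun {t x y} hx hy p hpx hpy => ?_
  obtain ⟨u, hxu, hyu, htu, hpu⟩ := hX.exists_le _ _ (Hom.comap_mem_im (fst f g) hx hpx)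
    (Hom.comap_mem_im (fst f g) hy hpy)
  obtain ⟨v, hxv, hyv, htv, hpv⟩ := hY.exists_le _ _ (Hom.comap_mem_im (snd f g) hx hpx)
    (Hom.comap_mem_im (snd f g) hy hpy)
  obtain ⟨w', h, h1, h2, h3⟩ := zigzag hZ hf hg htu htv hpu hpv
  exact ⟨w', ⟨hxu.trans h1, hxv.trans h2⟩, ⟨hyu.trans h1, hyv.trans h2⟩, h, h3⟩

lemma fst_isSchematic (hX : X.IsSchematic) (hZ : Z.IsSchematic)
    (hf : Hom.IsSchematic f) (hg : Hom.IsSchematic g) : Hom.IsSchematic (fst f g) := by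
  refine Hom.isSchematic_of hX fun {w u} hu p hp => ?_
  obtain ⟨w', h, h1, -, h3⟩ := zigzag hZ hf hg (v := w.1.2) hu (le_refl _) hp (mem_im_self _ _ _)
  exact ⟨w', h, h1, h3⟩

lemma snd_isSchematic (hY : Y.IsSchematic) (hZ : Z.IsSchematic)
    (hf : Hom.IsSchematic f) (hg : Hom.IsSchematic g) : Hom.IsSchematic (snd f g) := by
  refine Hom.isSchematic_of hY fun {w v} hv p hp => ?_
  obtain ⟨w', h, -, h2, h3⟩ := zigzag hZ hf hg (u := w.1.1) (le_refl _) hv (mem_im_self _ _ _) hp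
  exact ⟨w', h, h2, h3⟩

lemma lift_isSchematic (hX : X.IsSchematic) (hY : Y.IsSchematic) (hZ : Z.IsSchematic)
    (hf : Hom.IsSchematic f) (hg : Hom.IsSchematic g) {T : RingedPoset.{u}} (hT : T.IsSchematic)
    {a : T ⟶ X} {b : T ⟶ Y} (h : a ≫ f = b ≫ g) (ha : Hom.IsSchematic a)
    (hb : Hom.IsSchematic b) : Hom.IsSchematic (lift a b h) := by
  refine Hom.isSchematic_of (isSchematic hX hY hZ hf hg) fun {t w} hw p hp => ?_
  have h1 := Hom.comap_mem_im (fst f g) hw hp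
  have h2 := Hom.comap_mem_im (snd f g) hw hp
  rw [← SchematicAux.comap_comp_apply] at h1 h2
  have e1 : (fst f g).stalk ((lift a b h).base t) ≫ (lift a b h).stalk t = a.stalk t :=
    pushout.inl_desc _ _ _
  have e2 : (snd f g).stalk ((lift a b h).base t) ≫ (lift a b h).stalk t = b.stalk t :=
    pushout.inr_desc _ _ _
  rw [e1] at h1
  rw [e2] at h2
  obtain ⟨x, hx, hwx, hpx⟩ := ha.exists_le hw.1 h1
  obtain ⟨y, hy, hwy, hpy⟩ := hb.exists_le hw.2 h2
  obtain ⟨z, hxz, hyz, hz, hpz⟩ := hT.exists_le hx hy hpx hpy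
  exact ⟨z, hz, ⟨hwx.trans (a.base.monotone hxz), hwy.trans (b.base.monotone hyz)⟩, hpz⟩

end fiberProduct

end RingedPoset

namespace SchFin

open RingedPoset

section

variable {X Y Z : SchFin.{u}} (f : X ⟶ Z) (g : Y ⟶ Z)

/-- The fibered product of schematic spaces: the fibered product of the underlying ringed posets
is schematic. -/
noncomputable def fiberProduct : SchFin.{u} where
  toRingedPoset := RingedPoset.fiberProduct f.hom g.hom
  isSchematic := fiberProduct.isSchematic X.isSchematic Y.isSchematic Z.isSchematic
    f.isSchematic g.isSchematic

noncomputable def fiberProduct.fst : fiberProduct f g ⟶ X :=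
  ⟨RingedPoset.fiberProduct.fst f.hom g.hom, RingedPoset.fiberProduct.fst_isSchematic X.isSchematic
    Z.isSchematic f.isSchematic g.isSchematic⟩

noncomputable def fiberProduct.snd : fiberProduct f g ⟶ Y :=
  ⟨RingedPoset.fiberProduct.snd f.hom g.hom, RingedPoset.fiberProduct.snd_isSchematic Y.isSchematic
    Z.isSchematic f.isSchematic g.isSchematic⟩

lemma fiberProduct.isPullback :
    IsPullback (fiberProduct.fst f g) (fiberProduct.snd f g) f g where
  w := SchFin.hom_ext (RingedPoset.fiberProduct.condition f.hom g.hom)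
  isLimit' := ⟨PullbackCone.IsLimit.mk _
    (fun s => ⟨RingedPoset.fiberProduct.lift s.fst.hom s.snd.hom (congrArg Hom.hom s.condition),
      RingedPoset.fiberProduct.lift_isSchematic X.isSchematic Y.isSchematic Z.isSchematic
        f.isSchematic g.isSchematic s.pt.isSchematic _ s.fst.isSchematic s.snd.isSchematic⟩)
    (fun s => SchFin.hom_ext (RingedPoset.fiberProduct.lift_fst s.fst.hom s.snd.hom
      (congrArg Hom.hom s.condition)))
    (fun s => SchFin.hom_ext (RingedPoset.fiberProduct.lift_snd s.fst.hom s.snd.hom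
      (congrArg Hom.hom s.condition)))
    (fun s _ h1 h2 => SchFin.hom_ext (RingedPoset.fiberProduct.hom_ext
      ((congrArg Hom.hom h1).trans (RingedPoset.fiberProduct.lift_fst s.fst.hom s.snd.hom
        (congrArg Hom.hom s.condition)).symm)
      ((congrArg Hom.hom h2).trans (RingedPoset.fiberProduct.lift_snd s.fst.hom s.snd.hom
        (congrArg Hom.hom s.condition)).symm)))⟩

end

instance : HasPullbacks SchFin.{u} :=
  have {X Y Z : SchFin.{u}} (f : X ⟶ Z) (g : Y ⟶ Z) : HasLimit (cospan f g) :=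
    (fiberProduct.isPullback f g).hasPullback
  hasPullbacks_of_hasLimit_cospan _

/-- Finite fibered products over `X` exist: they are the finite products of the category of
schematic spaces over `X`. -/
instance (X : SchFin.{u}) : HasFiniteProducts (Over X) :=
  have := Over.ConstructProducts.over_binaryProduct_of_pullback (B := X)
  hasFiniteProducts_of_has_binary_and_terminal

end SchFin

/-! ### The functor `Spec`, qc-isomorphisms and flat immersions -/

namespace RingedPoset

open AlgebraicGeometry

/-- The diagram of affine schemes `Spec 𝒪 x`, `x ∈ X`. -/
noncomputable abbrev specDiagram (X : RingedPoset.{u}) : (X : Type u)ᵒᵖ ⥤ LocallyRingedSpace.{u} :=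
  X.O.op ⋙ AlgebraicGeometry.Spec.toLocallyRingedSpace

instance (X : RingedPoset.{u}) : HasColimit X.specDiagram := inferInstance

/-- `Spec X = colim_{x ∈ X} Spec 𝒪 x`, the colimit being taken in locally ringed spaces. -/
noncomputable def Spec (X : RingedPoset.{u}) : LocallyRingedSpace.{u} :=
  colimit X.specDiagram

/-- The natural morphism `Spec 𝒪 x ⟶ Spec X`. -/
noncomputable def specι (X : RingedPoset.{u}) (x : X) :
    AlgebraicGeometry.Spec.toLocallyRingedSpace.obj (op (X.O.obj x)) ⟶ X.Spec :=
  colimit.ι X.specDiagram (op x)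

lemma map_res_specι (X : RingedPoset.{u}) {x y : X} (h : x ≤ y) :
    AlgebraicGeometry.Spec.toLocallyRingedSpace.map (X.res h).op ≫ X.specι x = X.specι y :=
  colimit.w X.specDiagram (homOfLE h).op

/-- The morphism of locally ringed spaces `Spec f : Spec X ⟶ Spec Y`, given on `Spec 𝒪_{X, x}` by
the composite `Spec 𝒪_{X, x} ⟶ Spec 𝒪_{Y, f x} ⟶ Spec Y`. -/
noncomputable def specMap {X Y : RingedPoset.{u}} (f : X ⟶ Y) : X.Spec ⟶ Y.Spec :=
  colimit.desc X.specDiagram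
    { pt := Y.Spec
      ι :=
        { app := fun x => AlgebraicGeometry.Spec.toLocallyRingedSpace.map
            (Hom.stalk f x.unop).op ≫ Y.specι (Hom.base f x.unop)
          naturality := fun x y h => by
            change AlgebraicGeometry.Spec.toLocallyRingedSpace.map
              (X.res (leOfHom h.unop)).op ≫ AlgebraicGeometry.Spec.toLocallyRingedSpace.map
                (Hom.stalk f y.unop).op ≫ Y.specι (Hom.base f y.unop) =
              (AlgebraicGeometry.Spec.toLocallyRingedSpace.map
                (Hom.stalk f x.unop).op ≫ Y.specι (Hom.base f x.unop)) ≫ 𝟙 _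
            rw [← Category.assoc, ← Functor.map_comp, ← op_comp, ← stalk_res, op_comp,
              Functor.map_comp, Category.assoc, map_res_specι, Category.comp_id] } }

lemma specι_specMap {X Y : RingedPoset.{u}} (f : X ⟶ Y) (x : X) :
    X.specι x ≫ specMap f =
      AlgebraicGeometry.Spec.toLocallyRingedSpace.map (Hom.stalk f x).op ≫
        Y.specι (Hom.base f x) :=
  colimit.ι_desc _ _

lemma isIso_specι {X : RingedPoset.{u}} {x : X} (hx : ∀ y, x ≤ y) : IsIso (X.specι x) :=
  isIso_ι_of_isTerminal (j := op x) (IsTerminal.ofUniqueHom (fun z => (homOfLE (hx z.unop)).op)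
    (fun _ _ => Subsingleton.elim _ _)) X.specDiagram

end RingedPoset

namespace SchFin

/-- A schematic morphism is a qc-isomorphism if `Spec f` is an isomorphism. -/
def IsQcIso {X Y : SchFin.{u}} (f : X ⟶ Y) : Prop :=
  IsIso (RingedPoset.specMap f.hom)

/-- A schematic morphism is flat if it is flat on stalks. -/
def IsFlat {X Y : SchFin.{u}} (f : X ⟶ Y) : Prop :=
  ∀ x : X, (f.hom.stalk x).hom.Flat

/-- A flat immersion is a flat morphism whose diagonal is a qc-isomorphism. -/
structure IsFlatImmersion {X Y : SchFin.{u}} (f : X ⟶ Y) : Prop where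
  flat : IsFlat f
  diagonal : IsQcIso (pullback.diagonal f)

/-- A covering by flat immersions: a finite family of flat immersions which is jointly faithfully
flat, i.e. the maps `Spec (f i)` are jointly surjective. -/
structure IsCovering {X : SchFin.{u}} {I : Type u} {U : I → SchFin.{u}} (f : ∀ i, U i ⟶ X) :
    Prop where
  finite : Finite I
  isFlatImmersion : ∀ i, IsFlatImmersion (f i)
  surjective : ∀ p : X.toRingedPoset.Spec, ∃ (i : I) (q : (U i).toRingedPoset.Spec),
    (RingedPoset.specMap (f i).hom).base q = p

/-! ### The nerve of a finite family -/

/-- The poset of non-empty (finite) subsets of `I`, ordered by inclusion. -/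
abbrev Parts (I : Type u) : Type u := {Δ : Finset I // Δ.Nonempty}

section Nerve

variable {X : SchFin.{u}} {I : Type u} {U : I → SchFin.{u}} (f : ∀ i, U i ⟶ X)

/-- The functor sending a non-empty subset `Δ` of `I` to the fibered product over `X` of the
`U i`, `i ∈ Δ`, as a schematic space over `X`; an inclusion `Δ ⊆ Δ'` is sent to the projection. -/
noncomputable def nerveOver : (Parts I)ᵒᵖ ⥤ Over X where
  obj Δ := ∏ᶜ fun i : Δ.unop.1 => Over.mk (f i)
  map {Δ Δ'} h := Pi.lift fun i : Δ'.unop.1 =>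
    Pi.π (fun i : Δ.unop.1 => Over.mk (f i)) ⟨i.1, leOfHom h.unop i.2⟩

/-- The nerve datum `Δ ↦ 𝒰(Δ) = ∏_{i ∈ Δ} U i` (fibered product over `X`). -/
noncomputable def nerve : (Parts I)ᵒᵖ ⥤ SchFin.{u} := nerveOver f ⋙ Over.forget X

/-- The natural morphisms `𝒰(Δ) ⟶ X`. -/
noncomputable def nerveCocone : Cocone (nerve f) :=
  (Over.forgetCocone X).whisker (nerveOver f)

end Nerve

/-! ### Points and stars -/

/-- The one-point schematic space `(⋆, A)`. -/
def point (A : CommRingCat.{u}) : SchFin.{u} where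
  toRingedPoset := { carrier := PUnit.{u + 1}, O := (Functor.const _).obj A }
  isSchematic := RingedPoset.isSchematic_of (fun _ => RingHom.Flat.id _)
    (fun _ => inferInstanceAs (Epi (𝟙 A)))
    (fun {t _ y} _ _ _ _ _ => ⟨y, le_refl _, le_refl _, le_refl _, RingedPoset.mem_im_self _ t _⟩)

/-- The morphism `(⋆, B) ⟶ (⋆, A)` given by a ring map `A ⟶ B`. -/
def pointMap {A B : CommRingCat.{u}} (φ : A ⟶ B) : point B ⟶ point A where
  hom := { base := OrderHom.id, sharp := (Functor.const _).map φ }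
  isSchematic := RingedPoset.Hom.isSchematic_of (point A).isSchematic
    (fun {x _} _ _ _ => ⟨x, le_refl _, le_refl _, RingedPoset.mem_im_self _ x _⟩)

/-- The minimal open neighbourhood `U_x = {z ≥ x}` of `x`, with the restricted structure sheaf. -/
def star (X : SchFin.{u}) (x : X) : SchFin.{u} where
  toRingedPoset :=
    { carrier := {z : X // x ≤ z}
      O := (Subtype.mono_coe (fun z : X => x ≤ z)).functor ⋙ X.toRingedPoset.O }
  isSchematic := RingedPoset.isSchematic_of (fun h => X.isSchematic.flat h)
    (fun h => X.isSchematic.epi h)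
    (fun {t _ _} hx hy _ hpx hpy => by
      obtain ⟨z, hxz, hyz, htz, hz⟩ := X.isSchematic.exists_le hx hy hpx hpy
      exact ⟨⟨z, t.2.trans htz⟩, hxz, hyz, htz, hz⟩)

/-- The open immersion `U_x ⟶ U_y` for `y ≤ x`. -/
def starMap (X : SchFin.{u}) {x y : X} (h : y ≤ x) : X.star x ⟶ X.star y where
  hom :=
    { base := ⟨fun z => ⟨z.1, h.trans z.2⟩, fun _ _ h => h⟩
      sharp := 𝟙 _ }
  isSchematic := RingedPoset.Hom.isSchematic_of (X.star y).isSchematic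
    (fun {z w} h _ hp => ⟨⟨w.1, z.2.trans h⟩, h, le_refl _, hp⟩)

/-- The open immersion `U_x ⟶ X`. -/
def starι (X : SchFin.{u}) (x : X) : X.star x ⟶ X where
  hom :=
    { base := ⟨fun z => z.1, fun _ _ h => h⟩
      sharp := 𝟙 _ }
  isSchematic := RingedPoset.Hom.isSchematic_of X.isSchematic
    (fun {z w} h _ hp => ⟨⟨w, z.2.trans h⟩, h, le_refl _, hp⟩)

/-- The projection `U_x ⟶ (⋆, 𝒪_{X, x})`. -/
def starπ (X : SchFin.{u}) (x : X) : X.star x ⟶ point (X.O x) where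
  hom :=
    { base := ⟨fun _ => PUnit.unit, fun _ _ _ => le_refl _⟩
      sharp :=
        { app := fun z => X.toRingedPoset.res z.2
          naturality := fun z _ h => (Category.id_comp _).trans
            (X.toRingedPoset.res_res z.2 (leOfHom h)).symm } }
  isSchematic := RingedPoset.Hom.isSchematic_of (point (X.O x)).isSchematic
    (fun {z _} _ _ _ => ⟨z, le_refl _, le_refl _, RingedPoset.mem_im_self _ z _⟩)

/-- The diagram `x ↦ (⋆, 𝒪_{X, x})`. -/
def pointDiagram (X : SchFin.{u}) : (X : Type u)ᵒᵖ ⥤ SchFin.{u} where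
  obj x := point (X.O x.unop)
  map h := pointMap (X.toRingedPoset.res (leOfHom h.unop))
  map_id x := SchFin.hom_ext (RingedPoset.hom_ext (fun _ => rfl)
    (fun _ => (X.toRingedPoset.res_self _ _).trans (Category.id_comp (𝟙 (X.O x.unop))).symm))
  map_comp h h' := SchFin.hom_ext (RingedPoset.hom_ext (fun _ => rfl)
    (fun _ => (X.toRingedPoset.res_res (leOfHom h'.unop) (leOfHom h.unop)).symm.trans
      (Category.id_comp _).symm))

/-- The diagram `x ↦ U_x`. -/
def starDiagram (X : SchFin.{u}) : (X : Type u)ᵒᵖ ⥤ SchFin.{u} where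
  obj x := X.star x.unop
  map h := X.starMap (leOfHom h.unop)
  map_id _ := rfl
  map_comp _ _ := SchFin.hom_ext (RingedPoset.hom_ext (fun _ => rfl)
    (fun z => ((X.toRingedPoset.res_self z.1 (le_refl _)).symm.trans
      (Category.comp_id _).symm).trans
        (congrArg (X.toRingedPoset.res (le_refl z.1) ≫ ·) (Category.id_comp (𝟙 (X.O z.1))).symm)))

/-- The projections `U_x ⟶ (⋆, 𝒪_{X, x})`, as a natural transformation. -/
def starToPoint (X : SchFin.{u}) : X.starDiagram ⟶ X.pointDiagram where
  app x := X.starπ x.unop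
  naturality x y h := SchFin.hom_ext (RingedPoset.hom_ext (fun _ => rfl) (fun z => by
    change X.toRingedPoset.res _ ≫ 𝟙 (X.O z.1) = 𝟙 (X.O y.unop) ≫
      X.toRingedPoset.res (leOfHom h.unop) ≫ X.toRingedPoset.res z.2
    rw [Category.comp_id, Category.id_comp, RingedPoset.res_res]))

/-- The open immersions `U_x ⟶ X`, on the diagram `x ↦ U_x`. -/
def starLeg (X : SchFin.{u}) (x : (X : Type u)ᵒᵖ) : X.starDiagram.obj x ⟶ X := X.starι x.unop

lemma map_starLeg (X : SchFin.{u}) {x y : (X : Type u)ᵒᵖ} (h : x ⟶ y) :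
    X.starDiagram.map h ≫ X.starLeg y = X.starLeg x :=
  SchFin.hom_ext (RingedPoset.hom_ext (fun _ => rfl) (fun z => by
    change 𝟙 (X.O z.1) ≫ 𝟙 (X.O z.1) = X.toRingedPoset.res (le_refl z.1) ≫ 𝟙 (X.O z.1)
    rw [RingedPoset.res_self]))

/-- The projection `U_x ⟶ (⋆, 𝒪_{X, x})` is a qc-isomorphism. -/
lemma isQcIso_starπ (X : SchFin.{u}) (x : X) : IsQcIso (X.starπ x) := by
  have h1 : IsIso ((X.star x).toRingedPoset.specι ⟨x, le_refl x⟩) :=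
    RingedPoset.isIso_specι (fun y => y.2)
  have h2 : IsIso ((point (X.O x)).toRingedPoset.specι PUnit.unit) :=
    RingedPoset.isIso_specι (fun _ => le_refl _)
  have key := RingedPoset.specι_specMap (X.starπ x).hom ⟨x, le_refl x⟩
  have h3 : IsIso ((X.starπ x).hom.stalk ⟨x, le_refl x⟩) := by
    change IsIso (X.toRingedPoset.res (le_refl x))
    rw [RingedPoset.res_self]
    infer_instance
  have h4 : IsIso ((X.star x).toRingedPoset.specι ⟨x, le_refl x⟩ ≫
      RingedPoset.specMap (X.starπ x).hom) := by
    rw [key]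
    have h5 : IsIso ((X.starπ x).hom.stalk ⟨x, le_refl x⟩).op := inferInstance
    exact IsIso.comp_isIso' (Functor.map_isIso _ _) h2
  exact IsIso.of_isIso_comp_left ((X.star x).toRingedPoset.specι ⟨x, le_refl x⟩) _

end SchFin

/-! ### Geometric data with values in a category -/

section OneCategorical

variable {C : Type w} [Category.{v} C]

/-- A functor `𝔇𝔞𝔱 : SchFin ⥤ C` is a geometric datum if it maps qc-isomorphisms to
isomorphisms. -/
def IsGeometric (Dat : SchFin.{u} ⥤ C) : Prop :=
  ∀ ⦃X Y : SchFin.{u}⦄ (f : X ⟶ Y), SchFin.IsQcIso f → IsIso (Dat.map f)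

/-- The cocone with vertex `𝔇𝔞𝔱 X` on the diagram `x ↦ 𝔇𝔞𝔱 (⋆, 𝒪_{X, x})` given by
`𝔇𝔞𝔱 (⋆, 𝒪_{X, x}) ←~ 𝔇𝔞𝔱 U_x ⟶ 𝔇𝔞𝔱 X`. -/
noncomputable def internalCocone (Dat : SchFin.{u} ⥤ C) (hD : IsGeometric Dat) (X : SchFin.{u}) :
    Cocone (X.pointDiagram ⋙ Dat) :=
  have hi (x : (X : Type u)ᵒᵖ) : IsIso (Dat.map (X.starToPoint.app x)) :=
    hD _ (X.isQcIso_starπ x.unop)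
  { pt := Dat.obj X
    ι :=
      { app := fun x => inv (Dat.map (X.starToPoint.app x)) ≫ Dat.map (X.starLeg x)
        naturality := fun x y h => by
          have h1 := congrArg Dat.map (X.starToPoint.naturality h)
          have h2 := congrArg Dat.map (X.map_starLeg h)
          rw [Functor.map_comp, Functor.map_comp] at h1
          rw [Functor.map_comp] at h2
          have h3 : Dat.map (X.pointDiagram.map h) ≫ inv (Dat.map (X.starToPoint.app y)) =
              inv (Dat.map (X.starToPoint.app x)) ≫ Dat.map (X.starDiagram.map h) := by
            rw [IsIso.comp_inv_eq, Category.assoc, h1, IsIso.inv_hom_id_assoc]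
          refine Eq.trans ?_ (Category.comp_id _).symm
          rw [← h2]
          exact (Category.assoc _ _ _).symm.trans
            ((congrArg (· ≫ Dat.map (X.starLeg y)) h3).trans (Category.assoc _ _ _)) } }

/-- A geometric datum `𝔇𝔞𝔱` satisfies internal descent if, for every schematic space `X`, the
canonical morphism `colim_{x ∈ X} 𝔇𝔞𝔱 (⋆, 𝒪_{X, x}) ⟶ 𝔇𝔞𝔱 X` is an isomorphism, i.e. the
canonical cocone with vertex `𝔇𝔞𝔱 X` is a colimit cocone. -/
def SatisfiesInternalDescent (Dat : SchFin.{u} ⥤ C) (hD : IsGeometric Dat) : Prop :=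
  ∀ X : SchFin.{u}, Nonempty (IsColimit (internalCocone Dat hD X))

end OneCategorical

/-! ### Bicolimits -/

section TwoCategorical

open Bicategory

variable {S : Type w'} [Category.{v'} S] {D : Type w} [Bicategory.{v, t} D]

/-- For a functor `G : J ⥤ S` and a pseudofunctor `F` from `S` to `D`, a pseudococone with vertex
`d` on the composite of `G` and `F`: 1-cells `F (G j) ⟶ d` which are compatible with the
transition 1-cells up to coherent invertible 2-cells. -/
structure PseudoCocone {J : Type u} [Category.{u} J] (F : LocallyDiscrete S ⥤ᵖ D) (G : J ⥤ S)
    (d : D) where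
  leg (j : J) : F.obj ⟨G.obj j⟩ ⟶ d
  comm {j k : J} (f : j ⟶ k) : F.map (G.map f).toLoc ≫ leg k ≅ leg j
  comm_id (j : J) : (comm (𝟙 j)).hom =
    (F.mapId' (G.map (𝟙 j)).toLoc (congrArg Quiver.Hom.toLoc (G.map_id j))).hom ▷ leg j ≫
      (λ_ (leg j)).hom
  comm_comp {j k l : J} (f : j ⟶ k) (g : k ⟶ l) : (comm (f ≫ g)).hom =
    (F.mapComp' (G.map f).toLoc (G.map g).toLoc (G.map (f ≫ g)).toLoc
        (congrArg Quiver.Hom.toLoc (G.map_comp f g).symm)).hom ▷ leg l ≫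
      (α_ _ _ _).hom ≫ F.map (G.map f).toLoc ◁ (comm g).hom ≫ (comm f).hom

namespace PseudoCocone

variable {J : Type u} [Category.{u} J] {F : LocallyDiscrete S ⥤ᵖ D} {G : J ⥤ S} {d : D}

/-- Morphisms of pseudococones with the same vertex (modifications). -/
@[ext]
structure Hom (c c' : PseudoCocone F G d) where
  app (j : J) : c.leg j ⟶ c'.leg j
  naturality {j k : J} (f : j ⟶ k) :
    F.map (G.map f).toLoc ◁ app k ≫ (c'.comm f).hom = (c.comm f).hom ≫ app j

instance : Category (PseudoCocone F G d) where
  Hom := Hom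
  id c := ⟨fun j => 𝟙 (c.leg j), fun f => by simp⟩
  comp a b := ⟨fun j => a.app j ≫ b.app j, fun f => by
    rw [Bicategory.whiskerLeft_comp, Category.assoc, b.naturality, ← Category.assoc,
      a.naturality, Category.assoc]⟩
  id_comp a := Hom.ext (funext fun j => Category.id_comp _)
  comp_id a := Hom.ext (funext fun j => Category.comp_id _)
  assoc a b c := Hom.ext (funext fun j => Category.assoc _ _ _)

lemma postcomp_aux {a b b' e : D} {p : a ⟶ b} {l : b ⟶ b'} {l' : a ⟶ b'} (m : p ≫ l ≅ l')
    {φ ψ : b' ⟶ e} (η : φ ⟶ ψ) :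
    p ◁ l ◁ η ≫ ((α_ p l ψ).symm ≪≫ whiskerRightIso m ψ).hom =
      ((α_ p l φ).symm ≪≫ whiskerRightIso m φ).hom ≫ l' ◁ η := by
  simp [← whisker_exchange]

/-- Postcomposition of a pseudococone with vertex `d` with 1-cells `d ⟶ e`. -/
def postcomp (c : PseudoCocone F G d) (e : D) : (d ⟶ e) ⥤ PseudoCocone F G e where
  obj φ :=
    { leg := fun j => c.leg j ≫ φ
      comm := fun f => (α_ _ _ _).symm ≪≫ whiskerRightIso (c.comm f) φ
      comm_id := fun j => by
        simp [c.comm_id]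
      comm_comp := fun f g => by
        simp [c.comm_comp] }
  map η := ⟨fun j => c.leg j ◁ η, fun f => postcomp_aux _ η⟩
  map_id φ := Hom.ext (funext fun j => Bicategory.whiskerLeft_id _ _)
  map_comp η θ := Hom.ext (funext fun j => Bicategory.whiskerLeft_comp _ _ _)

/-- A pseudococone with vertex `d` is a bicolimit if postcomposition with it is an equivalence
between the category of 1-cells `d ⟶ e` and the category of pseudococones with vertex `e`, for
every object `e`. -/
def IsBicolimit (c : PseudoCocone F G d) : Prop :=
  ∀ e : D, (c.postcomp e).IsEquivalence

lemma mapComp'_inv_eq (F : LocallyDiscrete S ⥤ᵖ D) {a b : LocallyDiscrete S} (g : a ⟶ a)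
    (k : a ⟶ b) (hg : g = 𝟙 a) (hk : g ≫ k = k) :
    (F.mapComp' g k k hk).inv = (F.mapId' g hg).hom ▷ F.map k ≫ (λ_ (F.map k)).hom := by
  subst hg
  rw [F.mapComp'_id_comp_inv, F.mapId'_eq_mapId]

/-- The image under a pseudofunctor `F` of a cocone on `G` with vertex `s` and legs `ι`. -/
def ofLegs (F : LocallyDiscrete S ⥤ᵖ D) {s : S} (ι : ∀ j, G.obj j ⟶ s)
    (hι : ∀ {j k : J} (f : j ⟶ k), G.map f ≫ ι k = ι j) : PseudoCocone F G (F.obj ⟨s⟩) where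
  leg j := F.map (ι j).toLoc
  comm {j k} f := (F.mapComp' (G.map f).toLoc (ι k).toLoc (ι j).toLoc
    (congrArg Quiver.Hom.toLoc (hι f))).symm
  comm_id j := mapComp'_inv_eq F _ _ _ (congrArg Quiver.Hom.toLoc (hι (𝟙 j)))
  comm_comp {j k l} f g := by
    have := F.mapComp'_inv_whiskerRight_mapComp'₀₂₃_inv (G.map f).toLoc (G.map g).toLoc
      (ι l).toLoc (G.map (f ≫ g)).toLoc (ι k).toLoc (ι j).toLoc
      (congrArg Quiver.Hom.toLoc (G.map_comp f g).symm) (congrArg Quiver.Hom.toLoc (hι g))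
      (congrArg Quiver.Hom.toLoc (hι (f ≫ g)))
    rw [Iso.symm_hom, Iso.symm_hom, Iso.symm_hom, ← this, ← Category.assoc,
      ← Bicategory.comp_whiskerRight, Iso.hom_inv_id, Bicategory.id_whiskerRight,
      Category.id_comp]

/-- The image under a pseudofunctor `F` of a cocone on `G`. -/
def ofCocone (F : LocallyDiscrete S ⥤ᵖ D) (c : Cocone G) : PseudoCocone F G (F.obj ⟨c.pt⟩) :=
  ofLegs F (fun j => c.ι.app j) (fun f => c.w f)

end PseudoCocone

/-! ### Geometric data with values in a strict 2-category -/

/-- A pseudofunctor `𝔇𝔞𝔱` from `SchFin` (with only identity 2-cells) to a 2-category is a geometric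
datum if it maps qc-isomorphisms to equivalences. -/
def IsGeometric₂ (Dat : LocallyDiscrete SchFin.{u} ⥤ᵖ D) : Prop :=
  ∀ ⦃X Y : SchFin.{u}⦄ (f : X ⟶ Y), SchFin.IsQcIso f →
    ∃ e : Dat.obj ⟨X⟩ ≌ Dat.obj ⟨Y⟩, e.hom = Dat.map f.toLoc

/-- A pseudococone `c` with vertex `𝔇𝔞𝔱 X` on `x ↦ 𝔇𝔞𝔱 (⋆, 𝒪_{X, x})` is given by
`𝔇𝔞𝔱 (⋆, 𝒪_{X, x}) ←~ 𝔇𝔞𝔱 U_x ⟶ 𝔇𝔞𝔱 X` if the composites `𝔇𝔞𝔱 U_x ⟶ 𝔇𝔞𝔱 (⋆, 𝒪_{X, x}) ⟶ 𝔇𝔞𝔱 X`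
are isomorphic to the 1-cells `𝔇𝔞𝔱 U_x ⟶ 𝔇𝔞𝔱 X`, compatibly with the transition 1-cells. When `𝔇𝔞𝔱`
is geometric, this determines `c` up to a unique compatible isomorphism. -/
def IsInternal (Dat : LocallyDiscrete SchFin.{u} ⥤ᵖ D) {X : SchFin.{u}}
    (c : PseudoCocone Dat X.pointDiagram (Dat.obj ⟨X⟩)) : Prop :=
  ∃ θ : ∀ x : (X : Type u)ᵒᵖ,
      Dat.map (X.starToPoint.app x).toLoc ≫ c.leg x ≅ Dat.map (X.starLeg x).toLoc,
    ∀ ⦃x y : (X : Type u)ᵒᵖ⦄ (h : x ⟶ y),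
      Dat.map (X.starDiagram.map h).toLoc ◁ (θ y).hom ≫
        (Dat.mapComp' (X.starDiagram.map h).toLoc (X.starLeg y).toLoc
          (X.starLeg x).toLoc (congrArg Quiver.Hom.toLoc (X.map_starLeg h))).inv =
      (α_ _ _ _).inv ≫
        (Dat.mapComp (X.starDiagram.map h).toLoc (X.starToPoint.app y).toLoc).inv ▷ c.leg y ≫
        (Dat.mapComp' (X.starToPoint.app x).toLoc (X.pointDiagram.map h).toLoc
          ((X.starDiagram.map h).toLoc ≫ (X.starToPoint.app y).toLoc)
          (congrArg Quiver.Hom.toLoc (X.starToPoint.naturality h).symm)).hom ▷ c.leg y ≫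
        (α_ _ _ _).hom ≫
        Dat.map (X.starToPoint.app x).toLoc ◁ (c.comm h).hom ≫ (θ x).hom

/-- A geometric datum `𝔇𝔞𝔱` with values in a 2-category satisfies internal descent if, for every
schematic space `X`, the canonical 1-cell `colim_{x ∈ X} 𝔇𝔞𝔱 (⋆, 𝒪_{X, x}) ⟶ 𝔇𝔞𝔱 X` is an
equivalence, i.e. the canonical pseudococone with vertex `𝔇𝔞𝔱 X` is a bicolimit. -/
def SatisfiesInternalDescent₂ (Dat : LocallyDiscrete SchFin.{u} ⥤ᵖ D) : Prop :=
  ∀ X : SchFin.{u}, ∃ c : PseudoCocone Dat X.pointDiagram (Dat.obj ⟨X⟩),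
    IsInternal Dat c ∧ c.IsBicolimit

end TwoCategorical

/-! The nerve is assembled into a single schematic space, its cylinder: the disjoint union of the
`𝒰(Δ)`, where `(Δ, x) ≤ (Δ', x')` if `Δ ⊆ Δ'` and `x` lies below the image of `x'`. It projects to
`X`, and the projection is a qc-isomorphism. Internal descent for the cylinder therefore presents
the datum of `X` as a colimit over all `(Δ, x)`. The star of `(Δ, x)` in the cylinder and the star
of `x` in `𝒰(Δ)` both project by qc-isomorphisms to the same one-point space, so internal descent
for `𝒰(Δ)` identifies the part of this colimit with `Δ` fixed with the datum of `𝒰(Δ)`. Computing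
the colimit one `Δ` at a time is the claim.

The covering enters only through `IsFlatCover`. A flat immersion has flat epimorphic stalk maps and
is injective on points of `Spec` (`IsFlatImmersion.isFlatMono`). Fibered products inherit this, and
their image is the intersection of the images, so a point common to `Δ` and `Δ'` comes from `Δ ∪
Δ'`. This makes the cylinder schematic (`isSchematic_cylinder`) and its projection bijective on
`Spec`. Flatness gives the quotient topology and flat epimorphisms give isomorphisms of local rings,
so `Spec` of the projection is an isomorphism (`isIso_specMap_cylinderπ`).

The geometric input is a comparison of the colimit `Spec X` with its charts `Spec 𝒪 x`. Two points
of charts agree in `Spec X` exactly when a common point restricts to both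
(`IsSchematic.exists_of_specPt_eq`). Every element of `𝒪 x` extends to a section on an open
neighbourhood of the chart (`IsSchematic.exists_section`); hence the charts induce isomorphisms on
local rings (`IsSchematic.bijective_stalkMap_specι`) and separate morphisms from affine schemes
(`IsSchematic.eq_of_comp_specι`).

For 2-categories, a 2-cell `F.map f ≫ ψ ⟶ φ` is treated as an arrow lying over `f`, with an
associative and unital composition `ccomp`. Being a bicolimit becomes `IsDescent`: a vertex with
compatible invertible 2-cells exists, and 2-cells between vertices are determined by their
compatible restrictions. This property passes along natural transformations and vertices that become
equivalences (`IsDescent.of_natTrans`, `IsDescent.comp`), and the one-categorical argument can be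
repeated. -/

namespace AlgebraicGeometry

open TopologicalSpace

/-! ### Sections and points of colimits of locally ringed spaces. -/

namespace PresheafedSpace

variable {J : Type u} [Category.{u} J] {F : J ⥤ PresheafedSpace.{u} CommRingCat.{u}}

/-- The ring of sections of a colimit over `V` is the limit of the rings of sections over the
preimages of `V`, so equality can be tested on the legs. -/
lemma section_ext_of_colimit {V : Opens (Limits.colimit F).carrier}
    {s t : (Limits.colimit F).presheaf.obj (op V)}
    (h : ∀ j, (colimit.ι F j).c.app (op V) s = (colimit.ι F j).c.app (op V) t) : s = t := by
  apply (ConcreteCategory.bijective_of_isIso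
    (colimitPresheafObjIsoComponentwiseLimit F V).hom).1
  apply Concrete.limit_ext
  intro j
  have := h j.unop
  rw [← colimitPresheafObjIsoComponentwiseLimit_hom_π] at this
  exact this

lemma exists_section_of_colimit (V : Opens (Limits.colimit F).carrier)
    (s : ∀ j, (F.obj j).presheaf.obj (op ((Opens.map (colimit.ι F j).base).obj V)))
    (hs : ∀ ⦃j k : J⦄ (f : j ⟶ k)
      (h : (Opens.map (colimit.ι F j).base).obj V ≤
        (Opens.map (F.map f).base).obj ((Opens.map (colimit.ι F k).base).obj V)),
      (F.obj j).presheaf.map (homOfLE h).op ((F.map f).c.app _ (s k)) = s j) :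
    ∃ t : (Limits.colimit F).presheaf.obj (op V), ∀ j, (colimit.ι F j).c.app (op V) t = s j := by
  have hl := isLimitOfPreserves (CategoryTheory.forget CommRingCat)
    (limit.isLimit (componentwiseDiagram F V))
  let x := (Types.isLimitEquivSections hl).symm
    ⟨fun j => s j.unop, fun {j k} f => hs f.unop (by
      rw [← colimit.w F f.unop, comp_base]; rfl)⟩
  refine ⟨(colimitPresheafObjIsoComponentwiseLimit F V).inv x, fun j => ?_⟩
  have := congr($(colimitPresheafObjIsoComponentwiseLimit_inv_ι_app F V j) x)
  refine this.trans ?_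
  exact Types.isLimitEquivSections_symm_apply hl _ (op j)

/-- A colimit of locally ringed spaces is only isomorphic to the colimit of the underlying
presheafed spaces. Keeping the legs `l` as variables allows them to be substituted by composites
with `e`, which avoids transporting sections along equalities of open sets. -/
lemma section_ext_of_colimit_of_iso {B : PresheafedSpace.{u} CommRingCat.{u}}
    (e : Limits.colimit F ⟶ B) [IsIso e] (l : ∀ j, F.obj j ⟶ B)
    (hl : ∀ j, colimit.ι F j ≫ e = l j) {V : Opens B.carrier} {s t : B.presheaf.obj (op V)}
    (h : ∀ j, (l j).c.app (op V) s = (l j).c.app (op V) t) : s = t := by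
  obtain rfl := funext hl
  have := c_isIso_of_iso e
  have he : IsIso (e.c.app (op V)) := NatIso.isIso_app_of_isIso e.c _
  apply (ConcreteCategory.bijective_of_isIso (e.c.app (op V))).1
  apply section_ext_of_colimit
  intro j
  have := h j
  rw [comp_c_app] at this
  exact this

lemma exists_section_of_colimit_of_iso {B : PresheafedSpace.{u} CommRingCat.{u}}
    (e : Limits.colimit F ⟶ B) [IsIso e] (l : ∀ j, F.obj j ⟶ B)
    (hl : ∀ j, colimit.ι F j ≫ e = l j) (V : Opens B.carrier)
    (s : ∀ j, (F.obj j).presheaf.obj (op ((Opens.map (l j).base).obj V)))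
    (hs : ∀ ⦃j k : J⦄ (f : j ⟶ k)
      (h : (Opens.map (l j).base).obj V ≤
        (Opens.map (F.map f).base).obj ((Opens.map (l k).base).obj V)),
      (F.obj j).presheaf.map (homOfLE h).op ((F.map f).c.app _ (s k)) = s j) :
    ∃ t : B.presheaf.obj (op V), ∀ j, (l j).c.app (op V) t = s j := by
  obtain rfl := funext hl
  have := c_isIso_of_iso e
  have he : IsIso (e.c.app (op V)) := NatIso.isIso_app_of_isIso e.c _
  obtain ⟨t, ht⟩ := exists_section_of_colimit ((Opens.map e.base).obj V) s hs
  obtain ⟨t', rfl⟩ := (ConcreteCategory.bijective_of_isIso (e.c.app (op V))).2 t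
  refine ⟨t', fun j => ?_⟩
  rw [comp_c_app]
  exact ht j

end PresheafedSpace

namespace LocallyRingedSpace

variable {J : Type u} [Category.{u} J] (F : J ⥤ LocallyRingedSpace.{u})

/-- The forgetful functor to presheafed spaces. -/
noncomputable abbrev toPresheafed : LocallyRingedSpace.{u} ⥤ PresheafedSpace.{u} CommRingCat.{u} :=
  forgetToSheafedSpace ⋙ SheafedSpace.forgetToPresheafedSpace

noncomputable abbrev toPresheafedColimitIso :
    Limits.colimit (F ⋙ toPresheafed) ⟶ toPresheafed.obj (Limits.colimit F) :=
  (preservesColimitIso toPresheafed F).inv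

variable {F}

lemma colimit_section_ext {V : Opens (Limits.colimit F : LocallyRingedSpace)} {s t : (colimit F).presheaf.obj (op V)}
    (h : ∀ j, (colimit.ι F j).c.app (op V) s = (colimit.ι F j).c.app (op V) t) : s = t :=
  PresheafedSpace.section_ext_of_colimit_of_iso (toPresheafedColimitIso F)
    (fun j => toPresheafed.map (colimit.ι F j))
    (fun j => ι_preservesColimitIso_inv toPresheafed F j) h

lemma colimit_exists_section (V : Opens (Limits.colimit F : LocallyRingedSpace))
    (s : ∀ j, (F.obj j).presheaf.obj (op ((Opens.map (colimit.ι F j).base).obj V)))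
    (hs : ∀ ⦃j k : J⦄ (f : j ⟶ k)
      (h : (Opens.map (colimit.ι F j).base).obj V ≤
        (Opens.map (F.map f).base).obj ((Opens.map (colimit.ι F k).base).obj V)),
      (F.obj j).presheaf.map (homOfLE h).op ((F.map f).c.app _ (s k)) = s j) :
    ∃ t : (colimit F).presheaf.obj (op V), ∀ j, (colimit.ι F j).c.app (op V) t = s j :=
  PresheafedSpace.exists_section_of_colimit_of_iso (toPresheafedColimitIso F)
    (fun j => toPresheafed.map (colimit.ι F j))
    (fun j => ι_preservesColimitIso_inv toPresheafed F j) V s hs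

/-- The underlying topological space of a colimit of locally ringed spaces is the colimit of the
underlying topological spaces. -/
noncomputable def forgetColimit :
    IsColimit ((toPresheafed ⋙ PresheafedSpace.forget _).mapCocone (colimit.cocone F)) :=
  isColimitOfPreserves _ (colimit.isColimit F)

lemma isOpen_colimit_iff {V : Set (Limits.colimit F : LocallyRingedSpace)} :
    IsOpen V ↔ ∀ j, IsOpen ((colimit.ι F j).base ⁻¹' V) :=
  TopCat.isOpen_iff_of_isColimit _ forgetColimit V

lemma colimit_exists_rep (x : (Limits.colimit F : LocallyRingedSpace)) : ∃ (j : J) (y : F.obj j), (colimit.ι F j).base y = x :=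
  Types.jointly_surjective_of_isColimit
    (isColimitOfPreserves (CategoryTheory.forget TopCat.{u}) (forgetColimit (F := F))) x

/-- Points of a colimit of locally ringed spaces are identified only if they are equivalent for every
equivalence relation on the points of the diagram which is compatible with the transition maps. -/
lemma rel_of_colimit_eq {j k : J} {x : F.obj j} {y : F.obj k}
    (h : (colimit.ι F j).base x = (colimit.ι F k).base y) (r : Setoid (Σ j, F.obj j))
    (hr : ∀ ⦃j k : J⦄ (f : j ⟶ k) (x : F.obj j), r ⟨j, x⟩ ⟨k, (F.map f).base x⟩) :
    r ⟨j, x⟩ ⟨k, y⟩ := by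
  have hc := isColimitOfPreserves (CategoryTheory.forget TopCat.{u}) (forgetColimit (F := F))
  have h1 := ((Types.isColimit_iff_coconeTypesIsColimit _).1 ⟨hc⟩).bijective.1
  have h2 := Quot.eqvGen_exact (h1 (a₁ := Functor.ιColimitType _ j x)
    (a₂ := Functor.ιColimitType _ k y) h)
  refine r.iseqv.eqvGen_iff.1 (Relation.EqvGen.mono ?_ _ _ h2)
  rintro ⟨j, x⟩ ⟨k, y⟩ ⟨f, hf⟩
  have hf' : y = (F.map f).base x := hf
  rw [hf']
  exact hr f x

end LocallyRingedSpace

end AlgebraicGeometry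

/-! ### Commutative algebra of flat maps and flat epimorphisms. -/

namespace SchematicAux

open TensorProduct

/-- Annihilators commute with flat base change: an element which dies in `M ⊗[A] B` is locally
annihilated at the image of every prime of `B`. -/
lemma exists_smul_eq_zero {A B M : Type*} [CommRing A] [CommRing B] [Algebra A B] [Module.Flat A B]
    [AddCommGroup M] [Module A M] {d : M} (hd : d ⊗ₜ[A] (1 : B) = 0) (q : Ideal B) (hq : q ≠ ⊤) :
    ∃ a : A, algebraMap A B a ∉ q ∧ a • d = 0 := by
  by_contra! hcon
  let f := LinearMap.toSpanSingleton A M d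
  -- By flatness, `1 ⊗ 1` comes from `Ann(d) ⊗ B`, so the annihilator of `d` generates the unit
  -- ideal of `B`; it cannot map into the proper ideal `q`.
  have hex : Function.Exact (LinearMap.ker f).subtype f := LinearMap.exact_subtype_ker_map f
  have hex' := Module.Flat.rTensor_exact B hex
  have h1 : f.rTensor B (1 ⊗ₜ 1) = 0 := by simpa [f] using hd
  obtain ⟨t, ht⟩ := (hex' _).1 h1
  have key : ∀ t : LinearMap.ker f ⊗[A] B,
      TensorProduct.lid A B ((LinearMap.ker f).subtype.rTensor B t) ∈ q := by
    intro t
    induction t with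
    | zero => simp
    | add x y hx hy => rw [map_add, map_add]; exact q.add_mem hx hy
    | tmul a b =>
      simp only [LinearMap.rTensor_tmul, TensorProduct.lid_tmul, Algebra.smul_def]
      refine q.mul_mem_right _ ?_
      by_contra h
      exact hcon _ h a.2
  have := key t
  rw [ht] at this
  exact hq ((Ideal.eq_top_iff_one _).2 (by simpa using this))

/-- Every element of a flat epimorphic `A`-algebra `B` is, locally on the image of `Spec B` in
`Spec A`, a fraction of elements of `A`. -/
lemma exists_mul_eq_of_epi {A B : Type*} [CommRing A] [CommRing B] [Algebra A B] [Module.Flat A B]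
    [Algebra.IsEpi A B] (b : B) (q : Ideal B) (hq : q ≠ ⊤) :
    ∃ f a : A, algebraMap A B f ∉ q ∧ algebraMap A B f * b = algebraMap A B a := by
  let N := LinearMap.range (Algebra.linearMap A B)
  -- For an epimorphism `b ⊗ 1 = 1 ⊗ b` in `B ⊗ B`, and `1` dies modulo the image `N` of `A`. Hence
  -- the class of `b` in `B / N` dies after base change, and is killed by some `f` outside `q`.
  have h : N.mkQ b ⊗ₜ[A] (1 : B) = 0 := by
    have h1 := (Algebra.isEpi_iff_forall_one_tmul_eq A B).1 inferInstance b
    have h2 := congrArg (N.mkQ.rTensor B) h1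
    simp only [LinearMap.rTensor_tmul] at h2
    rw [← h2]
    have : N.mkQ (1 : B) = 0 := (Submodule.Quotient.mk_eq_zero N).2 ⟨1, by simp⟩
    rw [this, TensorProduct.zero_tmul]
  obtain ⟨f, hf, hfb⟩ := exists_smul_eq_zero h q hq
  rw [← map_smul, Submodule.mkQ_apply, Submodule.Quotient.mk_eq_zero] at hfb
  obtain ⟨a, ha⟩ := hfb
  exact ⟨f, a, hf, by simpa [Algebra.smul_def] using ha.symm⟩

/-- Let `P = B ⊗[A] R` with `A ⟶ B` flat, and let `J` be an ideal of `R`. If `d : R` lies in `J P`,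
then locally at the image of every prime of `B` some multiple of `d` lies in `J`. -/
lemma exists_mul_mem_of_mem_map {A B R P : CommRingCat.{u}} {f : A ⟶ R} {g : A ⟶ B} {i : R ⟶ P}
    {j : B ⟶ P} (h : IsPushout f g i j) (hg : g.hom.Flat) {J : Ideal R} {d : R}
    (hd : i.hom d ∈ J.map i.hom) (q : PrimeSpectrum B) :
    ∃ a : A, a ∉ (PrimeSpectrum.comap g.hom q).asIdeal ∧ f.hom a * d ∈ J := by
  algebraize [f.hom, g.hom]
  have : Module.Flat A B := hg
  -- Morally `T` is `P / J P`. Only the map `P ⟶ T` killing `J P` is needed, and the universal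
  -- property of the pushout provides it.
  let T := (R ⧸ J) ⊗[A] B
  let α : R ⟶ CommRingCat.of T := CommRingCat.ofHom
    ((Algebra.TensorProduct.includeLeftRingHom (R := A) (A := R ⧸ J) (B := B)).comp
      (Ideal.Quotient.mk J))
  let β : B ⟶ CommRingCat.of T := CommRingCat.ofHom
    (Algebra.TensorProduct.includeRight (R := A) (A := R ⧸ J) (B := B)).toRingHom
  have hαβ : f ≫ α = g ≫ β := by
    ext a
    change (algebraMap A (R ⧸ J) a) ⊗ₜ[A] (1 : B) = 1 ⊗ₜ algebraMap A B a
    rw [Algebra.algebraMap_eq_smul_one, Algebra.algebraMap_eq_smul_one, TensorProduct.smul_tmul]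
  have hle : J.map i.hom ≤ RingHom.ker (h.desc α β hαβ).hom := by
    rw [Ideal.map_le_iff_le_comap]
    intro x hx
    change (i ≫ h.desc α β hαβ).hom x = 0
    rw [h.inl_desc]
    change (Ideal.Quotient.mk J x) ⊗ₜ[A] (1 : B) = 0
    rw [Ideal.Quotient.eq_zero_iff_mem.2 hx, TensorProduct.zero_tmul]
  have h0 : (Ideal.Quotient.mk J d) ⊗ₜ[A] (1 : B) = 0 := by
    have h1 : (i ≫ h.desc α β hαβ).hom d = 0 := hle hd
    rw [h.inl_desc] at h1
    exact h1
  obtain ⟨a, ha, had⟩ := exists_smul_eq_zero h0 q.asIdeal q.isPrime.ne_top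
  refine ⟨a, ha, ?_⟩
  rw [← Ideal.Quotient.eq_zero_iff_mem, ← had, Algebra.smul_def, map_mul]
  rfl

/-- An element of a finite product is the sum of its components, and multiplying by the idempotent
`Pi.single i 1` places each component in the extended ideal. -/
lemma mem_map_pi {A ι : Type*} [CommRing A] [Finite ι] {B : ι → Type*} [∀ i, CommRing (B i)]
    (f : ∀ i, A →+* B i) (J : Ideal A) (x : ∀ i, B i) (hx : ∀ i, x i ∈ J.map (f i)) :
    x ∈ J.map (RingHom.pi f) := by
  classical
  have := Fintype.ofFinite ι
  have h (i : ι) (y : B i) (hy : y ∈ J.map (f i)) : Pi.single i y ∈ J.map (RingHom.pi f) := by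
    refine Submodule.span_induction ?_ ?_ ?_ ?_ hy
    · rintro _ ⟨j, hj, rfl⟩
      have : Pi.single i (f i j) = Pi.single i 1 * RingHom.pi f j := by
        rw [← Pi.single_mul_left]
        simp
      rw [this]
      exact Ideal.mul_mem_left _ _ (Ideal.mem_map_of_mem _ hj)
    · simp
    · intro a b _ _ ha hb
      rw [Pi.single_add]
      exact Ideal.add_mem _ ha hb
    · intro a b _ hb
      rw [smul_eq_mul, Pi.single_mul]
      exact Ideal.mul_mem_left _ _ hb
  rw [← Finset.univ_sum_single x]
  exact Ideal.sum_mem _ fun i _ => h i _ (hx i)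

end SchematicAux

/-! ### Local fractions and local membership in ideals on a schematic space. -/

namespace RingedPoset.IsSchematic

open SchematicAux

variable {X : RingedPoset.{u}}

lemma exists_res_mul_eq (hX : X.IsSchematic) {x y : X} (h : x ≤ y) (b : X.O.obj y) (q : PrimeSpectrum (X.O.obj y)) :
    ∃ f a : X.O.obj x, (X.res h).hom f ∉ q.asIdeal ∧ (X.res h).hom f * b = (X.res h).hom a := by
  algebraize [(X.res h).hom]
  have : Module.Flat (X.O.obj x) (X.O.obj y) := hX.flat h
  have : Algebra.IsEpi (X.O.obj x) (X.O.obj y) := CommRingCat.epi_iff_epi.1 (hX.epi h)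
  exact exists_mul_eq_of_epi b q.asIdeal q.isPrime.ne_top

/-- An element of `𝒪 z` which lies in the extension of `J` at all points above `y` and `z` lies
in `J` locally around the image of every point of `Spec 𝒪 y` in `Spec 𝒪 t`. -/
lemma exists_res_mul_mem (hX : X.IsSchematic) {t y z : X} (hy : t ≤ y) (hz : t ≤ z) {J : Ideal (X.O.obj z)}
    {d : X.O.obj z} (hd : ∀ (w : X) (h : z ≤ w), y ≤ w → (X.res h).hom d ∈ J.map (X.res h).hom)
    (q : PrimeSpectrum (X.O.obj y)) :
    ∃ a : X.O.obj t, (X.res hy).hom a ∉ q.asIdeal ∧ (X.res hz).hom a * d ∈ J := by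
  refine exists_mul_mem_of_mem_map (IsPushout.of_hasPushout (X.res hz) (X.res hy)) (hX.flat hy)
    ?_ q
  have hff := hX.faithfullyFlat hz hy
  algebraize [(X.tensorToProd hz hy).hom]
  have : Module.FaithfullyFlat ↑(pushout (X.res hz) (X.res hy))
    ((w : {w : X // z ≤ w ∧ y ≤ w}) → X.O.obj w) := hff
  -- Ideals are contracted from their extensions along the faithfully flat map `𝒪 z ⊗ 𝒪 y ⟶ ∏ 𝒪 w`,
  -- so membership can be tested at each `w` above `z` and `y`.
  rw [← Ideal.comap_map_eq_self_of_faithfullyFlat (B := ∀ w : {w : X // z ≤ w ∧ y ≤ w}, X.O.obj w)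
    (Ideal.map (pushout.inl (X.res hz) (X.res hy)).hom J), Ideal.mem_comap]
  change (X.tensorToProd hz hy).hom _ ∈ Ideal.map (X.tensorToProd hz hy).hom _
  rw [Ideal.map_map, ← CommRingCat.hom_comp]
  change (pushout.inl _ _ ≫ X.tensorToProd hz hy).hom d ∈ _
  rw [tensorToProd, pushout.inl_desc]
  exact mem_map_pi _ _ _ fun w => hd w.1 w.2.1 w.2.2

end RingedPoset.IsSchematic

/-! ### Sections over open subsets of an affine scheme described by fractions. -/

namespace SchematicAux

open AlgebraicGeometry TopologicalSpace

/-- Sections of the structure sheaf of `Spec A`. -/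
noncomputable abbrev Sec (A : CommRingCat.{u}) (U : Opens (PrimeSpectrum.Top A)) : CommRingCat.{u} :=
  (Spec.toLocallyRingedSpace.obj (op A)).presheaf.obj (op U)

/-- The section given by an element of `A`. -/
noncomputable def toSec (A : CommRingCat.{u}) (U : Opens (PrimeSpectrum.Top A)) : A →+* Sec A U :=
  StructureSheaf.openAlgebra A (op U) |>.algebraMap

variable {A B : CommRingCat.{u}}

lemma res_toSec {U V : Opens (PrimeSpectrum.Top A)} (h : U ≤ V) (a : A) :
    (Spec.toLocallyRingedSpace.obj (op A)).presheaf.map (homOfLE h).op (toSec A V a) =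
      toSec A U a := rfl

lemma app_toSec (φ : A ⟶ B) (U : Opens (PrimeSpectrum.Top A)) (a : A) :
    (Spec.toLocallyRingedSpace.map φ.op).c.app (op U) (toSec A U a) =
      toSec B ((Opens.map (Spec.topMap φ)).obj U) (φ.hom a) :=
  congr($(StructureSheaf.toOpen_comp_comap φ.hom U) a)

lemma _root_.LocalizedModule.mk_mul_mk_cancel {A : Type*} [CommRing A] {M : Submonoid A} (m : M) :
    (LocalizedModule.mk 1 m : LocalizedModule M A) * LocalizedModule.mk m.1 1 = 1 := by
  refine (LocalizedModule.mk_mul_mk (a₁ := 1) (a₂ := m.1) (s₁ := m) (s₂ := 1)).trans ?_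
  rw [one_mul, mul_one]
  exact (LocalizedModule.mk_eq.2 ⟨1, by simp [Submonoid.smul_def]⟩ :
    (LocalizedModule.mk m.1 m : LocalizedModule M A) = LocalizedModule.mk 1 1).trans
      (by simp [OreLocalization.one_def])

/-- At every point of `U` some denominator is invertible, so the equations determine the value of
the section there. -/
lemma sec_mul_ext {U : Opens (PrimeSpectrum.Top A)} (S : Set (A × A))
    (hcov : ∀ g ∈ U, ∃ fa ∈ S, fa.1 ∉ g.asIdeal) {s t : Sec A U}
    (hs : ∀ fa ∈ S, toSec A U fa.1 * s = toSec A U fa.2)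
    (ht : ∀ fa ∈ S, toSec A U fa.1 * t = toSec A U fa.2) : s = t := by
  refine Subtype.ext (a1 := (s : (structureSheafInType A A).obj.obj (op U)))
    (a2 := (t : (structureSheafInType A A).obj.obj (op U))) (funext fun g => ?_)
  obtain ⟨fa, hfa, hg⟩ := hcov g.1 g.2
  have := g.1.isPrime
  have hu := LocalizedModule.mk_mul_mk_cancel (M := g.1.asIdeal.primeCompl) (⟨fa.1, hg⟩ : g.1.asIdeal.primeCompl)
  have h1 : (LocalizedModule.mk fa.1 1 : StructureSheaf.Localizations A g.1) *
      (s : (structureSheafInType A A).obj.obj (op U)).1 g = LocalizedModule.mk fa.1 1 *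
      (t : (structureSheafInType A A).obj.obj (op U)).1 g :=
    congrFun (congrArg Subtype.val ((hs fa hfa).trans (ht fa hfa).symm :)) g
  refine (one_mul _).symm.trans (Eq.trans ?_ (one_mul _))
  exact (congrArg (· * _) hu.symm).trans (((mul_assoc _ _ _).trans (congrArg _ h1)).trans
    ((mul_assoc _ _ _).symm.trans (congrArg (· * _) hu)))

/-- The value at a point is `a / f` for any pair whose denominator is invertible there; `hcomp`
makes it independent of the pair, hence locally constant as a fraction. The resulting equation holds
for every pair in `S`, including those whose denominator vanishes somewhere on `U`. -/
lemma exists_sec {U : Opens (PrimeSpectrum.Top A)} (S : Set (A × A))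
    (hcov : ∀ g ∈ U, ∃ fa ∈ S, fa.1 ∉ g.asIdeal)
    (hcomp : ∀ g ∈ U, ∀ s ∈ S, ∀ t ∈ S, ∃ h ∉ g.asIdeal, h * (s.2 * t.1 - t.2 * s.1) = 0) :
    ∃ s : Sec A U, ∀ fa ∈ S, toSec A U fa.1 * s = toSec A U fa.2 := by
  choose! F hF hF' using hcov
  have key (g : PrimeSpectrum A) (hg : g ∈ U) (s : A × A) (hs : s ∈ S) (t : A × A) (ht : t ∈ S)
      (hs' : s.1 ∉ g.asIdeal) (ht' : t.1 ∉ g.asIdeal) :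
      (LocalizedModule.mk s.2 (⟨s.1, hs'⟩ : g.asIdeal.primeCompl) :
        StructureSheaf.Localizations A g) = LocalizedModule.mk t.2 ⟨t.1, ht'⟩ := by
    obtain ⟨h, hh, he⟩ := hcomp g hg s hs t ht
    rw [LocalizedModule.mk_eq]
    refine ⟨⟨h, hh⟩, ?_⟩
    simp only [Submonoid.smul_def, smul_eq_mul]
    linear_combination he
  refine ⟨(⟨fun g => LocalizedModule.mk (F g.1).2 ⟨(F g.1).1, hF' g.1 g.2⟩, fun g => ?_⟩ :
    (structureSheafInType A A).obj.obj (op U)), fun fa hfa => ?_⟩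
  · refine ⟨U ⊓ PrimeSpectrum.basicOpen (F g.1).1, ⟨g.2, hF' g.1 g.2⟩, homOfLE inf_le_left,
      (F g.1).2, (F g.1).1, fun g' => ⟨g'.2.2, ?_⟩⟩
    exact key _ g'.2.1 _ (hF _ g'.2.1) _ (hF _ g.2) _ _
  · refine Subtype.ext (funext fun g => ?_)
    obtain ⟨h, hh, he⟩ := hcomp g.1 g.2 _ hfa _ (hF g.1 g.2)
    refine (LocalizedModule.mk_mul_mk (a₁ := fa.1) (a₂ := (F g.1).2) (s₁ := 1)
      (s₂ := ⟨(F g.1).1, hF' g.1 g.2⟩)).trans ?_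
    change _ = LocalizedModule.mk fa.2 1
    rw [LocalizedModule.mk_eq]
    refine ⟨⟨h, hh⟩, ?_⟩
    simp only [Submonoid.smul_def, smul_eq_mul, one_mul, OneMemClass.coe_one]
    linear_combination -he

end SchematicAux

/-! ### Points and closed subsets of `Spec X`. -/

namespace RingedPoset

open SchematicAux AlgebraicGeometry TopologicalSpace

/-- The point of `Spec X` given by a point of `Spec 𝒪 x`. -/
noncomputable def specPt (X : RingedPoset.{u}) (x : X) (p : PrimeSpectrum (X.O.obj x)) : X.Spec :=
  (X.specι x).base p

lemma specPt_comap_res (X : RingedPoset.{u}) {x y : X} (h : x ≤ y)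
    (q : PrimeSpectrum (X.O.obj y)) :
    X.specPt x (PrimeSpectrum.comap (X.res h).hom q) = X.specPt y q :=
  congr(($(X.map_res_specι h)).base q)

lemma exists_specPt_eq (X : RingedPoset.{u}) (v : X.Spec) :
    ∃ (x : X) (p : PrimeSpectrum (X.O.obj x)), X.specPt x p = v := by
  obtain ⟨x, p, h⟩ := LocallyRingedSpace.colimit_exists_rep (F := X.specDiagram) v
  exact ⟨x.unop, p, h⟩

lemma isOpen_spec_iff (X : RingedPoset.{u}) {V : Set X.Spec} :
    IsOpen V ↔ ∀ x, IsOpen (X.specPt x ⁻¹' V) :=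
  (LocallyRingedSpace.isOpen_colimit_iff (F := X.specDiagram)).trans
    ⟨fun h x => h (op x), fun h x => h x.unop⟩

lemma specMap_specPt {X Y : RingedPoset.{u}} (f : X ⟶ Y) (x : X)
    (p : PrimeSpectrum (X.O.obj x)) :
    (specMap f).base (X.specPt x p) =
      Y.specPt (Hom.base f x) (PrimeSpectrum.comap (Hom.stalk f x).hom p) :=
  congr(($(specι_specMap f x)).base p)

/-- Points of `Spec X` agree if and only if they are restrictions of a common point. -/
lemma IsSchematic.exists_of_specPt_eq {X : RingedPoset.{u}} (hX : X.IsSchematic) {x y : X}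
    {p : PrimeSpectrum (X.O.obj x)} {q : PrimeSpectrum (X.O.obj y)}
    (h : X.specPt x p = X.specPt y q) :
    ∃ (z : X) (hx : x ≤ z) (hy : y ≤ z) (r : PrimeSpectrum (X.O.obj z)),
      PrimeSpectrum.comap (X.res hx).hom r = p ∧ PrimeSpectrum.comap (X.res hy).hom r = q := by
  refine LocallyRingedSpace.rel_of_colimit_eq (F := X.specDiagram) (j := op x) (k := op y)
    (x := p) (y := q) h
    { r := fun a b : Σ j : (X : Type u)ᵒᵖ, PrimeSpectrum (X.O.obj j.unop) =>
        ∃ (z : X) (hx : a.1.unop ≤ z) (hy : b.1.unop ≤ z) (r : PrimeSpectrum (X.O.obj z)),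
          PrimeSpectrum.comap (X.res hx).hom r = a.2 ∧ PrimeSpectrum.comap (X.res hy).hom r = b.2
      iseqv := ⟨?_, ?_, ?_⟩ } ?_
  · rintro ⟨x, p⟩
    refine ⟨x.unop, le_refl _, le_refl _, p, ?_, ?_⟩ <;> (rw [res_self]; rfl)
  · rintro a b ⟨z, hx, hy, r, h1, h2⟩
    exact ⟨z, hy, hx, r, h2, h1⟩
  · rintro ⟨a, p⟩ ⟨b, q⟩ ⟨c, s⟩ ⟨z, hx, hy, r, h1, h2⟩ ⟨z', hx', hy', r', h1', h2'⟩
    dsimp only at hx hy hx' hy' h1 h2 h1' h2'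
    -- For transitivity, the middle point `q` lies in the images of both `z` and `z'`, hence in that
    -- of a common `w`. Injectivity of spectra along epimorphisms identifies the restrictions of `t`
    -- with `r` and `r'`.
    obtain ⟨w, hzw, hzw', hbw, t, ht⟩ := hX.exists_le hy hx' (p := q) ⟨r, h2⟩ ⟨r', h1'⟩
    have := hX.epi hy
    have := hX.epi hx'
    have e1 : PrimeSpectrum.comap (X.res hzw).hom t = r := by
      apply comap_injective_of_epi (X.res hy)
      rw [h2, ← ht, ← comap_comp_apply, res_res]
    have e2 : PrimeSpectrum.comap (X.res hzw').hom t = r' := by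
      apply comap_injective_of_epi (X.res hx')
      rw [h1', ← ht, ← comap_comp_apply, res_res]
    refine ⟨w, hx.trans hzw, hy'.trans hzw', t, ?_, ?_⟩
    · rw [← h1, ← e1, ← comap_comp_apply, res_res]
    · rw [← h2', ← e2, ← comap_comp_apply, res_res]
  · rintro ⟨x⟩ ⟨y⟩ f p
    refine ⟨x, le_refl _, leOfHom f.unop, p, ?_, rfl⟩
    rw [res_self]
    rfl

/-- The closed subset of `Spec X` generated by a closed subset `V(I)` of some `Spec 𝒪 y`; its trace
on `Spec 𝒪 t` is the closed subset defined by this ideal. -/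
noncomputable def closureIdeal (X : RingedPoset.{u}) {y : X} (I : Ideal (X.O.obj y)) (t : X) :
    Ideal (X.O.obj t) :=
  ⨅ z : {z : X // y ≤ z ∧ t ≤ z}, (I.map (X.res z.2.1).hom).comap (X.res z.2.2).hom

lemma mem_closureIdeal {X : RingedPoset.{u}} {y : X} {I : Ideal (X.O.obj y)} {t : X}
    {a : X.O.obj t} : a ∈ X.closureIdeal I t ↔
      ∀ (z : X) (hy : y ≤ z) (ht : t ≤ z), (X.res ht).hom a ∈ I.map (X.res hy).hom := by
  simp only [closureIdeal, Submodule.mem_iInf, Ideal.mem_comap, Subtype.forall]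
  exact ⟨fun h z hy ht => h z ⟨hy, ht⟩, fun h z hz => h z hz.1 hz.2⟩

lemma res_res_apply (X : RingedPoset.{u}) {x y z : X} (h : x ≤ y) (h' : y ≤ z) (a : X.O.obj x) :
    (X.res h').hom ((X.res h).hom a) = (X.res (h.trans h')).hom a :=
  congr($(X.res_res h h') a)

lemma map_res_map_res (X : RingedPoset.{u}) {x y z : X} (h : x ≤ y) (h' : y ≤ z)
    (I : Ideal (X.O.obj x)) :
    (I.map (X.res h).hom).map (X.res h').hom = I.map (X.res (h.trans h')).hom := by
  rw [Ideal.map_map, ← CommRingCat.hom_comp, res_res]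

/-- This shows that the closed subsets `V(X.closureIdeal I t)` of the charts agree on overlaps, so
that they define a closed subset of `Spec X`. The reason is that finite intersections of ideals are
compatible with flat base change. Concretely, an element at `t'` outside `q` is locally a fraction
`a / f` over `𝒪 t`; multiplying `a` by finitely many factors outside `q`, one for each `z`, places
it in the ideal at `t`. -/
lemma IsSchematic.closureIdeal_le_iff {X : RingedPoset.{u}} (hX : X.IsSchematic) {y : X}
    (I : Ideal (X.O.obj y)) {t t' : X} (h : t ≤ t') (q : PrimeSpectrum (X.O.obj t')) :
    X.closureIdeal I t ≤ (PrimeSpectrum.comap (X.res h).hom q).asIdeal ↔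
      X.closureIdeal I t' ≤ q.asIdeal := by
  constructor
  · intro hle e he
    by_contra hq
    obtain ⟨f, a, hf, hfa⟩ := hX.exists_res_mul_eq h e q
    rw [mem_closureIdeal] at he
    have h1 (z : {z : X // y ≤ z ∧ t ≤ z}) : ∃ c : X.O.obj t, (X.res h).hom c ∉ q.asIdeal ∧
        (X.res z.2.2).hom c * (X.res z.2.2).hom a ∈ I.map (X.res z.2.1).hom := by
      refine hX.exists_res_mul_mem h z.2.2 (fun w hzw htw => ?_) q
      rw [map_res_map_res, res_res_apply, ← res_res_apply X h htw, ← hfa, map_mul]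
      exact Ideal.mul_mem_left _ _ (he w _ htw)
    choose c hc hc' using h1
    have := Fintype.ofFinite {z : X // y ≤ z ∧ t ≤ z}
    have h2 : (∏ z, c z) * a ∈ X.closureIdeal I t := by
      rw [mem_closureIdeal]
      intro z hy ht
      obtain ⟨d, hd⟩ := Finset.dvd_prod_of_mem c (Finset.mem_univ ⟨z, hy, ht⟩)
      rw [hd, mul_right_comm, map_mul, map_mul]
      exact Ideal.mul_mem_right _ _ (hc' ⟨z, hy, ht⟩)
    have h3 : (X.res h).hom ((∏ z, c z) * a) ∈ q.asIdeal := hle h2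
    rw [map_mul, ← hfa, map_prod] at h3
    rcases q.isPrime.mem_or_mem h3 with h4 | h4
    · obtain ⟨z, -, hz⟩ := (q.isPrime.prod_mem_iff).1 h4
      exact hc z hz
    · exact (q.isPrime.mem_or_mem h4).elim hf hq
  · intro hle a ha
    refine hle ?_
    rw [mem_closureIdeal] at ha ⊢
    intro z hy ht
    rw [res_res_apply]
    exact ha z hy _

end RingedPoset

namespace SchematicAux

open AlgebraicGeometry TopologicalSpace

/-- The ring map between sections given by a ring map. -/
noncomputable def secMap {A B : CommRingCat.{u}} (φ : A ⟶ B)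
    {U : Opens (PrimeSpectrum.Top A)} {U' : Opens (PrimeSpectrum.Top B)}
    (hle : U' ≤ (Opens.map (Spec.topMap φ)).obj U) : Sec A U →+* Sec B U' :=
  ((Spec.toLocallyRingedSpace.obj (op B)).presheaf.map (homOfLE hle).op).hom.comp
    ((Spec.toLocallyRingedSpace.map φ.op).c.app (op U)).hom

lemma toSec_mul_secMap {A B : CommRingCat.{u}} (φ : A ⟶ B)
    {U : Opens (PrimeSpectrum.Top A)} {U' : Opens (PrimeSpectrum.Top B)}
    (hle : U' ≤ (Opens.map (Spec.topMap φ)).obj U) {f a : A} {s : Sec A U}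
    (h : toSec A U f * s = toSec A U a) :
    toSec B U' (φ.hom f) * secMap φ hle s = toSec B U' (φ.hom a) := by
  have hΦ (c : A) : secMap φ hle (toSec A U c) = toSec B U' (φ.hom c) :=
    (congrArg _ (app_toSec φ U c)).trans (res_toSec hle _)
  rw [← hΦ, ← map_mul, h, hΦ]

end SchematicAux

/-! ### Extension of elements of `𝒪 x` to sections of the structure sheaf of `Spec X`. -/

namespace RingedPoset

open SchematicAux AlgebraicGeometry TopologicalSpace

/-- The open subset of `Spec X` which is the complement of the closed subsets generated by the
`V(I y)`, `y ∈ X`. -/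
lemma IsSchematic.exists_opens {X : RingedPoset.{u}} (hX : X.IsSchematic)
    (I : ∀ y : X, Ideal (X.O.obj y)) :
    ∃ V : Opens X.Spec, ∀ (t : X) (p : PrimeSpectrum (X.O.obj t)),
      X.specPt t p ∈ V ↔ ∀ y, ¬ X.closureIdeal (I y) t ≤ p.asIdeal := by
  have key (t : X) (p : PrimeSpectrum (X.O.obj t)) :
      X.specPt t p ∈ {v : X.Spec | ∀ (t : X) (p : PrimeSpectrum (X.O.obj t)),
        X.specPt t p = v → ∀ y, ¬ X.closureIdeal (I y) t ≤ p.asIdeal} ↔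
      ∀ y, ¬ X.closureIdeal (I y) t ≤ p.asIdeal := by
    refine ⟨fun h => h t p rfl, fun h t' p' he y => ?_⟩
    obtain ⟨z, ht', ht, r, rfl, rfl⟩ := hX.exists_of_specPt_eq he
    rw [hX.closureIdeal_le_iff, ← hX.closureIdeal_le_iff (I y) ht r]
    exact h y
  refine ⟨⟨{v : X.Spec | ∀ (t : X) (p : PrimeSpectrum (X.O.obj t)),
    X.specPt t p = v → ∀ y, ¬ X.closureIdeal (I y) t ≤ p.asIdeal},
    X.isOpen_spec_iff.2 fun t => ?_⟩, key⟩
  have : X.specPt t ⁻¹' {v : X.Spec | ∀ (t : X) (p : PrimeSpectrum (X.O.obj t)),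
      X.specPt t p = v → ∀ y, ¬ X.closureIdeal (I y) t ≤ p.asIdeal} =
      ⋂ y, (PrimeSpectrum.zeroLocus (X.closureIdeal (I y) t : Set (X.O.obj t)))ᶜ := by
    ext p
    rw [Set.mem_preimage, key]
    simp [PrimeSpectrum.mem_zeroLocus]
  rw [this]
  exact isOpen_iInter_of_finite fun y => (PrimeSpectrum.isClosed_zeroLocus _).isOpen_compl

/-- The fractions in `𝒪 y` which represent an element `b` of `𝒪 x` on the intersection of
`Spec 𝒪 x` and `Spec 𝒪 y`. -/
def fracs (X : RingedPoset.{u}) {x : X} (b : X.O.obj x) (y : X) :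
    Set (X.O.obj y × X.O.obj y) :=
  {s | ∀ (z : X) (hy : y ≤ z) (hx : x ≤ z),
    (X.res hy).hom s.1 * (X.res hx).hom b = (X.res hy).hom s.2}

lemma res_mem_fracs {X : RingedPoset.{u}} {x : X} {b : X.O.obj x} {y y' : X} (h : y ≤ y')
    {s : X.O.obj y × X.O.obj y} (hs : s ∈ X.fracs b y) :
    ((X.res h).hom s.1, (X.res h).hom s.2) ∈ X.fracs b y' := by
  intro z hy hx
  rw [res_res_apply, res_res_apply]
  exact hs z _ hx

namespace IsSchematic

variable {X : RingedPoset.{u}}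

lemma exists_mul_eq_zero (hX : X.IsSchematic) {t y z : X} (hy : t ≤ y) (hz : t ≤ z)
    {d : X.O.obj z} (hd : ∀ (w : X) (h : z ≤ w), y ≤ w → (X.res h).hom d = 0)
    (q : PrimeSpectrum (X.O.obj y)) :
    ∃ a : X.O.obj t, (X.res hy).hom a ∉ q.asIdeal ∧ (X.res hz).hom a * d = 0 := by
  obtain ⟨a, ha, had⟩ := hX.exists_res_mul_mem hy hz (J := ⊥) (d := d)
    (fun w h h' => by rw [hd w h h']; exact Ideal.zero_mem _) q
  exact ⟨a, ha, by simpa using had⟩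

/-- A fraction representing `b` near `q` satisfies its equation only at points above `z`. At each of
the finitely many `w` above `x` and `y` the defect is killed by some `c w` not vanishing at `q`;
multiplying numerator and denominator by all of them repairs the equation everywhere. -/
lemma exists_mem_fracs (hX : X.IsSchematic) {x : X} (b : X.O.obj x) {y z : X} (hy : y ≤ z)
    (hx : x ≤ z) (q : PrimeSpectrum (X.O.obj z)) :
    ∃ s ∈ X.fracs b y, (X.res hy).hom s.1 ∉ q.asIdeal := by
  obtain ⟨f, a, hf, hfa⟩ := hX.exists_res_mul_eq hy ((X.res hx).hom b) q
  have h1 (w : {w : X // y ≤ w ∧ x ≤ w}) : ∃ c : X.O.obj y, (X.res hy).hom c ∉ q.asIdeal ∧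
      (X.res w.2.1).hom c *
        ((X.res w.2.1).hom f * (X.res w.2.2).hom b - (X.res w.2.1).hom a) = 0 := by
    refine hX.exists_mul_eq_zero hy w.2.1 (fun v hv hzv => ?_) q
    have := congrArg (X.res hzv).hom hfa
    rw [map_mul, res_res_apply, res_res_apply, res_res_apply] at this
    rw [map_sub, map_mul, res_res_apply, res_res_apply, res_res_apply, this, sub_self]
  choose c hc hc' using h1
  have := Fintype.ofFinite {w : X // y ≤ w ∧ x ≤ w}
  refine ⟨((∏ w, c w) * f, (∏ w, c w) * a), fun w hy' hx' => ?_, ?_⟩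
  · obtain ⟨d, hd⟩ := Finset.dvd_prod_of_mem c (Finset.mem_univ ⟨w, hy', hx'⟩)
    have := hc' ⟨w, hy', hx'⟩
    simp only at this ⊢
    rw [hd, map_mul, map_mul, map_mul, map_mul]
    linear_combination (X.res hy').hom d * this
  · rw [map_mul, map_prod]
    intro h3
    rcases q.isPrime.mem_or_mem h3 with h4 | h4
    · obtain ⟨w, -, hw⟩ := (q.isPrime.prod_mem_iff).1 h4
      exact hc w hw
    · exact hf h4

/-- The overlap of the charts of `x` and `y` is quasi-compact, being a finite union of images of
spectra. Finiteness is needed later to treat all pairs of fractions at once. -/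
lemma exists_finite_fracs (hX : X.IsSchematic) {x : X} (b : X.O.obj x) (y : X) :
    ∃ S : Set (X.O.obj y × X.O.obj y), S.Finite ∧ S ⊆ X.fracs b y ∧
      ∀ (z : X) (hy : y ≤ z), x ≤ z → ∀ q : PrimeSpectrum (X.O.obj z),
        ∃ s ∈ S, (X.res hy).hom s.1 ∉ q.asIdeal := by
  have hK : IsCompact (⋃ z : {z : X // y ≤ z ∧ x ≤ z}, X.im z.2.1) :=
    isCompact_iUnion fun z => isCompact_range (PrimeSpectrum.continuous_comap _)
  obtain ⟨T, hT⟩ := hK.elim_finite_subcover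
    (fun s : X.fracs b y => (PrimeSpectrum.basicOpen s.1.1 : Set (PrimeSpectrum (X.O.obj y))))
    (fun s => (PrimeSpectrum.basicOpen s.1.1).2) (by
      intro g hg
      obtain ⟨z, q, rfl⟩ := Set.mem_iUnion.1 hg
      obtain ⟨s, hs, h⟩ := hX.exists_mem_fracs b z.2.1 z.2.2 q
      exact Set.mem_iUnion.2 ⟨⟨s, hs⟩, h⟩)
  refine ⟨Subtype.val '' (T : Set (X.fracs b y)), T.finite_toSet.image _, ?_, ?_⟩
  · rintro _ ⟨s, -, rfl⟩
    exact s.2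
  · intro z hy hx q
    have := hT (Set.mem_iUnion.2 ⟨⟨z, hy, hx⟩, q, rfl⟩)
    simp only [Set.mem_iUnion] at this
    obtain ⟨s, hs, h⟩ := this
    exact ⟨s.1, ⟨s, hs, rfl⟩, h⟩

/-- Every element of `𝒪 x` extends to a section of the structure sheaf of `Spec X` over an open
neighbourhood of `Spec 𝒪 x`. -/
theorem exists_section (hX : X.IsSchematic) {x : X} (b : X.O.obj x) :
    ∃ (V : Opens X.Spec) (s : X.Spec.presheaf.obj (op V)),
      (∀ p, X.specPt x p ∈ V) ∧ (X.specι x).c.app (op V) s = toSec (X.O.obj x) _ b := by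
  choose S hSfin hS hSq using hX.exists_finite_fracs b
  -- Including the restrictions of the fractions chosen at points below `y` lets the sections
  -- constructed on different charts be compared.
  let S' (y : X) : Set (X.O.obj y × X.O.obj y) := ⋃ t : {t : X // t ≤ y},
    (fun s => ((X.res t.2).hom s.1, (X.res t.2).hom s.2)) '' S t.1
  have hS'fin (y : X) : (S' y).Finite := Set.finite_iUnion fun t => (hSfin t.1).image _
  have hS'mem {t y : X} (h : t ≤ y) {s : X.O.obj t × X.O.obj t} (hs : s ∈ S t) :
      ((X.res h).hom s.1, (X.res h).hom s.2) ∈ S' y :=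
    Set.mem_iUnion.2 ⟨⟨t, h⟩, s, hs, rfl⟩
  have hSS' (y : X) : S y ⊆ S' y := by
    intro s hs
    have := hS'mem (le_refl y) hs
    simpa using this
  have hS' (y : X) : S' y ⊆ X.fracs b y := by
    intro s hs
    obtain ⟨t, s, hs', rfl⟩ := Set.mem_iUnion.1 hs
    exact res_mem_fracs t.2 (hS _ hs')
  -- Away from `V(I y)` some denominator from `S y` is invertible and any two fractions from `S' y`
  -- agree locally, so the fractions define a section.
  let I (y : X) : Ideal (X.O.obj y) := Ideal.span (Prod.fst '' S y) ⊓
    ⨅ s : S' y × S' y, Submodule.annihilator (Ideal.span {s.1.1.2 * s.2.1.1 - s.2.1.2 * s.1.1.1})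
  have hI1 (y : X) (g : PrimeSpectrum (X.O.obj y)) (hg : ¬ I y ≤ g.asIdeal) :
      ∃ s ∈ S y, s.1 ∉ g.asIdeal := by
    by_contra! hcon
    refine hg (inf_le_left.trans (Ideal.span_le.2 ?_))
    rintro _ ⟨s, hs, rfl⟩
    exact hcon s hs
  have hI2 (y : X) (g : PrimeSpectrum (X.O.obj y)) (hg : ¬ I y ≤ g.asIdeal) :
      ∀ s ∈ S' y, ∀ t ∈ S' y, ∃ h ∉ g.asIdeal, h * (s.2 * t.1 - t.2 * s.1) = 0 := by
    intro s hs t ht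
    obtain ⟨h, hh, hh'⟩ := SetLike.not_le_iff_exists.1 hg
    have h1 := (Submodule.mem_iInf _).1 hh.2 (⟨s, hs⟩, ⟨t, ht⟩)
    exact ⟨h, hh', Submodule.mem_annihilator.1 h1 _ (Ideal.mem_span_singleton_self _)⟩
  -- The bad locus `V(I y)` misses every chart above `x` and `y`, because all the fractions
  -- represent `b` there. Consequently its closure in `Spec X` misses `Spec 𝒪 x`, and `V` contains
  -- this chart.
  have hI3 (y z : X) (hy : y ≤ z) (hx : x ≤ z) : (I y).map (X.res hy).hom = ⊤ := by
    by_contra hne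
    obtain ⟨m, hm, hle⟩ := Ideal.exists_le_maximal _ hne
    let q : PrimeSpectrum (X.O.obj z) := ⟨m, hm.isPrime⟩
    obtain ⟨s, hs, hsq⟩ := hSq y z hy hx q
    have h1 (a : S' y × S' y) : ∃ h : X.O.obj y, (X.res hy).hom h ∉ q.asIdeal ∧
        h * (a.1.1.2 * a.2.1.1 - a.2.1.2 * a.1.1.1) = 0 := by
      obtain ⟨h, hh, hh'⟩ := hX.exists_mul_eq_zero hy (le_refl y)
        (d := a.1.1.2 * a.2.1.1 - a.2.1.2 * a.1.1.1) (fun w hw hzw => by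
          have h1 := hS' y a.1.2 w hw (hx.trans hzw)
          have h2 := hS' y a.2.2 w hw (hx.trans hzw)
          rw [map_sub, map_mul, map_mul, ← h1, ← h2]
          ring) q
      exact ⟨h, hh, by simpa using hh'⟩
    choose h hh hh' using h1
    have := (hS'fin y).fintype
    refine hsq ?_
    have hmem : s.1 * ∏ a, h a ∈ I y := by
      refine ⟨Ideal.mul_mem_right _ _ (Ideal.subset_span ⟨s, hs, rfl⟩),
        (Submodule.mem_iInf _).2 fun a => ?_⟩
      refine Ideal.mul_mem_left _ _ ?_
      obtain ⟨d, hd⟩ := Finset.dvd_prod_of_mem h (Finset.mem_univ a)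
      rw [hd]
      refine Ideal.mul_mem_right _ _ ?_
      rw [Ideal.span, Submodule.mem_annihilator_span_singleton]
      exact hh' a
    have := hle (Ideal.mem_map_of_mem _ hmem)
    rw [map_mul, map_prod] at this
    refine (q.isPrime.mem_or_mem this).resolve_right fun h4 => ?_
    obtain ⟨a, -, ha⟩ := (q.isPrime.prod_mem_iff).1 h4
    exact hh a ha
  obtain ⟨V, hV⟩ := hX.exists_opens I
  have hVI (y : X) (g : PrimeSpectrum (X.O.obj y)) (hg : X.specPt y g ∈ V) :
      ¬ I y ≤ g.asIdeal := by
    intro hle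
    refine (hV y g).1 hg y (le_trans ?_ hle)
    intro a ha
    have := mem_closureIdeal.1 ha y (le_refl y) (le_refl y)
    rw [res_self] at this
    simpa using this
  have hsec (y : X) := exists_sec (U := (Opens.map (X.specι y).base).obj V) (S' y)
    (fun g hg => by
      obtain ⟨s, hs, h⟩ := hI1 y g (hVI y g hg)
      exact ⟨s, hSS' y hs, h⟩)
    (fun g hg => hI2 y g (hVI y g hg))
  choose s hs using hsec
  obtain ⟨σ, hσ⟩ := LocallyRingedSpace.colimit_exists_section (F := X.specDiagram) V
    (fun j => s j.unop) (fun j k f hle => by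
      -- Here `k.unop ≤ j.unop`. The restrictions of the fractions in `S k.unop` still have no
      -- common zero on the preimage of `V`, and they belong to `S' j.unop`; both sections satisfy
      -- their equations and hence agree.
      refine sec_mul_ext ((fun s => ((X.res (leOfHom f.unop)).hom s.1,
        (X.res (leOfHom f.unop)).hom s.2)) '' S k.unop) ?_ ?_ ?_
      · intro g hg
        obtain ⟨s, hs, h⟩ := hI1 k.unop (PrimeSpectrum.comap (X.res (leOfHom f.unop)).hom g)
          (hVI _ _ ((congrArg (· ∈ V) (X.specPt_comap_res _ g)).mpr hg))
        exact ⟨_, ⟨s, hs, rfl⟩, h⟩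
      · rintro _ ⟨a, ha, rfl⟩
        exact toSec_mul_secMap (X.res (leOfHom f.unop)) hle (hs k.unop a (hSS' _ ha))
      · rintro _ ⟨a, ha, rfl⟩
        exact hs j.unop _ (hS'mem _ ha))
  refine ⟨V, σ, fun p => (hV x p).2 fun y hle => ?_, (hσ (op x)).trans ?_⟩
  · refine p.isPrime.ne_top (top_le_iff.1 (le_trans ?_ hle))
    intro a _
    rw [mem_closureIdeal]
    intro z hy hx
    rw [hI3 y z hy hx]
    trivial
  · refine sec_mul_ext (S' x) (fun g hg => ?_) (hs x) (fun fa hfa => ?_)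
    · obtain ⟨s, hs, h⟩ := hI1 x g (hVI x g hg)
      exact ⟨s, hSS' x hs, h⟩
    · have := hS' x hfa x (le_refl x) (le_refl x)
      rw [← map_mul]
      simpa using congrArg (toSec (X.O.obj x) _) this

end IsSchematic

end RingedPoset

/-! ### Local rings of affine schemes under flat epimorphisms. -/

namespace SchematicAux

open AlgebraicGeometry TopologicalSpace TensorProduct

lemma secMap_toSec {A B : CommRingCat.{u}} (φ : A ⟶ B)
    {U : Opens (PrimeSpectrum.Top A)} {U' : Opens (PrimeSpectrum.Top B)}
    (hle : U' ≤ (Opens.map (Spec.topMap φ)).obj U) (c : A) :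
    secMap φ hle (toSec A U c) = toSec B U' (φ.hom c) :=
  (congrArg _ (app_toSec φ U c)).trans (res_toSec hle _)

/-- The stalk of `Spec A` at `p`. -/
noncomputable abbrev Stk (A : CommRingCat.{u}) (p : PrimeSpectrum A) : CommRingCat.{u} :=
  (Spec.toLocallyRingedSpace.obj (op A)).presheaf.stalk p

/-- The ring map from `A` to the stalk of `Spec A` at `p`. -/
noncomputable def toStk (A : CommRingCat.{u}) (p : PrimeSpectrum A) : A →+* Stk A p :=
  (StructureSheaf.toStalk A p).hom

variable {A B : CommRingCat.{u}}

lemma isUnit_toStk {p : PrimeSpectrum A} {a : A} (ha : a ∉ p.asIdeal) : IsUnit (toStk A p a) :=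
  have := p.isPrime
  IsLocalization.map_units (M := p.asIdeal.primeCompl)
    ((Spec.structureSheaf A).presheaf.stalk p) ⟨a, ha⟩

lemma exists_mul_toStk {p : PrimeSpectrum A} (s : Stk A p) :
    ∃ f a : A, f ∉ p.asIdeal ∧ s * toStk A p f = toStk A p a := by
  have := p.isPrime
  obtain ⟨⟨a, f⟩, h⟩ := IsLocalization.surj (S := (Spec.structureSheaf A).presheaf.stalk p)
    p.asIdeal.primeCompl s
  exact ⟨f, a, f.2, h⟩

lemma exists_of_toStk_eq_zero {p : PrimeSpectrum A} {a : A} (ha : toStk A p a = 0) :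
    ∃ f : A, f ∉ p.asIdeal ∧ f * a = 0 := by
  have := p.isPrime
  obtain ⟨f, h⟩ := (IsLocalization.map_eq_zero_iff p.asIdeal.primeCompl
    ((Spec.structureSheaf A).presheaf.stalk p) a).1 ha
  exact ⟨f, f.2, h⟩

lemma germ_toSec (U : Opens (PrimeSpectrum.Top A)) (p : PrimeSpectrum A) (hp : p ∈ U) (a : A) :
    (Spec.toLocallyRingedSpace.obj (op A)).presheaf.germ U p hp (toSec A U a) = toStk A p a :=
  StructureSheaf.algebraMap_germ_apply U p hp a

lemma stalkMap_toStk (φ : A ⟶ B) (p : PrimeSpectrum B) (a : A) :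
    (Spec.toLocallyRingedSpace.map φ.op).stalkMap p (toStk A (PrimeSpectrum.comap φ.hom p) a) =
      toStk B p (φ.hom a) :=
  stalkMap_toStalk_apply φ p a

/-- A flat epimorphism of rings induces isomorphisms on local rings. -/
lemma bijective_stalkMap_of_flat_of_epi (φ : A ⟶ B) [Epi φ] (hφ : φ.hom.Flat)
    (p : PrimeSpectrum B) :
    Function.Bijective ((Spec.toLocallyRingedSpace.map φ.op).stalkMap p) := by
  -- Elements of `B` are local fractions from `A`, by the epimorphism property; elements of `A` that
  -- vanish in `B` are killed locally, by flatness. The rest is a computation with fractions in the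
  -- two localizations.
  have hQ (b : B) : ∃ f a : A, φ.hom f ∉ p.asIdeal ∧ φ.hom f * b = φ.hom a := by
    algebraize [φ.hom]
    have : Module.Flat A B := hφ
    have : Algebra.IsEpi A B := CommRingCat.epi_iff_epi.1 ‹Epi φ›
    exact exists_mul_eq_of_epi b p.asIdeal p.isPrime.ne_top
  have hD (a : A) (ha : φ.hom a = 0) : ∃ f : A, φ.hom f ∉ p.asIdeal ∧ f * a = 0 := by
    algebraize [φ.hom]
    have : Module.Flat A B := hφ
    refine exists_smul_eq_zero (d := a) ?_ p.asIdeal p.isPrime.ne_top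
    have h1 : algebraMap A B a = 0 := ha
    apply (TensorProduct.lid A B).injective
    rw [TensorProduct.lid_tmul, map_zero, Algebra.smul_def, h1, zero_mul]
  let Φ : Stk A (PrimeSpectrum.comap φ.hom p) →+* Stk B p :=
    ((Spec.toLocallyRingedSpace.map φ.op).stalkMap p).hom
  have hΦ (a : A) : Φ (toStk A _ a) = toStk B p (φ.hom a) := stalkMap_toStk φ p a
  change Function.Bijective Φ
  constructor
  · rw [injective_iff_map_eq_zero]
    intro s hs
    obtain ⟨f, a, hf, h⟩ := exists_mul_toStk s
    have h1 : toStk B p (φ.hom a) = 0 := by rw [← hΦ, ← h, map_mul, hs, zero_mul]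
    obtain ⟨b, hb, hba⟩ := exists_of_toStk_eq_zero h1
    obtain ⟨f', c, hf', hc⟩ := hQ b
    have hc' : φ.hom c ∉ p.asIdeal := by
      rw [← hc]
      exact fun h => (p.isPrime.mem_or_mem h).elim hf' hb
    obtain ⟨g, hg, hg'⟩ := hD (c * a) (by rw [map_mul, ← hc, mul_assoc, hba, mul_zero])
    have h2 : toStk A (PrimeSpectrum.comap φ.hom p) (g * c * f) * s = 0 := by
      rw [map_mul, mul_assoc, mul_comm _ s, h, ← map_mul, mul_assoc, hg', map_zero]
    refine (isUnit_toStk ?_).mul_right_eq_zero.1 h2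
    change φ.hom (g * c * f) ∉ p.asIdeal
    rw [map_mul, map_mul]
    exact fun h => (p.isPrime.mem_or_mem h).elim
      (fun h => (p.isPrime.mem_or_mem h).elim hg hc') hf
  · intro s
    obtain ⟨b, b', hb, h⟩ := exists_mul_toStk s
    obtain ⟨f, a, hf, hfa⟩ := hQ b
    obtain ⟨f', a', hf', hfa'⟩ := hQ b'
    have ha : φ.hom a ∉ p.asIdeal := by
      rw [← hfa]
      exact fun h => (p.isPrime.mem_or_mem h).elim hf hb
    have hu : IsUnit (toStk A (PrimeSpectrum.comap φ.hom p) (f' * a)) := isUnit_toStk (by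
      change φ.hom (f' * a) ∉ p.asIdeal
      rw [map_mul]
      exact fun h => (p.isPrime.mem_or_mem h).elim hf' ha)
    obtain ⟨v, hv⟩ := hu.exists_right_inv
    refine ⟨toStk A _ (f * a') * v, ?_⟩
    have hv' : toStk B p (φ.hom (f' * a)) * Φ v = 1 := by rw [← hΦ, ← map_mul, hv, map_one]
    have h3 : s * toStk B p (φ.hom (f' * a)) = toStk B p (φ.hom (f * a')) := by
      have : φ.hom (f' * a) = b * φ.hom (f * f') := by
        rw [map_mul, ← hfa, map_mul]; ring
      rw [this, map_mul, ← mul_assoc, h, ← map_mul]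
      congr 1
      rw [map_mul, map_mul, ← hfa']; ring
    rw [map_mul, hΦ, ← h3, mul_assoc, hv', mul_one]

end SchematicAux

/-! ### The charts of `Spec X` and their local rings. -/

namespace RingedPoset.IsSchematic

open SchematicAux AlgebraicGeometry TopologicalSpace

variable {X : RingedPoset.{u}}

/-- Extended sections hit the germs of all elements of `𝒪 x`. Their inverses are hit as well, since
the stalk map is local and so reflects units. -/
lemma surjective_stalkMap_specι (hX : X.IsSchematic) (x : X) (p : PrimeSpectrum (X.O.obj x)) :
    Function.Surjective ((X.specι x).stalkMap p) := by
  let Φ : X.Spec.presheaf.stalk (X.specPt x p) →+* Stk (X.O.obj x) p :=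
    ((X.specι x).stalkMap p).hom
  have hloc : IsLocalHom Φ := (X.specι x).prop p
  have key (a : X.O.obj x) : ∃ s, Φ s = toStk _ p a := by
    obtain ⟨V, s, hV, hs⟩ := hX.exists_section a
    refine ⟨X.Spec.presheaf.germ V _ (hV p) s, ?_⟩
    refine (LocallyRingedSpace.stalkMap_germ_apply (X.specι x) V p (hV p) s).trans ?_
    rw [hs]
    exact germ_toSec _ p _ a
  intro s
  obtain ⟨f, a, hf, h⟩ := exists_mul_toStk s
  obtain ⟨s1, h1⟩ := key f
  obtain ⟨s2, h2⟩ := key a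
  have hu : IsUnit s1 := by
    apply isUnit_of_map_unit Φ
    rw [h1]
    exact isUnit_toStk hf
  obtain ⟨v, hv⟩ := hu.exists_right_inv
  refine ⟨s2 * v, ?_⟩
  change Φ (s2 * v) = s
  have hv' := congrArg Φ hv
  rw [map_mul, h1, map_one] at hv'
  rw [map_mul, h2, ← h, mul_assoc, hv', mul_one]

/-- The morphism `Spec 𝒪 x ⟶ Spec X` is a monomorphism, as far as affine schemes are concerned. -/
lemma eq_of_comp_specι (hX : X.IsSchematic) {x : X} {R : CommRingCat.{u}} {α β : X.O.obj x ⟶ R}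
    (h : AlgebraicGeometry.Spec.toLocallyRingedSpace.map α.op ≫ X.specι x =
      AlgebraicGeometry.Spec.toLocallyRingedSpace.map β.op ≫ X.specι x) : α = β := by
  ext b
  obtain ⟨V, s, hV, hs⟩ := hX.exists_section b
  -- The composite `m` is a variable, so the two sides of `h` can be compared although their
  -- sections live a priori over different open sets.
  have key (γ : X.O.obj x ⟶ R) (m) (hm : m = Spec.toLocallyRingedSpace.map γ.op ≫ X.specι x)
      (hle : ⊤ ≤ (Opens.map m.base).obj V) :
      (Spec.toLocallyRingedSpace.obj (op R)).presheaf.map (homOfLE hle).op (m.c.app (op V) s) =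
        toSec R ⊤ (γ.hom b) := by
    subst hm
    rw [LocallyRingedSpace.comp_c_app]
    exact (congrArg (secMap γ hle) hs).trans (secMap_toSec γ hle b)
  refine StructureSheaf.algebraMap_obj_top_bijective.1 (?_ : toSec R ⊤ _ = toSec R ⊤ _)
  rw [← key α _ rfl (fun p _ => hV _), ← key β _ h (fun p _ => hV _)]

end RingedPoset.IsSchematic

namespace RingedPoset

open SchematicAux AlgebraicGeometry TopologicalSpace

/-- A section of the structure sheaf of `Spec X` vanishes at a point of `Spec 𝒪 y`. -/
def VanishesAt (X : RingedPoset.{u}) (V : Opens X.Spec) (s : X.Spec.presheaf.obj (op V)) (y : X)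
    (q : PrimeSpectrum (X.O.obj y)) : Prop :=
  ∃ h : X.specPt y q ∈ V, (AlgebraicGeometry.Spec.toLocallyRingedSpace.obj
    (op (X.O.obj y))).presheaf.germ ((Opens.map (X.specι y).base).obj V) q h
      ((X.specι y).c.app (op V) s) = 0

variable {X : RingedPoset.{u}}

lemma germ_comp_specι {V : Opens X.Spec} (s : X.Spec.presheaf.obj (op V)) {y z : X}
    (φ : X.O.obj y ⟶ X.O.obj z) (r : PrimeSpectrum (X.O.obj z)) (m)
    (hm : m = AlgebraicGeometry.Spec.toLocallyRingedSpace.map φ.op ≫ X.specι y)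
    (h : m.base r ∈ V) (h' : X.specPt y (PrimeSpectrum.comap φ.hom r) ∈ V) :
    (AlgebraicGeometry.Spec.toLocallyRingedSpace.obj (op (X.O.obj z))).presheaf.germ
      ((Opens.map m.base).obj V) r h (m.c.app (op V) s) =
    (Spec.toLocallyRingedSpace.map φ.op).stalkMap r
      ((AlgebraicGeometry.Spec.toLocallyRingedSpace.obj (op (X.O.obj y))).presheaf.germ
        ((Opens.map (X.specι y).base).obj V) (PrimeSpectrum.comap φ.hom r) h'
          ((X.specι y).c.app (op V) s)) := by
  subst hm
  exact (LocallyRingedSpace.stalkMap_germ_apply (Spec.toLocallyRingedSpace.map φ.op)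
    ((Opens.map (X.specι y).base).obj V) r h' ((X.specι y).c.app (op V) s)).symm

/-- The restriction map is a flat epimorphism and thus bijective on local rings, so vanishing of a
germ does not depend on the chart in which the point is represented. -/
lemma IsSchematic.vanishesAt_comap_iff (hX : X.IsSchematic) {V : Opens X.Spec}
    {s : X.Spec.presheaf.obj (op V)} {y z : X} (h : y ≤ z) (r : PrimeSpectrum (X.O.obj z)) :
    X.VanishesAt V s y (PrimeSpectrum.comap (X.res h).hom r) ↔ X.VanishesAt V s z r := by
  have := hX.epi h
  have hb := bijective_stalkMap_of_flat_of_epi (X.res h) (hX.flat h) r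
  have key (h1 h2) := germ_comp_specι s (X.res h) r _ (X.map_res_specι h).symm h1 h2
  have hpt := X.specPt_comap_res h r
  constructor
  · rintro ⟨h1, h2⟩
    refine ⟨hpt ▸ h1, (key (hpt ▸ h1 : X.specPt z r ∈ V) h1).trans ?_⟩
    exact (congrArg _ h2).trans (map_zero _)
  · rintro ⟨h1, h2⟩
    refine ⟨hpt ▸ h1, hb.1 (((key h1 (hpt ▸ h1)).symm.trans h2).trans (map_zero _).symm)⟩

lemma isOpen_vanishesAt (V : Opens X.Spec) (s : X.Spec.presheaf.obj (op V)) (y : X) :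
    IsOpen {q | X.VanishesAt V s y q} := by
  rw [isOpen_iff_forall_mem_open]
  rintro q ⟨hq, h⟩
  obtain ⟨W, hW, i, j, hij⟩ := TopCat.Presheaf.germ_eq
    (U := (Opens.map (X.specι y).base).obj V) (V := (Opens.map (X.specι y).base).obj V)
    (AlgebraicGeometry.Spec.toLocallyRingedSpace.obj (op (X.O.obj y))).presheaf q hq hq ((X.specι y).c.app (op V) s) 0 (h.trans (map_zero _).symm)
  refine ⟨W.1, fun q' hq' => ⟨leOfHom i hq', ?_⟩, W.2, hW⟩
  rw [map_zero] at hij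
  refine (TopCat.Presheaf.germ_res_apply _ i q' hq' _).symm.trans ?_
  exact (congrArg _ hij).trans (map_zero _)

/-- The points where the pulled back germs of `s` vanish form a well-defined open subset `V'` of
`Spec X`. On `V'` the section `s` is zero on every chart, hence zero, so its germ at each point of
`V'` is zero. -/
lemma IsSchematic.injective_stalkMap_specι (hX : X.IsSchematic) (x : X)
    (p : PrimeSpectrum (X.O.obj x)) : Function.Injective ((X.specι x).stalkMap p) := by
  let Φ : X.Spec.presheaf.stalk (X.specPt x p) →+* Stk (X.O.obj x) p :=
    ((X.specι x).stalkMap p).hom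
  change Function.Injective Φ
  rw [injective_iff_map_eq_zero]
  intro t ht
  obtain ⟨V, hp, s, rfl⟩ := TopCat.Presheaf.exists_germ_eq _ t
  have hs : X.VanishesAt V s x p :=
    ⟨hp, (LocallyRingedSpace.stalkMap_germ_apply (X.specι x) V p hp s).symm.trans ht⟩
  have key (y : X) (q : PrimeSpectrum (X.O.obj y)) :
      X.specPt y q ∈ {v : X.Spec | ∀ y q, X.specPt y q = v → X.VanishesAt V s y q} ↔
        X.VanishesAt V s y q := by
    refine ⟨fun h => h y q rfl, fun h y' q' he => ?_⟩
    obtain ⟨z, hy', hy, r, rfl, rfl⟩ := hX.exists_of_specPt_eq he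
    rw [hX.vanishesAt_comap_iff] at h ⊢
    exact h
  let V' : Opens X.Spec := ⟨{v : X.Spec | ∀ y q, X.specPt y q = v → X.VanishesAt V s y q},
    X.isOpen_spec_iff.2 fun y => by
      have : X.specPt y ⁻¹' {v : X.Spec | ∀ y q, X.specPt y q = v → X.VanishesAt V s y q} =
        {q | X.VanishesAt V s y q} := Set.ext (key y)
      rw [this]
      exact isOpen_vanishesAt V s y⟩
  have hle : V' ≤ V := by
    intro v hv
    obtain ⟨y, q, rfl⟩ := X.exists_specPt_eq v
    exact ((key y q).1 hv).1
  have hz : X.Spec.presheaf.map (homOfLE hle).op s = 0 := by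
    refine LocallyRingedSpace.colimit_section_ext (F := X.specDiagram) fun j => ?_
    refine TopCat.Presheaf.section_ext (Spec.toLocallyRingedSpace.obj
      (op (X.O.obj j.unop))).sheaf _ _ _ fun q hq => ?_
    obtain ⟨h1, h2⟩ := (key j.unop q).1 hq
    have h3 := congr($((X.specι j.unop).c.naturality (homOfLE hle).op) s)
    refine (congrArg _ h3).trans ?_
    refine (TopCat.Presheaf.germ_res_apply (Spec.toLocallyRingedSpace.obj
      (op (X.O.obj j.unop))).presheaf ((Opens.map (X.specι j.unop).base).map (homOfLE hle)) q hq
      ((X.specι j.unop).c.app (op V) s)).trans (h2.trans ?_)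
    exact ((congrArg _ (map_zero _)).trans (map_zero _)).symm
  have h1 := TopCat.Presheaf.germ_res_apply X.Spec.presheaf (homOfLE hle) (X.specPt x p)
    ((key x p).2 hs) s
  refine h1.symm.trans ?_
  rw [hz, map_zero]

lemma IsSchematic.bijective_stalkMap_specι (hX : X.IsSchematic) (x : X)
    (p : PrimeSpectrum (X.O.obj x)) : Function.Bijective ((X.specι x).stalkMap p) :=
  ⟨hX.injective_stalkMap_specι x p, hX.surjective_stalkMap_specι x p⟩

end RingedPoset

/-! ### Functoriality of `Spec` and points of fibered products. -/

namespace RingedPoset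

open SchematicAux

lemma spec_hom_ext {X : RingedPoset.{u}} {T : AlgebraicGeometry.LocallyRingedSpace.{u}}
    {a b : X.Spec ⟶ T} (h : ∀ x, X.specι x ≫ a = X.specι x ≫ b) : a = b :=
  colimit.hom_ext fun x => h x.unop

lemma specMap_id (X : RingedPoset.{u}) : specMap (𝟙 X) = 𝟙 X.Spec := by
  refine spec_hom_ext fun x => ?_
  refine (specι_specMap (𝟙 X) x).trans ?_
  exact (congrArg (· ≫ X.specι x) (AlgebraicGeometry.Spec.toLocallyRingedSpace.map_id _)).trans
    ((Category.id_comp _).trans (Category.comp_id _).symm)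

lemma specMap_comp {X Y Z : RingedPoset.{u}} (f : X ⟶ Y) (g : Y ⟶ Z) :
    specMap (f ≫ g) = specMap f ≫ specMap g := by
  refine spec_hom_ext fun x => ?_
  rw [specι_specMap, ← Category.assoc, specι_specMap, Category.assoc, specι_specMap]
  exact (congrArg (· ≫ Z.specι _) (AlgebraicGeometry.Spec.toLocallyRingedSpace.map_comp
    (Hom.stalk f x).op (Hom.stalk g (Hom.base f x)).op)).trans (Category.assoc _ _ _)

lemma IsSchematic.specPt_injective {X : RingedPoset.{u}} (hX : X.IsSchematic) (x : X) :
    Function.Injective (X.specPt x) := by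
  intro p q h
  obtain ⟨z, hx, hy, r, rfl, rfl⟩ := hX.exists_of_specPt_eq h
  rfl

variable {X Y Z : RingedPoset.{u}} {f : X ⟶ Z} {g : Y ⟶ Z}

lemma Hom.IsSchematic.exists_specPt_eq (hf : Hom.IsSchematic f) (hZ : Z.IsSchematic) {x : X}
    {p : PrimeSpectrum (X.O.obj x)} {c : Z} (hc : f.base x ≤ c) {q : PrimeSpectrum (Z.O.obj c)}
    (h : Z.specPt (f.base x) (PrimeSpectrum.comap (f.stalk x).hom p) = Z.specPt c q) :
    ∃ (x' : X) (p' : PrimeSpectrum (X.O.obj x')), x ≤ x' ∧ c ≤ f.base x' ∧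
      X.specPt x' p' = X.specPt x p := by
  rw [← Z.specPt_comap_res hc] at h
  obtain ⟨x', hx, hcx, p', rfl⟩ := hf.exists_le hc (p := p) ⟨q, (hZ.specPt_injective _ h).symm⟩
  exact ⟨x', p', hx, hcx, (X.specPt_comap_res hx p').symm⟩

namespace fiberProduct

/-- While `f u` and `g v` differ, the same two points can be represented at larger indices,
alternating between `Y` and `X`; `v` increases strictly, so the process stops in the finite poset
`Y`. Once the indices match, a prime of the tensor product lies over the two given primes. -/
lemma exists_specPt_aux (hZ : Z.IsSchematic) (hf : Hom.IsSchematic f) (hg : Hom.IsSchematic g)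
    (v : Y) : ∀ (q : PrimeSpectrum (Y.O.obj v)) (u : X) (p : PrimeSpectrum (X.O.obj u)),
      g.base v ≤ f.base u →
      (specMap f).base (X.specPt u p) = (specMap g).base (Y.specPt v q) →
      ∃ ξ : (fiberProduct f g).Spec, (specMap (fst f g)).base ξ = X.specPt u p ∧
        (specMap (snd f g)).base ξ = Y.specPt v q := by
  induction v using WellFoundedGT.induction with
  | _ v ih =>
    intro q u p hle h
    have h' := h
    rw [specMap_specPt, specMap_specPt] at h'
    by_cases heq : f.base u = g.base v
    · let w : fiberProduct f g := ⟨(u, v), heq⟩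
      obtain ⟨r, hr1, hr2⟩ := exists_prime (isPushout w) p q (by
        apply hZ.specPt_injective
        refine h'.trans ?_
        rw [comap_comp_apply]
        exact (Z.specPt_comap_res _ _).symm)
      refine ⟨(fiberProduct f g).specPt w r, ?_, ?_⟩
      · exact (specMap_specPt _ w r).trans (congrArg (X.specPt u) hr1)
      · exact (specMap_specPt _ w r).trans (congrArg (Y.specPt v) hr2)
    · obtain ⟨v', q', hvv', huv', hq'⟩ := hg.exists_specPt_eq hZ hle h'.symm
      rw [← hq'] at h
      have h'' := h
      rw [specMap_specPt, specMap_specPt] at h''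
      obtain ⟨u', p', huu', hvu', hp'⟩ := hf.exists_specPt_eq hZ huv' h''
      rw [← hp'] at h
      have hlt : v < v' := lt_of_le_of_ne hvv' (by
        rintro rfl
        exact heq (le_antisymm huv' hle))
      rw [← hp', ← hq']
      exact ih v' hlt q' u' p' hvu' h

/-- The points of `Spec` of a fibered product surject onto the fibered product of the points. -/
lemma exists_spec (hZ : Z.IsSchematic) (hf : Hom.IsSchematic f) (hg : Hom.IsSchematic g)
    {a : X.Spec} {b : Y.Spec} (h : (specMap f).base a = (specMap g).base b) :
    ∃ ξ : (fiberProduct f g).Spec, (specMap (fst f g)).base ξ = a ∧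
        (specMap (snd f g)).base ξ = b := by
  obtain ⟨u, p, rfl⟩ := X.exists_specPt_eq a
  obtain ⟨v, q, rfl⟩ := Y.exists_specPt_eq b
  have h' := h
  rw [specMap_specPt, specMap_specPt] at h'
  obtain ⟨c, hu, hv, r, hr, hr'⟩ := hZ.exists_of_specPt_eq h'
  have hc : Z.specPt (f.base u) (PrimeSpectrum.comap (f.stalk u).hom p) = Z.specPt c r := by
    rw [← hr]
    exact Z.specPt_comap_res hu r
  obtain ⟨u', p', huu', hcu', hp'⟩ := hf.exists_specPt_eq hZ hu hc
  rw [← hp'] at h ⊢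
  exact exists_specPt_aux hZ hf hg v q u' p' (hv.trans hcu') h

end fiberProduct

end RingedPoset

/-! ### Flat monomorphisms of schematic spaces. -/

namespace SchFin

open RingedPoset SchematicAux

/-- A schematic morphism is a flat monomorphism if it consists of flat epimorphisms on stalks and
is injective on the points of `Spec`. -/
structure IsFlatMono {X Y : SchFin.{u}} (f : X ⟶ Y) : Prop where
  flat : IsFlat f
  epi : ∀ x, Epi (f.hom.stalk x)
  injective : Function.Injective (specMap f.hom).base

variable {X Y Z : SchFin.{u}}

lemma specMap_comp_apply (f : X ⟶ Y) (g : Y ⟶ Z) (a : X.toRingedPoset.Spec) :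
    (specMap (f ≫ g).hom).base a = (specMap g.hom).base ((specMap f.hom).base a) :=
  congr(($(RingedPoset.specMap_comp f.hom g.hom)).base a)

lemma specMap_id_apply (a : X.toRingedPoset.Spec) : (specMap (𝟙 X : X ⟶ X).hom).base a = a :=
  congr(($(RingedPoset.specMap_id X.toRingedPoset)).base a)

lemma IsFlatMono.comp {f : X ⟶ Y} {g : Y ⟶ Z} (hf : IsFlatMono f) (hg : IsFlatMono g) :
    IsFlatMono (f ≫ g) where
  flat x := RingHom.Flat.comp (hg.flat (f.hom.base x)) (hf.flat x)
  epi x :=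
    have := hf.epi x
    have := hg.epi (f.hom.base x)
    epi_comp (g.hom.stalk (f.hom.base x)) (f.hom.stalk x)
  injective a b h := by
    rw [specMap_comp_apply, specMap_comp_apply] at h
    exact hf.injective (hg.injective h)

lemma IsFlatMono.of_comp {f : X ⟶ Y} {g : Y ⟶ Z} (hfg : IsFlatMono (f ≫ g)) (hg : IsFlatMono g) :
    IsFlatMono f where
  flat x :=
    have := hg.epi (f.hom.base x)
    flat_of_epi_comp (g.hom.stalk (f.hom.base x)) (f.hom.stalk x) (hfg.flat x)
  epi x :=
    have : Epi (g.hom.stalk (f.hom.base x) ≫ f.hom.stalk x) := hfg.epi x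
    epi_of_epi (g.hom.stalk (f.hom.base x)) (f.hom.stalk x)
  injective a b h := by
    apply hfg.injective
    rw [specMap_comp_apply, specMap_comp_apply, h]

lemma IsFlatMono.of_isIso (f : X ⟶ Y) [IsIso f] : IsFlatMono f := by
  have hepi {X Y : SchFin.{u}} (f : X ⟶ Y) [IsIso f] (x : X) : Epi (f.hom.stalk x) := by
    have h := stalk_congr (congrArg Hom.hom (IsIso.hom_inv_id f)) x
    have h1 : Epi ((inv f).hom.stalk (f.hom.base x) ≫ f.hom.stalk x) := by
      change Epi (RingedPoset.Hom.stalk (f ≫ inv f).hom x)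
      rw [h]
      exact epi_comp' (X.isSchematic.epi _) (inferInstanceAs (Epi (𝟙 (X.O x))))
    exact epi_of_epi ((inv f).hom.stalk (f.hom.base x)) _
  refine ⟨fun x => ?_, hepi f, fun a b h => ?_⟩
  · have := hepi (inv f) (f.hom.base x)
    refine flat_of_epi_comp ((inv f).hom.stalk (f.hom.base x)) _ ?_
    have h := stalk_congr (congrArg Hom.hom (IsIso.hom_inv_id f)) x
    change (RingedPoset.Hom.stalk (f ≫ inv f).hom x).hom.Flat
    rw [h]
    exact RingHom.Flat.comp (X.isSchematic.flat _) (RingHom.Flat.id _)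
  · have h' := congrArg (specMap (inv f).hom).base h
    rwa [← specMap_comp_apply, ← specMap_comp_apply, IsIso.hom_inv_id, specMap_id_apply,
      specMap_id_apply] at h'

/-- The points of `Spec Y` in the image of `Spec X`. -/
def range (f : X ⟶ Y) : Set Y.toRingedPoset.Spec := Set.range (specMap f.hom).base

lemma range_comp_of_isIso (f : X ⟶ Y) [IsIso f] (g : Y ⟶ Z) : range (f ≫ g) = range g := by
  ext c
  constructor
  · rintro ⟨a, rfl⟩
    exact ⟨(specMap f.hom).base a, (specMap_comp_apply f g a).symm⟩
  · rintro ⟨a, rfl⟩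
    refine ⟨(specMap (inv f).hom).base a, ?_⟩
    rw [← specMap_comp_apply, IsIso.inv_hom_id_assoc]

/-- Both projections of `X ×_Y X` become equal after composing with the diagonal, whose `Spec` is
invertible, so they have the same `Spec`. At the point `(x, x)`, where charts separate ring maps,
this says that the two coprojections to `𝒪 x ⊗ 𝒪 x` coincide, i.e. the stalk map is an epimorphism.
On points it says that any two with the same image coincide, since they lift to `Spec` of the
fibered product. -/
lemma IsFlatImmersion.isFlatMono {f : X ⟶ Y} (hf : IsFlatImmersion f) : IsFlatMono f := by
  have hd : IsIso (specMap (pullback.diagonal f).hom) := hf.diagonal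
  have h1 : specMap (pullback.fst f f).hom = specMap (pullback.snd f f).hom := by
    rw [← cancel_epi (specMap (pullback.diagonal f).hom), ← RingedPoset.specMap_comp,
      ← RingedPoset.specMap_comp, ← comp_hom, ← comp_hom, pullback.diagonal_fst,
      pullback.diagonal_snd]
  have h2 : specMap (fiberProduct.fst f f).hom = specMap (fiberProduct.snd f f).hom := by
    have e1 := congrArg (fun m => specMap (Hom.hom m))
      (fiberProduct.isPullback f f).isoPullback_hom_fst
    have e2 := congrArg (fun m => specMap (Hom.hom m))
      (fiberProduct.isPullback f f).isoPullback_hom_snd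
    refine e1.symm.trans (Eq.trans ?_ e2)
    rw [comp_hom, comp_hom, RingedPoset.specMap_comp, RingedPoset.specMap_comp, h1]
  refine ⟨hf.flat, fun x => ?_, fun a b hab => ?_⟩
  · let w : RingedPoset.fiberProduct f.hom f.hom := ⟨(x, x), rfl⟩
    have hs := fiberProduct.isPushout w
    have h3 := congrArg ((RingedPoset.fiberProduct f.hom f.hom).specι w ≫ ·) h2
    have h4 : (RingedPoset.fiberProduct.fst f.hom f.hom).stalk w =
        (RingedPoset.fiberProduct.snd f.hom f.hom).stalk w := by
      apply X.isSchematic.eq_of_comp_specι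
      exact (specι_specMap (RingedPoset.fiberProduct.fst f.hom f.hom) w).symm.trans
        (h3.trans (specι_specMap (RingedPoset.fiberProduct.snd f.hom f.hom) w))
    constructor
    intro R a b hab
    have hab' : f.hom.stalk x ≫ a = (Y.toRingedPoset.res w.2.le ≫ f.hom.stalk x) ≫ b := by
      rw [hab, res_self, Category.id_comp]
    have e1 := hs.inl_desc a b hab'
    have e2 := hs.inr_desc a b hab'
    exact e1.symm.trans ((congrArg (· ≫ hs.desc a b hab') h4).trans e2)
  · obtain ⟨ξ, rfl, rfl⟩ := fiberProduct.exists_spec Y.isSchematic f.isSchematic f.isSchematic hab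
    exact congr(($h2).base ξ)

/-- Flat epimorphisms are stable under cobase change. For injectivity, two points with the same
image in `X` also have the same image in `Y`, because `g` is injective on points. The zigzag
argument represents the first point at an index above `w'`, so both points live in the spectrum at
`w'`, where the epimorphic stalk map separates them. -/
lemma IsFlatMono.fiberProduct_fst (f : X ⟶ Z) {g : Y ⟶ Z} (hg : IsFlatMono g) :
    IsFlatMono (fiberProduct.fst f g) := by
  have hepi (w : RingedPoset.fiberProduct f.hom g.hom) :
      Epi ((RingedPoset.fiberProduct.fst f.hom g.hom).stalk w) := by
    have := hg.epi w.1.2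
    have := Z.isSchematic.epi w.2.le
    have := epi_comp (Z.toRingedPoset.res w.2.le) (g.hom.stalk w.1.2)
    exact epi_inl (fiberProduct.isPushout w)
  refine ⟨fun w => ?_, hepi, fun a b hab => ?_⟩
  · have h1 : (Z.toRingedPoset.res w.2.le ≫ g.hom.stalk w.1.2).hom.Flat :=
      RingHom.Flat.comp (Z.isSchematic.flat _) (hg.flat _)
    rw [← CommRingCat.flat_iff] at h1
    exact (CommRingCat.flat_iff _).1
      (MorphismProperty.of_isPushout (fiberProduct.isPushout w) h1)
  · have hab' : (specMap (RingedPoset.fiberProduct.snd f.hom g.hom)).base a =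
        (specMap (RingedPoset.fiberProduct.snd f.hom g.hom)).base b := by
      apply hg.injective
      have h1 (c) := specMap_comp_apply (fiberProduct.fst f g) f c
      have h2 (c) := specMap_comp_apply (fiberProduct.snd f g) g c
      refine (h2 a).symm.trans (Eq.trans ?_ (h2 b))
      rw [← (fiberProduct.isPullback f g).w]
      exact (h1 a).trans ((congrArg _ hab).trans (h1 b).symm)
    obtain ⟨w, r, rfl⟩ := RingedPoset.exists_specPt_eq _ a
    obtain ⟨w', r', rfl⟩ := RingedPoset.exists_specPt_eq _ b
    have hab'' := hab
    replace hab := (specMap_specPt (RingedPoset.fiberProduct.fst f.hom g.hom) w r).symm.trans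
      (hab.trans (specMap_specPt (RingedPoset.fiberProduct.fst f.hom g.hom) w' r'))
    replace hab' := (specMap_specPt (RingedPoset.fiberProduct.snd f.hom g.hom) w r).symm.trans
      (hab'.trans (specMap_specPt (RingedPoset.fiberProduct.snd f.hom g.hom) w' r'))
    obtain ⟨u, hu, hu', p, hp, -⟩ := X.isSchematic.exists_of_specPt_eq hab
    obtain ⟨v, hv, hv', q, hq, -⟩ := Y.isSchematic.exists_of_specPt_eq hab'
    obtain ⟨w'', hw, huw, hvw, s, rfl⟩ := fiberProduct.zigzag Z.isSchematic f.isSchematic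
      g.isSchematic hu hv ⟨p, hp⟩ ⟨q, hq⟩
    have hw' : w' ≤ w'' := ⟨hu'.trans huw, hv'.trans hvw⟩
    have e := ((RingedPoset.fiberProduct f.hom g.hom).specPt_comap_res hw s).trans
      ((RingedPoset.fiberProduct f.hom g.hom).specPt_comap_res hw' s).symm
    refine e.trans (congrArg _ ?_)
    have := hepi w'
    apply comap_injective_of_epi ((RingedPoset.fiberProduct.fst f.hom g.hom).stalk w')
    apply X.isSchematic.specPt_injective
    refine (specMap_specPt _ _ _).symm.trans (Eq.trans ?_ (specMap_specPt _ _ _))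
    exact (congrArg _ e.symm).trans hab''

lemma _root_.CategoryTheory.IsPullback.isFlatMono {P : SchFin.{u}} {a : P ⟶ X} {b : P ⟶ Y}
    {f : X ⟶ Z} {g : Y ⟶ Z} (h : IsPullback a b f g) (hf : IsFlatMono f) (hg : IsFlatMono g) :
    IsFlatMono (a ≫ f) := by
  rw [← h.isoIsPullback_hom_fst _ _ (fiberProduct.isPullback f g)]
  exact ((IsFlatMono.of_isIso _).comp (hg.fiberProduct_fst f)).comp hf

lemma _root_.CategoryTheory.IsPullback.range_eq {P : SchFin.{u}} {a : P ⟶ X} {b : P ⟶ Y}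
    {f : X ⟶ Z} {g : Y ⟶ Z} (h : IsPullback a b f g) : range (a ≫ f) = range f ∩ range g := by
  have h1 := h.isoIsPullback_hom_fst _ _ (fiberProduct.isPullback f g)
  rw [← h1, Category.assoc, range_comp_of_isIso]
  ext c
  constructor
  · rintro ⟨ξ, rfl⟩
    refine ⟨⟨_, (specMap_comp_apply _ _ _).symm⟩, ?_⟩
    rw [(fiberProduct.isPullback f g).w]
    exact ⟨_, (specMap_comp_apply _ _ _).symm⟩
  · rintro ⟨⟨x, rfl⟩, ⟨y, hy⟩⟩
    obtain ⟨ξ, rfl, rfl⟩ := fiberProduct.exists_spec Z.isSchematic f.isSchematic g.isSchematic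
      hy.symm
    exact ⟨ξ, specMap_comp_apply (fiberProduct.fst f g) f ξ⟩

end SchFin

/-! ### Finite fibered products of flat monomorphisms and the nerve. -/

namespace SchFin

variable {X : SchFin.{u}}

/-- Products in the category of schematic spaces over `X` are obtained one factor at a time as
fibered products. -/
lemma isPullback_of_isLimit_option {α : Type u} {F : Option α → Over X} {c : Fan F}
    (hc : IsLimit c) {d : Fan fun a => F (some a)} (hd : IsLimit d) :
    IsPullback (hd.lift (Fan.mk c.pt fun a => c.proj (some a))).left (c.proj none).left
      d.pt.hom (F none).hom := by
  have hw {T : SchFin.{u}} (a : T ⟶ d.pt.left) (b : T ⟶ (F none).left)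
      (h : a ≫ d.pt.hom = b ≫ (F none).hom) : ∃! l : T ⟶ c.pt.left,
      l ≫ (hd.lift (Fan.mk c.pt fun a => c.proj (some a))).left = a ∧
        l ≫ (c.proj none).left = b := by
    let A : Over.mk (a ≫ d.pt.hom) ⟶ d.pt := Over.homMk a
    let B : Over.mk (a ≫ d.pt.hom) ⟶ F none := Over.homMk b h.symm
    have hl (j) : hd.lift (Fan.mk c.pt fun a => c.proj (some a)) ≫ d.proj j = c.proj (some j) :=
      hd.fac _ ⟨j⟩
    let s : Fan F := Fan.mk (Over.mk (a ≫ d.pt.hom)) fun o => match o with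
      | none => B
      | some j => A ≫ d.proj j
    refine ⟨(hc.lift s).left, ⟨?_, congrArg CommaMorphism.left (hc.fac s ⟨none⟩)⟩, ?_⟩
    · have : hc.lift s ≫ hd.lift (Fan.mk c.pt fun a => c.proj (some a)) = A := by
        refine hd.hom_ext fun j => ?_
        refine (Category.assoc _ _ _).trans ?_
        refine (congrArg (hc.lift s ≫ ·) (hl j.as)).trans ?_
        exact hc.fac s ⟨some j.as⟩
      exact congrArg CommaMorphism.left this
    · rintro m ⟨h1, h2⟩
      let M : Over.mk (a ≫ d.pt.hom) ⟶ c.pt := Over.homMk m (by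
        rw [← h1, Category.assoc, Over.w]
        rfl)
      have : M = hc.lift s := by
        refine hc.hom_ext fun j => ?_
        refine Eq.trans ?_ (hc.fac s j).symm
        obtain ⟨_ | j⟩ := j
        · exact Over.OverMorphism.ext h2
        · have h3 : M ≫ hd.lift (Fan.mk c.pt fun a => c.proj (some a)) = A :=
            Over.OverMorphism.ext h1
          exact (congrArg (M ≫ ·) (hl j)).symm.trans
            ((Category.assoc _ _ _).symm.trans (congrArg (· ≫ d.proj j) h3))
      exact congrArg CommaMorphism.left this
  refine ⟨⟨(Over.w _).trans (Over.w (c.proj none)).symm⟩, ⟨PullbackCone.IsLimit.mk _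
    (fun s => (hw s.fst s.snd s.condition).choose)
    (fun s => (hw s.fst s.snd s.condition).choose_spec.1.1)
    (fun s => (hw s.fst s.snd s.condition).choose_spec.1.2)
    (fun s m h1 h2 => (hw s.fst s.snd s.condition).choose_spec.2 m ⟨h1, h2⟩)⟩⟩

/-- The fibered products over `X` of finitely many flat monomorphisms. -/
lemma isFlatMono_and_range_eq_of_isLimit {α : Type u} [Finite α] :
    ∀ (F : α → Over X) (_ : ∀ i, IsFlatMono (F i).hom) (c : Fan F) (_ : IsLimit c),
      IsFlatMono c.pt.hom ∧ range c.pt.hom = ⋂ i, range (F i).hom := by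
  induction α using Finite.induction_empty_option with
  | of_equiv e ih =>
    intro F hF c hc
    let t (s : Fan fun i => F (e i)) : Fan F := Fan.mk s.pt fun i =>
      s.proj (e.symm i) ≫ eqToHom (congrArg F (e.apply_symm_apply i))
    have ht (s : Fan fun i => F (e i)) (j) : (t s).proj (e j) = s.proj j := by
      have h (j') (hj : j' = j) (h' : F (e j') = F (e j)) :
          s.proj j' ≫ eqToHom h' = s.proj j := by
        subst hj
        exact Category.comp_id _
      exact h _ (e.symm_apply_apply j) _
    obtain ⟨h1, h2⟩ := ih (fun i => F (e i)) (fun i => hF (e i))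
      (Fan.mk c.pt fun i => c.proj (e i))
      (Fan.IsLimit.mk _ (fun s => hc.lift (t s))
        (fun s j => (hc.fac (t s) ⟨e j⟩).trans (ht s j))
        (fun s m hm => by
          refine hc.hom_ext fun ⟨j⟩ => ?_
          obtain ⟨j, rfl⟩ := e.surjective j
          exact (hm j).trans ((ht s j).symm.trans (hc.fac (t s) ⟨e j⟩).symm)))
    exact ⟨h1, h2.trans (e.surjective.iInter_comp fun i => range (F i).hom)⟩
  | h_empty =>
    intro F _ c hc
    have ht : IsTerminal c.pt := IsTerminal.ofUniqueHom
      (fun Y => hc.lift (Fan.mk Y fun i => i.elim)) (fun Y m => hc.hom_ext fun j => j.as.elim)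
    let e := ht.uniqueUpToIso Over.mkIdTerminal
    have he : e.hom.left = c.pt.hom := (Category.comp_id _).symm.trans (Over.w e.hom)
    have : IsIso c.pt.hom := he ▸ inferInstanceAs (IsIso ((Over.forget X).map e.hom))
    refine ⟨IsFlatMono.of_isIso _, ?_⟩
    have h := range_comp_of_isIso c.pt.hom (𝟙 X)
    rw [Category.comp_id] at h
    rw [h, Set.iInter_of_empty]
    exact Set.eq_univ_of_forall fun a => ⟨a, specMap_id_apply a⟩
  | h_option ih =>
    intro F hF c hc
    obtain ⟨h1, h2⟩ := ih (fun i => F (some i)) (fun i => hF _) (Fan.mk _ (Pi.π _))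
      (productIsProduct _)
    have h := isPullback_of_isLimit_option hc (productIsProduct fun i => F (some i))
    have h3 := h.isFlatMono h1 (hF none)
    have h4 := h.range_eq
    rw [Over.w] at h3 h4
    refine ⟨h3, h4.trans ?_⟩
    rw [h2, Set.inter_comm]
    ext a
    simp [Option.forall]

variable {I : Type u} {U : I → SchFin.{u}}

lemma isFlatMono_nerveCocone {f : ∀ i, U i ⟶ X} (hf : ∀ i, IsFlatMono (f i)) (Δ : (Parts I)ᵒᵖ) :
    IsFlatMono ((nerveCocone f).ι.app Δ) :=
  (isFlatMono_and_range_eq_of_isLimit _ (fun i : Δ.unop.1 => hf i) _ (productIsProduct _)).1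

lemma range_nerveCocone {f : ∀ i, U i ⟶ X} (hf : ∀ i, IsFlatMono (f i)) (Δ : (Parts I)ᵒᵖ) :
    range ((nerveCocone f).ι.app Δ) = ⋂ i : Δ.unop.1, range (f i) :=
  (isFlatMono_and_range_eq_of_isLimit _ (fun i : Δ.unop.1 => hf i) _ (productIsProduct _)).2

lemma mem_range_nerveCocone_iff {f : ∀ i, U i ⟶ X} (hf : ∀ i, IsFlatMono (f i)) (Δ : (Parts I)ᵒᵖ)
    (a : X.toRingedPoset.Spec) :
    a ∈ range ((nerveCocone f).ι.app Δ) ↔ ∀ i ∈ Δ.unop.1, a ∈ range (f i) := by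
  rw [range_nerveCocone hf]
  refine Set.mem_iInter.trans ?_
  exact ⟨fun h i hi => h ⟨i, hi⟩, fun h i => h i.1 i.2⟩

end SchFin

/-! ### The cylinder of a diagram of schematic spaces. -/

namespace SchFin

section Cylinder

open RingedPoset SchematicAux

variable {P : Type u} [PartialOrder P] (G : Pᵒᵖ ⥤ SchFin.{u})

/-- The transition morphisms of a diagram of schematic spaces indexed by a poset. -/
abbrev tr {Δ Δ' : P} (h : Δ ≤ Δ') : G.obj (op Δ') ⟶ G.obj (op Δ) := G.map (homOfLE h).op

lemma tr_refl {Δ : P} (h : Δ ≤ Δ) : tr G h = 𝟙 _ := G.map_id _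

lemma tr_comp {Δ Δ' Δ'' : P} (h : Δ ≤ Δ') (h' : Δ' ≤ Δ'') :
    tr G (h.trans h') = tr G h' ≫ tr G h := G.map_comp _ _

lemma tr_refl_base {Δ : P} (h : Δ ≤ Δ) (x : G.obj (op Δ)) : (tr G h).hom.base x = x :=
  congrArg (fun f : G.obj (op Δ) ⟶ G.obj (op Δ) => f.hom.base x) (tr_refl G h)

lemma tr_comp_base {Δ Δ' Δ'' : P} (h : Δ ≤ Δ') (h' : Δ' ≤ Δ'') (x : G.obj (op Δ'')) :
    (tr G (h.trans h')).hom.base x = (tr G h).hom.base ((tr G h').hom.base x) :=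
  congrArg (fun f : G.obj (op Δ'') ⟶ G.obj (op Δ) => f.hom.base x) (tr_comp G h h')

lemma tr_refl_stalk {Δ : P} (h : Δ ≤ Δ) (x : G.obj (op Δ)) :
    (tr G h).hom.stalk x = (G.obj (op Δ)).toRingedPoset.res (tr_refl_base G h x).le :=
  (stalk_congr (congrArg Hom.hom (tr_refl G h)) x).trans (Category.comp_id _)

lemma tr_comp_stalk {Δ Δ' Δ'' : P} (h : Δ ≤ Δ') (h' : Δ' ≤ Δ'') (x : G.obj (op Δ'')) :
    (tr G (h.trans h')).hom.stalk x =
      (G.obj (op Δ)).toRingedPoset.res (tr_comp_base G h h' x).le ≫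
        (tr G h).hom.stalk ((tr G h').hom.base x) ≫ (tr G h').hom.stalk x :=
  stalk_congr (congrArg Hom.hom (tr_comp G h h')) x

/-- The points of the cylinder of a diagram of schematic spaces. -/
structure CylinderPt : Type u where
  idx : P
  pt : G.obj (op idx)

variable {G}

instance [Finite P] : Finite (CylinderPt G) :=
  Finite.of_injective (β := Σ Δ : P, (G.obj (op Δ) : Type u)) (fun k => ⟨k.1, k.2⟩) (by
    rintro ⟨Δ, x⟩ ⟨Δ', x'⟩ h
    cases h
    rfl)

instance : PartialOrder (CylinderPt G) where
  le k k' := ∃ h : k.idx ≤ k'.idx, k.pt ≤ (tr G h).hom.base k'.pt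
  le_refl k := ⟨le_refl _, (tr_refl_base G _ _).ge⟩
  le_trans := fun k k' k'' ⟨h1, h2⟩ ⟨h1', h2'⟩ => ⟨h1.trans h1', by
    rw [tr_comp_base G h1 h1']
    exact h2.trans ((tr G h1).hom.base.monotone h2')⟩
  le_antisymm := by
    rintro ⟨Δ, x⟩ ⟨Δ', x'⟩ ⟨h1, h2⟩ ⟨h1', h2'⟩
    obtain rfl : Δ = Δ' := le_antisymm h1 h1'
    dsimp only at h2 h2'
    rw [tr_refl_base] at h2 h2'
    rw [le_antisymm h2 h2']

lemma CylinderPt.idx_le {k k' : CylinderPt G} (h : k ≤ k') : k.idx ≤ k'.idx := h.choose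

lemma CylinderPt.pt_le {k k' : CylinderPt G} (h : k ≤ k') :
    k.pt ≤ (tr G (idx_le h)).hom.base k'.pt := h.choose_spec

/-- The restriction maps of the cylinder. -/
def cylinderRes {k k' : CylinderPt G} (h : k ≤ k') :
    (G.obj (op k.idx)).O k.pt ⟶ (G.obj (op k'.idx)).O k'.pt :=
  (G.obj (op k.idx)).toRingedPoset.res (CylinderPt.pt_le h) ≫
    (tr G (CylinderPt.idx_le h)).hom.stalk k'.pt

lemma cylinderRes_mk {Δ : P} {x y : G.obj (op Δ)} (h : (⟨Δ, x⟩ : CylinderPt G) ≤ ⟨Δ, y⟩)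
    (hxy : x ≤ y) : cylinderRes h = (G.obj (op Δ)).toRingedPoset.res hxy :=
  (congrArg ((G.obj (op Δ)).toRingedPoset.res (CylinderPt.pt_le h) ≫ ·)
    (tr_refl_stalk G (Δ := Δ) (CylinderPt.idx_le h) y)).trans (res_res _ _ _)

lemma cylinderRes_comp {k k' k'' : CylinderPt G} (h : k ≤ k') (h' : k' ≤ k'') :
    cylinderRes h ≫ cylinderRes h' = cylinderRes (h.trans h') := by
  have e1 := tr_comp_stalk G (CylinderPt.idx_le h) (CylinderPt.idx_le h') k''.pt
  have e2 := stalk_res (tr G (CylinderPt.idx_le h)).hom (CylinderPt.pt_le h')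
  have e3 := res_res (G.obj (op k.idx)).toRingedPoset (CylinderPt.pt_le h)
    ((tr G (CylinderPt.idx_le h)).hom.base.monotone (CylinderPt.pt_le h'))
  have e4 := res_res (G.obj (op k.idx)).toRingedPoset (CylinderPt.pt_le (h.trans h'))
    (tr_comp_base G (CylinderPt.idx_le h) (CylinderPt.idx_le h') k''.pt).le
  calc cylinderRes h ≫ cylinderRes h' =
      (G.obj (op k.idx)).toRingedPoset.res (CylinderPt.pt_le h) ≫
      ((tr G (CylinderPt.idx_le h)).hom.stalk k'.pt ≫ (G.obj (op k'.idx)).toRingedPoset.res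
        (CylinderPt.pt_le h')) ≫ (tr G (CylinderPt.idx_le h')).hom.stalk k''.pt := by
        simp only [cylinderRes, Category.assoc]
    _ = ((G.obj (op k.idx)).toRingedPoset.res (CylinderPt.pt_le h) ≫
        (G.obj (op k.idx)).toRingedPoset.res
          ((tr G (CylinderPt.idx_le h)).hom.base.monotone (CylinderPt.pt_le h'))) ≫
        (tr G (CylinderPt.idx_le h)).hom.stalk
          ((tr G (CylinderPt.idx_le h')).hom.base k''.pt) ≫
          (tr G (CylinderPt.idx_le h')).hom.stalk k''.pt := by
        rw [← e2]
        simp only [Category.assoc]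
    _ = _ := by
        rw [e3, ← e4, Category.assoc, ← e1]
        rfl

variable (G) in
/-- The cylinder of a diagram `G` of schematic spaces, as a ringed poset: the disjoint union of the
`G Δ`, with `(Δ, x) ≤ (Δ', x')` if `Δ ≤ Δ'` and `x` is below the image of `x'`. -/
def cylinder [Finite P] : RingedPoset.{u} where
  carrier := CylinderPt G
  O :=
    { obj := fun k => (G.obj (op k.idx)).O k.pt
      map := fun h => cylinderRes (leOfHom h)
      map_id := fun _ => (cylinderRes_mk _ (le_refl _)).trans (res_self _ _ _)
      map_comp := fun h h' => (cylinderRes_comp (leOfHom h) (leOfHom h')).symm }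

lemma specPt_cylinderRes {k k' : CylinderPt G} (h : k ≤ k')
    (p : PrimeSpectrum ((G.obj (op k'.idx)).O k'.pt)) :
    (G.obj (op k.idx)).toRingedPoset.specPt k.pt (PrimeSpectrum.comap (cylinderRes h).hom p) =
      (specMap (tr G (CylinderPt.idx_le h)).hom).base
        ((G.obj (op k'.idx)).toRingedPoset.specPt k'.pt p) :=
  (RingedPoset.specPt_comap_res _ (CylinderPt.pt_le h) _).trans (specMap_specPt _ _ _).symm

/-- The index `y` need not lie above the image of `x`. The two representations in `Y` have a common
refinement above both, and this can be lifted along the schematic morphism `f`. -/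
lemma exists_specPt_eq_of_specMap_eq {X Y : SchFin.{u}} (f : X ⟶ Y) {x : X}
    {p : PrimeSpectrum (X.O x)} {y : Y} {q : PrimeSpectrum (Y.O y)}
    (h : (specMap f.hom).base (X.toRingedPoset.specPt x p) = Y.toRingedPoset.specPt y q) :
    ∃ (x' : X) (p' : PrimeSpectrum (X.O x')), x ≤ x' ∧ y ≤ f.hom.base x' ∧
      X.toRingedPoset.specPt x' p' = X.toRingedPoset.specPt x p := by
  rw [specMap_specPt] at h
  obtain ⟨z, hx, hy, r, hr, -⟩ := Y.isSchematic.exists_of_specPt_eq h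
  obtain ⟨x', p', hxx', hzx', he⟩ := f.isSchematic.exists_specPt_eq Y.isSchematic hx (q := r)
    (by rw [← hr]; exact RingedPoset.specPt_comap_res _ _ _)
  exact ⟨x', p', hxx', hy.trans hzx', he⟩

section Cocone

variable {c : Cocone G}

lemma w_base {Δ Δ' : P} (h : Δ ≤ Δ') (x : G.obj (op Δ')) :
    (c.ι.app (op Δ')).hom.base x = (c.ι.app (op Δ)).hom.base ((tr G h).hom.base x) :=
  (congrArg (fun f : G.obj (op Δ') ⟶ c.pt => f.hom.base x) (c.w (homOfLE h).op)).symm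

lemma w_stalk {Δ Δ' : P} (h : Δ ≤ Δ') (x : G.obj (op Δ')) :
    (c.ι.app (op Δ')).hom.stalk x = c.pt.toRingedPoset.res (w_base (c := c) h x).le ≫
      (c.ι.app (op Δ)).hom.stalk ((tr G h).hom.base x) ≫ (tr G h).hom.stalk x :=
  stalk_congr (congrArg Hom.hom (c.w (homOfLE h).op).symm) x

lemma w_specMap {Δ Δ' : P} (h : Δ ≤ Δ') (a : (G.obj (op Δ')).toRingedPoset.Spec) :
    (specMap (c.ι.app (op Δ)).hom).base ((specMap (tr G h).hom).base a) =
      (specMap (c.ι.app (op Δ')).hom).base a := by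
  rw [← c.w (homOfLE h).op]
  exact (specMap_comp_apply (tr G h) (c.ι.app (op Δ)) a).symm

/-- The projection from the cylinder to the vertex of a cocone. -/
def cylinderπ [Finite P] (c : Cocone G) : cylinder G ⟶ c.pt.toRingedPoset where
  base := ⟨fun k => (c.ι.app (op k.idx)).hom.base k.pt, fun k k' h =>
    ((c.ι.app (op k.idx)).hom.base.monotone (CylinderPt.pt_le h)).trans (w_base (c := c) (CylinderPt.idx_le h) k'.pt).ge⟩
  sharp :=
    { app := fun k => (c.ι.app (op k.idx)).hom.stalk k.pt
      naturality := fun k k' h => by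
        have e1 := w_stalk (c := c) (CylinderPt.idx_le (leOfHom h)) k'.pt
        have e2 := stalk_res (c.ι.app (op k.idx)).hom (CylinderPt.pt_le (leOfHom h))
        refine (congrArg (c.pt.toRingedPoset.res _ ≫ ·) e1).trans ?_
        refine (Category.assoc _ _ _).symm.trans ?_
        refine (congrArg (· ≫ _) (res_res _ _ _)).trans ?_
        refine (Category.assoc _ _ _).symm.trans ?_
        exact (congrArg (· ≫ _) e2).trans (Category.assoc _ _ _) }

/-- Points of the diagram with the same image in the vertex come from a common point. -/
def IsCodirected (c : Cocone G) : Prop :=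
  ∀ (Δ Δ' : P) (a : c.pt.toRingedPoset.Spec), a ∈ range (c.ι.app (op Δ)) →
    a ∈ range (c.ι.app (op Δ')) → ∃ (Δ'' : P) (_ : Δ ≤ Δ'') (_ : Δ' ≤ Δ''),
      a ∈ range (c.ι.app (op Δ''))

/-- Codirectedness provides a point over some `Δ` above both indices, and injectivity of the legs
shows that it maps to both given points. Refining its representative for `k` and for `k'` puts it at
an index of the cylinder above both. This gives the schematic condition for the cylinder as well as
injectivity of its projection on `Spec`. -/
lemma exists_cylinder_le (hc : ∀ Δ, IsFlatMono (c.ι.app Δ)) (hd : IsCodirected c)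
    {k k' : CylinderPt G} {p : PrimeSpectrum ((G.obj (op k.idx)).O k.pt)}
    {p' : PrimeSpectrum ((G.obj (op k'.idx)).O k'.pt)}
    (h : (specMap (c.ι.app (op k.idx)).hom).base
        ((G.obj (op k.idx)).toRingedPoset.specPt k.pt p) =
      (specMap (c.ι.app (op k'.idx)).hom).base
        ((G.obj (op k'.idx)).toRingedPoset.specPt k'.pt p')) :
    ∃ (k'' : CylinderPt G) (hk : k ≤ k'') (hk' : k' ≤ k'')
      (r : PrimeSpectrum ((G.obj (op k''.idx)).O k''.pt)),
        PrimeSpectrum.comap (cylinderRes hk).hom r = p ∧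
        PrimeSpectrum.comap (cylinderRes hk').hom r = p' := by
  obtain ⟨Δ, h1, h2, b, hb⟩ := hd k.idx k'.idx _ ⟨_, rfl⟩ ⟨_, h.symm⟩
  have e1 : (specMap (tr G h1).hom).base b = (G.obj (op k.idx)).toRingedPoset.specPt k.pt p :=
    (hc _).injective ((w_specMap h1 b).trans hb)
  have e2 : (specMap (tr G h2).hom).base b = (G.obj (op k'.idx)).toRingedPoset.specPt k'.pt p' :=
    (hc _).injective ((w_specMap h2 b).trans (hb.trans h))
  obtain ⟨y, r, rfl⟩ := RingedPoset.exists_specPt_eq _ b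
  obtain ⟨y1, r1, hy1, hky1, hr1⟩ := exists_specPt_eq_of_specMap_eq (tr G h1) e1
  rw [← hr1] at e1 e2
  obtain ⟨y2, r2, hy2, hky2, hr2⟩ := exists_specPt_eq_of_specMap_eq (tr G h2) e2
  rw [← hr2] at e1 e2
  have l1 : k ≤ ⟨Δ, y2⟩ := ⟨h1, hky1.trans ((tr G h1).hom.base.monotone hy2)⟩
  have l2 : k' ≤ ⟨Δ, y2⟩ := ⟨h2, hky2⟩
  exact ⟨⟨Δ, y2⟩, l1, l2, r2,
    (G.obj (op k.idx)).isSchematic.specPt_injective _ ((specPt_cylinderRes l1 r2).trans e1),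
    (G.obj (op k'.idx)).isSchematic.specPt_injective _ ((specPt_cylinderRes l2 r2).trans e2)⟩

lemma specMap_specPt_cylinderRes {k k' : CylinderPt G} (h : k ≤ k')
    (p : PrimeSpectrum ((G.obj (op k'.idx)).O k'.pt)) :
    (specMap (c.ι.app (op k.idx)).hom).base ((G.obj (op k.idx)).toRingedPoset.specPt k.pt
      (PrimeSpectrum.comap (cylinderRes h).hom p)) =
    (specMap (c.ι.app (op k'.idx)).hom).base
      ((G.obj (op k'.idx)).toRingedPoset.specPt k'.pt p) := by
  rw [specPt_cylinderRes]
  exact w_specMap _ _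

lemma isFlatMono_tr (hc : ∀ Δ, IsFlatMono (c.ι.app Δ)) {Δ Δ' : P} (h : Δ ≤ Δ') :
    IsFlatMono (tr G h) := by
  refine IsFlatMono.of_comp (g := c.ι.app (op Δ)) ?_ (hc _)
  rw [c.w (homOfLE h).op]
  exact hc _

variable [Finite P]

/-- A restriction map of the cylinder is a restriction map of some `G Δ` followed by a stalk map of
a transition morphism. The latter is a flat monomorphism by cancellation, since the legs are. -/
lemma isSchematic_cylinder (hc : ∀ Δ, IsFlatMono (c.ι.app Δ)) (hd : IsCodirected c) :
    (cylinder G).IsSchematic := by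
  refine isSchematic_of (fun {k k'} h => ?_) (fun {k k'} h => ?_)
    (fun {t x y} hx hy p hpx hpy => ?_)
  · exact RingHom.Flat.comp ((G.obj (op k.idx)).isSchematic.flat _)
      ((isFlatMono_tr hc (CylinderPt.idx_le h)).flat _)
  · exact epi_comp' ((G.obj (op k.idx)).isSchematic.epi _)
      ((isFlatMono_tr hc (CylinderPt.idx_le h)).epi _)
  · obtain ⟨q, rfl⟩ := hpx
    obtain ⟨q', hq'⟩ := hpy
    have h1 := specMap_specPt_cylinderRes (c := c) hx q
    have h2 := specMap_specPt_cylinderRes (c := c) hy q'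
    have hq'' : PrimeSpectrum.comap (cylinderRes hy).hom q' =
      PrimeSpectrum.comap (cylinderRes hx).hom q := hq'
    rw [hq''] at h2
    obtain ⟨z, hxz, hyz, r, rfl, -⟩ := exists_cylinder_le hc hd (k := x) (k' := y) (p := q)
      (p' := q') (h1.symm.trans h2)
    refine ⟨z, hxz, hyz, hx.trans hxz, r, ?_⟩
    have e : cylinderRes (hx.trans hxz) = cylinderRes hx ≫ cylinderRes hxz :=
      (cylinderRes_comp _ _).symm
    change PrimeSpectrum.comap (cylinderRes (hx.trans hxz)).hom r = _
    rw [e]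
    rfl

lemma isSchematic_cylinderπ (c : Cocone G) :
    RingedPoset.Hom.IsSchematic (cylinderπ c) := by
  refine RingedPoset.Hom.isSchematic_of c.pt.isSchematic (fun {k y} h p hp => ?_)
  obtain ⟨z, hz, hyz, q, hq⟩ := (c.ι.app (op k.idx)).isSchematic.exists_le
    (x := k.pt) (y := y) (p := p) h hp
  have hk : k ≤ ⟨k.idx, z⟩ := ⟨le_refl _, hz.trans (tr_refl_base G _ _).ge⟩
  refine ⟨⟨k.idx, z⟩, hk, hyz, q, ?_⟩
  exact (congrArg (fun φ : (G.obj (op k.idx)).O k.pt ⟶ (G.obj (op k.idx)).O z =>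
    PrimeSpectrum.comap φ.hom q) (cylinderRes_mk hk hz)).trans hq

end Cocone

end Cylinder

end SchFin

/-! ### The projection from the cylinder is a qc-isomorphism. -/

namespace SchematicAux

/-- For a finite, jointly faithfully flat family of ring maps, the spectrum of the source carries the
quotient topology. -/
lemma isOpen_of_flat {A : Type u} [CommRing A] {ι : Type u} [Finite ι] {B : ι → Type u}
    [∀ i, CommRing (B i)] (φ : ∀ i, A →+* B i) (hφ : ∀ i, (φ i).Flat)
    (hs : ∀ p : PrimeSpectrum A, ∃ i q, PrimeSpectrum.comap (φ i) q = p)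
    {V : Set (PrimeSpectrum A)} (hV : ∀ i, IsOpen (PrimeSpectrum.comap (φ i) ⁻¹' V)) :
    IsOpen V := by
  -- Flat ring maps satisfy going down, and a surjective generalizing map of spectra is a quotient
  -- map. The finite product replaces the family by one ring map, whose source spectrum is the
  -- disjoint union of the given spectra.
  have hq : Topology.IsQuotientMap (PrimeSpectrum.comap (RingHom.pi φ)) := by
    refine PrimeSpectrum.isQuotientMap_of_generalizingMap (fun p => ?_)
      (RingHom.Flat.generalizingMap_comap (flat_pi φ hφ))
    obtain ⟨i, q, rfl⟩ := hs p
    exact ⟨PrimeSpectrum.comap (Pi.evalRingHom B i) q, rfl⟩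
  rw [← hq.isOpen_preimage, ← (PrimeSpectrum.sigmaToPiHomeo B).isOpen_preimage, isOpen_sigma_iff]
  exact hV

end SchematicAux

namespace RingedPoset

open SchematicAux AlgebraicGeometry

variable {X Y : RingedPoset.{u}}

lemma isIso_stalkSpecializes {A T : LocallyRingedSpace.{u}} {f g : A ⟶ T} (h : f = g) (a : A) :
    IsIso (T.presheaf.stalkSpecializes (specializes_of_eq (congr(($h).base a)).symm)) := by
  subst h
  rw [TopCat.Presheaf.stalkSpecializes_refl]
  infer_instance

lemma isIso_stalkMap_of_comp_eq {A B S T : LocallyRingedSpace.{u}} {i : A ⟶ S} {f : S ⟶ T}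
    {φ : A ⟶ B} {j : B ⟶ T} (h : i ≫ f = φ ≫ j) (a : A) (hi : IsIso (i.stalkMap a))
    (hφ : IsIso (φ.stalkMap a)) (hj : IsIso (j.stalkMap (φ.base a))) :
    IsIso (f.stalkMap (i.base a)) := by
  have h5 : IsIso ((i ≫ f).stalkMap a) := by
    rw [LocallyRingedSpace.stalkMap_congr_hom _ _ h a, LocallyRingedSpace.stalkMap_comp]
    exact IsIso.comp_isIso' (isIso_stalkSpecializes h a) (IsIso.comp_isIso' hj hφ)
  rw [LocallyRingedSpace.stalkMap_comp] at h5
  exact @IsIso.of_isIso_comp_right _ _ _ _ _ (f.stalkMap (i.base a)) (i.stalkMap a) hi h5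

/-- A morphism of schematic ringed posets which is a flat epimorphism on stalks induces
isomorphisms on the local rings of the spectra. -/
lemma isIso_stalkMap_specMap (hX : X.IsSchematic) (hY : Y.IsSchematic) (f : X ⟶ Y)
    (hf : ∀ x, (Hom.stalk f x).hom.Flat) (he : ∀ x, Epi (Hom.stalk f x)) (a : X.Spec) :
    IsIso ((specMap f).stalkMap a) := by
  obtain ⟨x, p, rfl⟩ := X.exists_specPt_eq a
  have hb {R S : CommRingCat.{u}} (φ : R ⟶ S) : IsIso φ ↔ Function.Bijective φ :=
    ConcreteCategory.isIso_iff_bijective φ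
  have := he x
  exact isIso_stalkMap_of_comp_eq (specι_specMap f x) p
    ((hb _).2 (hX.bijective_stalkMap_specι x p))
    ((hb _).2 (bijective_stalkMap_of_flat_of_epi (Hom.stalk f x) (hf x) p))
    ((hb _).2 (hY.bijective_stalkMap_specι _ _))

/-- A morphism of locally ringed spaces is an isomorphism if it is a bijective quotient map and
induces isomorphisms on stalks. -/
lemma isIso_of_bijective {S T : LocallyRingedSpace.{u}} (f : S ⟶ T)
    (hb : Function.Bijective f.base) (ho : ∀ V : Set T, IsOpen (f.base ⁻¹' V) → IsOpen V)
    (hs : ∀ a : S, IsIso (f.stalkMap a)) : IsIso f := by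
  have hemb : Topology.IsOpenEmbedding f.base := by
    refine .of_continuous_injective_isOpenMap f.base.hom.continuous hb.1 fun W hW => ?_
    refine ho _ ?_
    rwa [Set.preimage_image_eq _ hb.1]
  have := LocallyRingedSpace.IsOpenImmersion.of_stalk_iso f hemb
  have : Epi f.base := (TopCat.epi_iff_surjective _).2 hb.2
  exact LocallyRingedSpace.IsOpenImmersion.to_iso f

end RingedPoset

namespace SchFin

open RingedPoset SchematicAux

variable {P : Type u} [PartialOrder P] [Finite P] {G : Pᵒᵖ ⥤ SchFin.{u}} {c : Cocone G}

/-- Common refinements of points give injectivity and the covering gives surjectivity. On a chart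
`Spec 𝒪 x` the topology is controlled by the points of the cylinder lying over indices `≥ x`: they
form a finite, jointly surjective family of flat maps. The local rings agree because the stalk maps
are flat epimorphisms. -/
lemma isIso_specMap_cylinderπ (hc : ∀ Δ, IsFlatMono (c.ι.app Δ)) (hd : IsCodirected c)
    (hs : ∀ a : c.pt.toRingedPoset.Spec, ∃ Δ, a ∈ range (c.ι.app Δ)) :
    IsIso (specMap (cylinderπ c)) := by
  have hK := isSchematic_cylinder hc hd
  have key (k : CylinderPt G) (p : PrimeSpectrum ((G.obj (op k.idx)).O k.pt)) :
      (specMap (cylinderπ c)).base ((cylinder G).specPt k p) =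
        (specMap (c.ι.app (op k.idx)).hom).base
          ((G.obj (op k.idx)).toRingedPoset.specPt k.pt p) :=
    (specMap_specPt (cylinderπ c) k p).trans
      (specMap_specPt (c.ι.app (op k.idx)).hom k.pt p).symm
  have hsurj (a : c.pt.toRingedPoset.Spec) : ∃ (k : CylinderPt G)
      (p : PrimeSpectrum ((G.obj (op k.idx)).O k.pt)),
      (specMap (cylinderπ c)).base ((cylinder G).specPt k p) = a := by
    obtain ⟨⟨Δ⟩, b, hb⟩ := hs a
    obtain ⟨y, r, rfl⟩ := RingedPoset.exists_specPt_eq _ b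
    exact ⟨⟨Δ, y⟩, r, (key ⟨Δ, y⟩ r).trans hb⟩
  refine isIso_of_bijective _ ⟨fun a b hab => ?_, fun a => ?_⟩ (fun V hV => ?_) (fun a => ?_)
  · obtain ⟨k, p, rfl⟩ := RingedPoset.exists_specPt_eq _ a
    obtain ⟨k', p', rfl⟩ := RingedPoset.exists_specPt_eq _ b
    obtain ⟨k'', h, h', r, rfl, rfl⟩ := exists_cylinder_le hc hd
      (((key k p).symm.trans hab).trans (key k' p'))
    exact ((cylinder G).specPt_comap_res h r).trans ((cylinder G).specPt_comap_res h' r).symm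
  · obtain ⟨k, p, h⟩ := hsurj a
    exact ⟨_, h⟩
  · rw [RingedPoset.isOpen_spec_iff]
    intro x
    have hB := fun k : {k : cylinder G // x ≤ (cylinderπ c).base k} =>
      c.pt.toRingedPoset.res k.2 ≫ (cylinderπ c).stalk k.1
    have hpt (k : {k : cylinder G // x ≤ (cylinderπ c).base k})
        (q : PrimeSpectrum ((cylinder G).O.obj k.1)) : c.pt.toRingedPoset.specPt x
          (PrimeSpectrum.comap (c.pt.toRingedPoset.res k.2 ≫ (cylinderπ c).stalk k.1).hom q) =
        (specMap (cylinderπ c)).base ((cylinder G).specPt k.1 q) :=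
      (RingedPoset.specPt_comap_res _ k.2 _).trans (specMap_specPt (cylinderπ c) k.1 q).symm
    refine isOpen_of_flat (fun k : {k : cylinder G // x ≤ (cylinderπ c).base k} =>
      (c.pt.toRingedPoset.res k.2 ≫ (cylinderπ c).stalk k.1).hom)
      (fun k => RingHom.Flat.comp (c.pt.isSchematic.flat _) ((hc _).flat _)) (fun p => ?_)
      (fun k => ?_)
    · obtain ⟨k, q, h⟩ := hsurj (c.pt.toRingedPoset.specPt x p)
      obtain ⟨k', q', -, hk', he⟩ := exists_specPt_eq_of_specMap_eq
        (X := ⟨cylinder G, hK⟩) ⟨cylinderπ c, isSchematic_cylinderπ c⟩ h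
      refine ⟨⟨k', hk'⟩, q', c.pt.isSchematic.specPt_injective x ?_⟩
      exact (hpt ⟨k', hk'⟩ q').trans ((congrArg _ he).trans h)
    · have h1 := (RingedPoset.isOpen_spec_iff _).1 hV k.1
      convert h1 using 1
      ext q
      exact iff_of_eq (congrArg (· ∈ V) (hpt k q))
  · exact isIso_stalkMap_specMap hK c.pt.isSchematic _ (fun k => (hc _).flat _)
      (fun k => (hc _).epi _) a

end SchFin

/-! ### Stars of the cylinder and flat covers. -/

namespace SchFin

open RingedPoset SchematicAux

lemma IsQcIso.of_comp {X Y Z : SchFin.{u}} {f : X ⟶ Y} {g : Y ⟶ Z} (hfg : IsQcIso (f ≫ g))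
    (hg : IsQcIso g) : IsQcIso f := by
  rw [IsQcIso] at hfg hg
  rw [comp_hom, RingedPoset.specMap_comp] at hfg
  exact IsIso.of_isIso_comp_right _ (specMap g.hom)

variable {P : Type u} [PartialOrder P] [Finite P] {G : Pᵒᵖ ⥤ SchFin.{u}} {c : Cocone G}

/-- The legs of a cocone are flat monomorphisms which cover the vertex, and points of the diagram
with the same image in the vertex come from a common point. -/
structure IsFlatCover (c : Cocone G) : Prop where
  isFlatMono : ∀ Δ, IsFlatMono (c.ι.app Δ)
  isCodirected : IsCodirected c
  surjective : ∀ a : c.pt.toRingedPoset.Spec, ∃ Δ, a ∈ range (c.ι.app Δ)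

namespace IsFlatCover

/-- The cylinder of a flat cover, as a schematic space. -/
def space (hc : IsFlatCover c) : SchFin.{u} :=
  ⟨cylinder G, isSchematic_cylinder hc.isFlatMono hc.isCodirected⟩

/-- The projection from the cylinder of a flat cover to the space which is covered. -/
def proj (hc : IsFlatCover c) : hc.space ⟶ c.pt := ⟨cylinderπ c, isSchematic_cylinderπ c⟩

lemma isQcIso_proj (hc : IsFlatCover c) : IsQcIso hc.proj :=
  isIso_specMap_cylinderπ hc.isFlatMono hc.isCodirected hc.surjective

/-- The projection from the star of `(Δ, x)` in the cylinder to the star of `x` in `G Δ`. -/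
def starProj (hc : IsFlatCover c) (k : CylinderPt G) :
    hc.space.star k ⟶ (G.obj (op k.idx)).star k.pt where
  hom :=
    { base := ⟨fun z => ⟨(tr G (CylinderPt.idx_le z.2)).hom.base z.1.pt, CylinderPt.pt_le z.2⟩,
        fun z z' h => by
          have e := tr_comp_base G (CylinderPt.idx_le z.2)
            (CylinderPt.idx_le (h : z.1 ≤ z'.1)) z'.1.pt
          exact ((tr G (CylinderPt.idx_le z.2)).hom.base.monotone
            (CylinderPt.pt_le (h : z.1 ≤ z'.1))).trans e.ge⟩
      sharp :=
        { app := fun z => (tr G (CylinderPt.idx_le z.2)).hom.stalk z.1.pt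
          naturality := fun z z' h => by
            have h' : z.1 ≤ z'.1 := leOfHom h
            have e1 := tr_comp_stalk G (CylinderPt.idx_le z.2) (CylinderPt.idx_le h') z'.1.pt
            have e2 := stalk_res (tr G (CylinderPt.idx_le z.2)).hom (CylinderPt.pt_le h')
            refine (congrArg ((G.obj (op k.idx)).toRingedPoset.res _ ≫ ·) e1).trans ?_
            refine (Category.assoc _ _ _).symm.trans ?_
            refine (congrArg (· ≫ _) (res_res _ _ _)).trans ?_
            refine (Category.assoc _ _ _).symm.trans ?_
            exact (congrArg (· ≫ _) e2).trans (Category.assoc _ _ _) } }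
  isSchematic := RingedPoset.Hom.isSchematic_of ((G.obj (op k.idx)).star k.pt).isSchematic
    (fun {z y} h p hp => by
      obtain ⟨w, hw, hyw, q, hq⟩ := (tr G (CylinderPt.idx_le z.2)).isSchematic.exists_le
        (x := z.1.pt) (y := y.1) (p := p) h hp
      have hk : z.1 ≤ ⟨z.1.idx, w⟩ := ⟨le_refl _, hw.trans (tr_refl_base G _ _).ge⟩
      refine ⟨⟨⟨z.1.idx, w⟩, le_trans z.2 hk⟩, hk, hyw, q, ?_⟩
      exact (congrArg (fun φ : (G.obj (op z.1.idx)).O z.1.pt ⟶ (G.obj (op z.1.idx)).O w =>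
        PrimeSpectrum.comap φ.hom q) (cylinderRes_mk hk hw)).trans hq)

/-- Both stars project by qc-isomorphisms to the same one-point space, since the ring of the
cylinder at `(Δ, x)` is the ring of `G Δ` at `x`; two out of three gives the claim. -/
lemma isQcIso_starProj (hc : IsFlatCover c) (k : CylinderPt G) : IsQcIso (hc.starProj k) := by
  have h : hc.starProj k ≫ (G.obj (op k.idx)).starπ k.pt = hc.space.starπ k := by
    refine SchFin.hom_ext (RingedPoset.hom_ext (fun _ => rfl) (fun z => ?_))
    exact (Category.id_comp (cylinderRes z.2)).symm
  exact IsQcIso.of_comp (h ▸ isQcIso_starπ hc.space k) (isQcIso_starπ _ _)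

/-- The projection from the star of `(Δ, x)` in the cylinder to `G Δ`. -/
def starTo (hc : IsFlatCover c) (k : CylinderPt G) : hc.space.star k ⟶ G.obj (op k.idx) :=
  hc.starProj k ≫ (G.obj (op k.idx)).starι k.pt

lemma starι_proj (hc : IsFlatCover c) (k : CylinderPt G) :
    hc.space.starι k ≫ hc.proj = hc.starTo k ≫ c.ι.app (op k.idx) := by
  refine SchFin.hom_ext (RingedPoset.hom_ext (fun z => w_base _ _) (fun z => ?_))
  have e := w_stalk (c := c) (CylinderPt.idx_le z.2) z.1.pt
  refine (Category.comp_id _).trans (e.trans ?_)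
  refine congrArg (c.pt.toRingedPoset.res (w_base (c := c) (CylinderPt.idx_le z.2) z.1.pt).le ≫ ·) ?_
  refine congrArg ((c.ι.app (op k.idx)).hom.stalk _ ≫ ·) ?_
  exact (Category.id_comp ((tr G (CylinderPt.idx_le z.2)).hom.stalk z.1.pt)).symm

/-- The index functor of the cylinder. -/
def idx (hc : IsFlatCover c) : (hc.space : Type u)ᵒᵖ ⥤ Pᵒᵖ :=
  (show Monotone (CylinderPt.idx : CylinderPt G → P) from fun _ _ h => CylinderPt.idx_le h).functor.op

/-- The inclusion of `G Δ` into the cylinder, on points. -/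
def incl (hc : IsFlatCover c) (Δ : Pᵒᵖ) : (G.obj Δ : Type u)ᵒᵖ ⥤ (hc.space : Type u)ᵒᵖ :=
  (show Monotone (fun x : G.obj Δ => (⟨Δ.unop, x⟩ : CylinderPt G)) from
    fun _ _ h => ⟨le_refl _, h.trans (tr_refl_base G _ _).ge⟩).functor.op

/-- The projections from the stars of the cylinder to the diagram. -/
def toDiagram (hc : IsFlatCover c) : hc.space.starDiagram ⟶ hc.idx ⋙ G where
  app k := hc.starTo k.unop
  naturality k k' h := by
    have hk : (k'.unop : CylinderPt G) ≤ k.unop := leOfHom h.unop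
    refine SchFin.hom_ext (RingedPoset.hom_ext (fun z => ?_) (fun z => ?_))
    · exact tr_comp_base G (CylinderPt.idx_le hk) (CylinderPt.idx_le z.2) z.1.pt
    · have e := tr_comp_stalk G (CylinderPt.idx_le hk) (CylinderPt.idx_le z.2) z.1.pt
      refine (Category.comp_id _).trans ((Category.id_comp _).trans (e.trans ?_))
      refine congrArg ((G.obj (op k'.unop.idx)).toRingedPoset.res (tr_comp_base G
        (CylinderPt.idx_le hk) (CylinderPt.idx_le z.2) z.1.pt).le ≫ ·) ?_
      refine congrArg ((tr G (CylinderPt.idx_le hk)).hom.stalk _ ≫ ·) ?_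
      exact (Category.id_comp ((tr G (CylinderPt.idx_le z.2)).hom.stalk z.1.pt)).symm

/-- The projections from the stars of the cylinder to the stars of `G Δ`. -/
def toStar (hc : IsFlatCover c) (Δ : Pᵒᵖ) :
    hc.incl Δ ⋙ hc.space.starDiagram ⟶ (G.obj Δ).starDiagram where
  app x := hc.starProj ⟨Δ.unop, x.unop⟩
  naturality x x' h := by
    refine SchFin.hom_ext (RingedPoset.hom_ext (fun z => rfl) (fun z => ?_))
    refine (Category.comp_id _).trans (Eq.symm ?_)
    exact (congrArg (· ≫ _) (res_self _ _ _)).trans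
      ((Category.id_comp _).trans (Category.id_comp _))

lemma toStar_starLeg (hc : IsFlatCover c) (Δ : Pᵒᵖ) (x : (G.obj Δ : Type u)ᵒᵖ) :
    (hc.toStar Δ).app x ≫ (G.obj Δ).starLeg x = hc.toDiagram.app ((hc.incl Δ).obj x) := rfl

lemma starLeg_proj (hc : IsFlatCover c) (k : (hc.space : Type u)ᵒᵖ) :
    hc.space.starLeg k ≫ hc.proj = hc.toDiagram.app k ≫ c.ι.app (hc.idx.obj k) :=
  hc.starι_proj k.unop

end IsFlatCover

/-- The nerve of a covering by flat immersions. -/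
lemma IsCovering.isFlatCover {X : SchFin.{u}} {I : Type u} {U : I → SchFin.{u}} {f : ∀ i, U i ⟶ X}
    (hf : IsCovering f) : IsFlatCover (nerveCocone f) := by
  classical
  have hm (i) := (hf.isFlatImmersion i).isFlatMono
  refine ⟨isFlatMono_nerveCocone hm, fun Δ Δ' a h h' => ?_, fun a => ?_⟩
  -- The image of `𝒰(Δ)` is the intersection of the images of its factors, so a point in the images
  -- of `𝒰(Δ)` and `𝒰(Δ')` lies in that of `𝒰(Δ ∪ Δ')`.
  · refine ⟨⟨Δ.1 ∪ Δ'.1, Δ.2.mono Finset.subset_union_left⟩, Finset.subset_union_left,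
      Finset.subset_union_right, ?_⟩
    have h1 := (mem_range_nerveCocone_iff hm _ a).1 h
    have h2 := (mem_range_nerveCocone_iff hm _ a).1 h'
    refine (mem_range_nerveCocone_iff hm _ a).2 fun i hi => ?_
    exact (Finset.mem_union.1 hi).elim (h1 i) (h2 i)
  · obtain ⟨i, q, hq⟩ := hf.surjective a
    refine ⟨op ⟨{i}, Finset.singleton_nonempty i⟩, ?_⟩
    refine (mem_range_nerveCocone_iff hm _ a).2 fun j hj => ?_
    obtain rfl := Finset.mem_singleton.1 hj
    exact ⟨q, hq⟩

end SchFin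

/-! ### External descent with values in a category. -/

section

variable {C : Type w} [Category.{v} C]

/-- Internal descent, in terms of the stars of a schematic space. -/
lemma SatisfiesInternalDescent.existsUnique {Dat : SchFin.{u} ⥤ C} {hD : IsGeometric Dat}
    (h : SatisfiesInternalDescent Dat hD) (Y : SchFin.{u}) {T : C}
    (s : ∀ x : (Y : Type u)ᵒᵖ, Dat.obj (Y.starDiagram.obj x) ⟶ T)
    (hs : ∀ {x y : (Y : Type u)ᵒᵖ} (h : x ⟶ y), Dat.map (Y.starDiagram.map h) ≫ s y = s x) :
    ∃! m : Dat.obj Y ⟶ T, ∀ x, Dat.map (Y.starLeg x) ≫ m = s x := by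
  obtain ⟨hl⟩ := h Y
  have hi (x : (Y : Type u)ᵒᵖ) : IsIso (Dat.map (Y.starToPoint.app x)) :=
    hD _ (Y.isQcIso_starπ x.unop)
  have hw (x : (Y : Type u)ᵒᵖ) (m : Dat.obj Y ⟶ T) : Dat.map (Y.starLeg x) ≫ m = s x ↔
      (internalCocone Dat hD Y).ι.app x ≫ m = inv (Dat.map (Y.starToPoint.app x)) ≫ s x := by
    change _ ↔ (inv (Dat.map (Y.starToPoint.app x)) ≫ Dat.map (Y.starLeg x)) ≫ m = _
    rw [Category.assoc, cancel_epi]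
  let d : Cocone (Y.pointDiagram ⋙ Dat) :=
    { pt := T
      ι :=
        { app := fun x => inv (Dat.map (Y.starToPoint.app x)) ≫ s x
          naturality := fun x y h => by
            have h1 := congrArg Dat.map (Y.starToPoint.naturality h)
            rw [Functor.map_comp, Functor.map_comp] at h1
            refine Eq.trans ?_ (Category.comp_id _).symm
            rw [← hs h, ← cancel_epi (Dat.map (Y.starToPoint.app x)), IsIso.hom_inv_id_assoc]
            refine (Category.assoc _ _ _).symm.trans ?_
            refine (congrArg (· ≫ _) h1.symm).trans ?_
            rw [Category.assoc, IsIso.hom_inv_id_assoc] } }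
  refine ⟨hl.desc d, fun x => (hw x _).2 (hl.fac d x), fun m hm => ?_⟩
  exact hl.hom_ext fun x => ((hw x m).1 (hm x)).trans (hl.fac d x).symm

/-- External descent for flat covers, for geometric data with values in a category. -/
theorem SchFin.IsFlatCover.nonempty_isColimit {P : Type u} [PartialOrder P] [Finite P]
    {G : Pᵒᵖ ⥤ SchFin.{u}} {c : Cocone G} (hc : IsFlatCover c) {Dat : SchFin.{u} ⥤ C}
    {hD : IsGeometric Dat} (h : SatisfiesInternalDescent Dat hD) :
    Nonempty (IsColimit (Dat.mapCocone c)) := by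
  have hπ : IsIso (Dat.map hc.proj) := hD _ hc.isQcIso_proj
  have hw (k : (hc.space : Type u)ᵒᵖ) {T : C} (m : Dat.obj c.pt ⟶ T) :
      Dat.map (hc.space.starLeg k) ≫ Dat.map hc.proj ≫ m =
        Dat.map (hc.toDiagram.app k) ≫ Dat.map (c.ι.app (hc.idx.obj k)) ≫ m := by
    have := congrArg Dat.map (hc.starLeg_proj k)
    rw [Functor.map_comp, Functor.map_comp] at this
    rw [← Category.assoc, this, Category.assoc]
  -- By internal descent for `G Δ`, morphisms out of its datum are detected on its stars, and these
  -- may be replaced by the stars of the cylinder at the points of index `Δ`.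
  have hepi (Δ : Pᵒᵖ) {T : C} {a b : Dat.obj (G.obj Δ) ⟶ T} (hab : ∀ x : (G.obj Δ : Type u)ᵒᵖ,
      Dat.map (hc.toDiagram.app ((hc.incl Δ).obj x)) ≫ a =
        Dat.map (hc.toDiagram.app ((hc.incl Δ).obj x)) ≫ b) : a = b := by
    refine (h.existsUnique (G.obj Δ) (fun x => Dat.map ((G.obj Δ).starLeg x) ≫ b)
      (fun {x y} g => ?_)).unique (fun x => ?_) (fun x => rfl)
    · rw [← Category.assoc, ← Functor.map_comp, SchFin.map_starLeg]
    · have hi : IsIso (Dat.map ((hc.toStar Δ).app x)) := hD _ (hc.isQcIso_starProj _)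
      rw [← cancel_epi (Dat.map ((hc.toStar Δ).app x)), ← Category.assoc, ← Category.assoc,
        ← Functor.map_comp, hc.toStar_starLeg]
      exact hab x
  have key (s : Cocone (G ⋙ Dat)) : ∃! m : Dat.obj c.pt ⟶ s.pt,
      ∀ Δ, Dat.map (c.ι.app Δ) ≫ m = s.ι.app Δ := by
    -- A cocone on `G` pulls back to a cocone on the stars of the cylinder. Internal descent
    -- produces a morphism out of the datum of the cylinder, and the qc-isomorphism to the vertex
    -- carries it over.
    obtain ⟨m, hm, hu⟩ := h.existsUnique hc.space
      (fun k => Dat.map (hc.toDiagram.app k) ≫ s.ι.app (hc.idx.obj k)) (fun {k k'} g => by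
        have h1 := congrArg Dat.map (hc.toDiagram.naturality g)
        rw [Functor.map_comp, Functor.map_comp] at h1
        rw [← Category.assoc, h1, Category.assoc]
        exact congrArg (_ ≫ ·) (s.w (hc.idx.map g)))
    refine ⟨inv (Dat.map hc.proj) ≫ m, fun Δ => hepi Δ fun x => ?_, fun m' hm' => ?_⟩
    · refine (hw ((hc.incl Δ).obj x) _).symm.trans (Eq.trans ?_ (hm ((hc.incl Δ).obj x)))
      rw [IsIso.hom_inv_id_assoc]
    · rw [← cancel_epi (Dat.map hc.proj), IsIso.hom_inv_id_assoc]
      refine hu _ fun k => ?_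
      rw [hw, hm']
  exact ⟨{ desc := fun s => (key s).choose
           fac := fun s Δ => (key s).choose_spec.1 Δ
           uniq := fun s m hm => (key s).choose_spec.2 m hm }⟩

end

/-! ### Calculus of 2-cells lying over 1-cells. -/

section TwoCategorical

open Bicategory

namespace PseudoCocone

variable {S : Type w'} [Category.{v'} S] {D : Type w} [Bicategory.{v, t} D]

section

variable {x y z z' e : D}

lemma isEquivalence_precomp {a b c : D} (E : a ≌ b) :
    (precomp c E.hom).IsEquivalence := by
  have e1 : precomp c E.inv ⋙ precomp c E.hom ≅ 𝟭 _ :=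
    (associatorNatIsoRight E.hom E.inv c).symm ≪≫
      (precomposing a a c).mapIso E.unit.symm ≪≫ leftUnitorNatIso a c
  have e2 : precomp c E.hom ⋙ precomp c E.inv ≅ 𝟭 _ :=
    (associatorNatIsoRight E.inv E.hom c).symm ≪≫
      (precomposing b b c).mapIso E.counit ≪≫ leftUnitorNatIso b c
  exact (CategoryTheory.Equivalence.mk (precomp c E.hom) (precomp c E.inv) e2.symm e1).isEquivalence_functor

/-- Composition of 2-cells along a factorization of 1-cells. -/
def mcomp {h : x ⟶ z} {f : x ⟶ y} {g : y ⟶ z} (m : h ≅ f ≫ g) {φ : x ⟶ e} {ψ : y ⟶ e} {χ : z ⟶ e}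
    (α : f ≫ ψ ⟶ φ) (β : g ≫ χ ⟶ ψ) : h ≫ χ ⟶ φ :=
  m.hom ▷ χ ≫ (α_ _ _ _).hom ≫ f ◁ β ≫ α

variable {h : x ⟶ z} {f : x ⟶ y} {g : y ⟶ z} (m : h ≅ f ≫ g) {φ φ' : x ⟶ e} {ψ ψ' : y ⟶ e}
  {χ χ' : z ⟶ e}

lemma mcomp_comp (α : f ≫ ψ ⟶ φ) (β : g ≫ χ ⟶ ψ) (η : φ ⟶ φ') :
    mcomp m α β ≫ η = mcomp m (α ≫ η) β := by
  simp [mcomp]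

lemma mcomp_whiskerLeft_left (α : f ≫ ψ' ⟶ φ) (β : g ≫ χ ⟶ ψ) (η : ψ ⟶ ψ') :
    mcomp m (f ◁ η ≫ α) β = mcomp m α (β ≫ η) := by
  simp [mcomp]

lemma mcomp_whiskerLeft_right (α : f ≫ ψ ⟶ φ) (β : g ≫ χ' ⟶ ψ) (η : χ ⟶ χ') :
    mcomp m α (g ◁ η ≫ β) = h ◁ η ≫ mcomp m α β := by
  simp [mcomp, whisker_exchange_assoc]

lemma mcomp_assoc {k : x ⟶ z'} {l : z ⟶ z'} {n : y ⟶ z'} {θ : z' ⟶ e} (m₂ : k ≅ h ≫ l)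
    (m₃ : n ≅ g ≫ l) (m₄ : k ≅ f ≫ n)
    (hm : m₄.hom ≫ f ◁ m₃.hom = m₂.hom ≫ m.hom ▷ l ≫ (α_ _ _ _).hom)
    (α : f ≫ ψ ⟶ φ) (β : g ≫ χ ⟶ ψ) (γ : l ≫ θ ⟶ χ) :
    mcomp m₂ (mcomp m α β) γ = mcomp m₄ α (mcomp m₃ β γ) := by
  have hm' := congrArg (· ▷ θ) hm
  rw [comp_whiskerRight, comp_whiskerRight, comp_whiskerRight] at hm'
  have : m₄.hom ▷ θ ≫ (α_ _ _ _).hom ≫ f ◁ m₃.hom ▷ θ = m₂.hom ▷ θ ≫ (α_ _ _ _).hom ≫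
      m.hom ▷ (l ≫ θ) ≫ (α_ _ _ _).hom ≫ f ◁ (α_ _ _ _).inv := by
    have h1 : (α_ _ _ _).hom ≫ f ◁ m₃.hom ▷ θ =
      (f ◁ m₃.hom) ▷ θ ≫ (α_ f (g ≫ l) θ).hom := by simp
    rw [h1, reassoc_of% hm']
    simp
  simp only [mcomp, whiskerLeft_comp, Category.assoc]
  rw [reassoc_of% this]
  simp [whisker_exchange_assoc]

lemma isIso_mcomp (α : f ≫ ψ ⟶ φ) (β : g ≫ χ ⟶ ψ) (hα : IsIso α) (hβ : IsIso β) :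
    IsIso (mcomp m α β) := by
  unfold mcomp
  infer_instance

lemma mcomp_cancel_right {α α' : f ≫ ψ ⟶ φ} (β : g ≫ χ ⟶ ψ) (hβ : IsIso β)
    (heq : mcomp m α β = mcomp m α' β) : α = α' := by
  unfold mcomp at heq
  rwa [cancel_epi, cancel_epi, cancel_epi] at heq

lemma exists_mcomp_right (β : g ≫ χ ⟶ ψ) (hβ : IsIso β) (γ : h ≫ χ ⟶ φ) :
    ∃ α : f ≫ ψ ⟶ φ, mcomp m α β = γ :=
  ⟨inv (f ◁ β) ≫ (α_ _ _ _).inv ≫ m.inv ▷ χ ≫ γ, by simp [mcomp]⟩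

/-- Dividing by the invertible `α` leaves a 2-cell between 1-cells precomposed with `f`; it comes
from a 2-cell before precomposition because the precomposition functor is full. Faithfulness of the
same functor gives left cancellation. -/
lemma exists_mcomp_left (hf : ∀ d, (precomp d f).IsEquivalence) (α : f ≫ ψ ⟶ φ) (hα : IsIso α)
    (γ : h ≫ χ ⟶ φ) : ∃ β : g ≫ χ ⟶ ψ, mcomp m α β = γ := by
  have := hf e
  let γ' : f ≫ g ≫ χ ⟶ f ≫ ψ := (α_ _ _ _).inv ≫ m.inv ▷ χ ≫ γ ≫ inv α
  obtain ⟨β, hβ⟩ := (precomp e f).map_surjective γ'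
  refine ⟨β, ?_⟩
  have hβ' : f ◁ β = γ' := hβ
  rw [mcomp, hβ']
  simp [γ']

lemma mcomp_cancel_left (hf : ∀ d, (precomp d f).IsEquivalence) (α : f ≫ ψ ⟶ φ) (hα : IsIso α)
    {β β' : g ≫ χ ⟶ ψ} (heq : mcomp m α β = mcomp m α β') : β = β' := by
  have := hf e
  apply (precomp e f).map_injective
  unfold mcomp at heq
  rwa [cancel_epi, cancel_epi, cancel_mono] at heq

lemma isIso_of_mcomp (hf : ∀ d, (precomp d f).IsEquivalence) (α : f ≫ ψ ⟶ φ) (hα : IsIso α)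
    (β : g ≫ χ ⟶ ψ) (h : IsIso (mcomp m α β)) : IsIso β := by
  have := hf e
  have h1 : f ◁ β = (α_ _ _ _).inv ≫ m.inv ▷ χ ≫ mcomp m α β ≫ inv α := by
    simp [mcomp]
  have : IsIso ((precomp e f).map β) := by
    change IsIso (f ◁ β)
    rw [h1]
    infer_instance
  exact isIso_of_reflects_iso β (precomp e f)

/-- Postcomposition of a 2-cell with a 1-cell. -/
def mpost {e' : D} (α : f ≫ ψ ⟶ φ) (ρ : e ⟶ e') : f ≫ ψ ≫ ρ ⟶ φ ≫ ρ := (α_ _ _ _).inv ≫ α ▷ ρ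

lemma mpost_mcomp {e' : D} (α : f ≫ ψ ⟶ φ) (β : g ≫ χ ⟶ ψ) (ρ : e ⟶ e') :
    mpost (mcomp m α β) ρ = mcomp m (mpost α ρ) (mpost β ρ) := by
  simp [mpost, mcomp]

end

variable (F : LocallyDiscrete S ⥤ᵖ D) {e : D}

/-- Composition of 2-cells over the composition of morphisms in the source of a pseudofunctor. -/
abbrev ccomp {a b c : S} {f : a ⟶ b} {g : b ⟶ c} {h : a ⟶ c} (hfg : f ≫ g = h)
    {φ : F.obj ⟨a⟩ ⟶ e} {ψ : F.obj ⟨b⟩ ⟶ e} {χ : F.obj ⟨c⟩ ⟶ e}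
    (α : F.map f.toLoc ≫ ψ ⟶ φ) (β : F.map g.toLoc ≫ χ ⟶ ψ) : F.map h.toLoc ≫ χ ⟶ φ :=
  mcomp (F.mapComp' f.toLoc g.toLoc h.toLoc (congrArg Quiver.Hom.toLoc hfg)) α β

/-- The identity 2-cell over an identity morphism. -/
def cid {a : S} {f : a ⟶ a} (hf : f = 𝟙 a) (φ : F.obj ⟨a⟩ ⟶ e) : F.map f.toLoc ≫ φ ⟶ φ :=
  (F.mapId' f.toLoc (congrArg Quiver.Hom.toLoc hf)).hom ▷ φ ≫ (λ_ φ).hom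

lemma ccomp_assoc {a b c d : S} {f : a ⟶ b} {g : b ⟶ c} {h : c ⟶ d} {fg : a ⟶ c} {gh : b ⟶ d}
    {k : a ⟶ d} (h₁ : f ≫ g = fg) (h₂ : fg ≫ h = k) (h₃ : g ≫ h = gh) (h₄ : f ≫ gh = k)
    {φ : F.obj ⟨a⟩ ⟶ e} {ψ : F.obj ⟨b⟩ ⟶ e} {χ : F.obj ⟨c⟩ ⟶ e} {θ : F.obj ⟨d⟩ ⟶ e}
    (α : F.map f.toLoc ≫ ψ ⟶ φ) (β : F.map g.toLoc ≫ χ ⟶ ψ) (γ : F.map h.toLoc ≫ θ ⟶ χ) :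
    ccomp F h₂ (ccomp F h₁ α β) γ = ccomp F h₄ α (ccomp F h₃ β γ) :=
  mcomp_assoc _ _ _ _ (F.mapComp'₀₁₃_hom_comp_whiskerLeft_mapComp'_hom f.toLoc g.toLoc h.toLoc
    fg.toLoc gh.toLoc k.toLoc (congrArg Quiver.Hom.toLoc h₁) (congrArg Quiver.Hom.toLoc h₃)
    (congrArg Quiver.Hom.toLoc h₄)) α β γ

lemma cid_ccomp {a b : S} {f : a ⟶ a} (hf : f = 𝟙 a) {g : a ⟶ b} (h : f ≫ g = g)
    {φ : F.obj ⟨a⟩ ⟶ e} {χ : F.obj ⟨b⟩ ⟶ e} (β : F.map g.toLoc ≫ χ ⟶ φ) :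
    ccomp F h (cid F hf φ) β = β := by
  subst hf
  have key {a b : LocallyDiscrete S} (g : a ⟶ b) {φ : F.obj a ⟶ e} {χ : F.obj b ⟶ e}
      (β : F.map g ≫ χ ⟶ φ) : mcomp (F.mapComp' (𝟙 a) g g (Category.id_comp g))
        ((F.mapId' (𝟙 a) rfl).hom ▷ φ ≫ (λ_ φ).hom) β = β := by
    rw [mcomp, F.mapComp'_id_comp_hom, F.mapId'_eq_mapId, whisker_exchange_assoc]
    simp
  exact key g.toLoc β

lemma ccomp_cid {a b : S} {f : a ⟶ b} {g : b ⟶ b} (hg : g = 𝟙 b) (h : f ≫ g = f)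
    {φ : F.obj ⟨a⟩ ⟶ e} {ψ : F.obj ⟨b⟩ ⟶ e} (α : F.map f.toLoc ≫ ψ ⟶ φ) :
    ccomp F h α (cid F hg ψ) = α := by
  subst hg
  have key {a b : LocallyDiscrete S} (f : a ⟶ b) {φ : F.obj a ⟶ e} {ψ : F.obj b ⟶ e}
      (α : F.map f ≫ ψ ⟶ φ) : mcomp (F.mapComp' f (𝟙 b) f (Category.comp_id f)) α
        ((F.mapId' (𝟙 b) rfl).hom ▷ ψ ≫ (λ_ ψ).hom) = α := by
    rw [mcomp, F.mapComp'_comp_id_hom, F.mapId'_eq_mapId]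
    simp
  exact key f.toLoc α

end PseudoCocone

end TwoCategorical

/-! ### Transport of pseudococones between related diagrams. -/

section TwoCategorical

open Bicategory

namespace PseudoCocone

variable {S : Type w'} [Category.{v'} S] {D : Type w} [Bicategory.{v, t} D]
  {F : LocallyDiscrete S ⥤ᵖ D} {e : D} {J : Type u} [Category.{u} J] {G : J ⥤ S}

/-- Allowing any `f` equal to the identity makes the unit axiom applicable to images of identities
under functors and to endomorphisms in a poset. -/
lemma comm_eq_cid (c : PseudoCocone F G e) {j : J} (f : j ⟶ j) (hf : f = 𝟙 j)
    (h : G.map f = 𝟙 (G.obj j)) : (c.comm f).hom = cid F h (c.leg j) := by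
  subst hf
  exact c.comm_id j

lemma comm_eq_ccomp (c : PseudoCocone F G e) {j k l : J} (f : j ⟶ k) (g : k ⟶ l) (h : j ⟶ l)
    (hfg : f ≫ g = h) (h' : G.map f ≫ G.map g = G.map h) :
    (c.comm h).hom = ccomp F h' (c.comm f).hom (c.comm g).hom := by
  subst hfg
  exact c.comm_comp f g

lemma comm_naturality {c c' : PseudoCocone F G e} (μ : c ⟶ c') {j k : J} (f : j ⟶ k) :
    F.map (G.map f).toLoc ◁ μ.app k ≫ (c'.comm f).hom = (c.comm f).hom ≫ μ.app j :=
  μ.naturality f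

/-- Isomorphisms of pseudococones. -/
noncomputable def isoMk {c c' : PseudoCocone F G e} (μ : c ⟶ c') [∀ j, IsIso (μ.app j)] : c ≅ c' where
  hom := μ
  inv := ⟨fun j => inv (μ.app j), fun {j k} f => by
    rw [← cancel_mono (μ.app j), Category.assoc, Category.assoc, ← comm_naturality μ f,
      IsIso.inv_hom_id, Category.comp_id, ← Bicategory.whiskerLeft_comp_assoc, IsIso.inv_hom_id,
      Bicategory.whiskerLeft_id, Category.id_comp]⟩
  hom_inv_id := Hom.ext (funext fun j => IsIso.hom_inv_id (μ.app j))
  inv_hom_id := Hom.ext (funext fun j => IsIso.inv_hom_id (μ.app j))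

/-- Restriction of pseudococones along a functor between the index categories. -/
def restrict {J' : Type u} [Category.{u} J'] (p : J' ⥤ J) (c : PseudoCocone F G e) :
    PseudoCocone F (p ⋙ G) e where
  leg j := c.leg (p.obj j)
  comm f := c.comm (p.map f)
  comm_id j := c.comm_eq_cid _ (p.map_id j) (by rw [p.map_id, G.map_id])
  comm_comp f g := c.comm_eq_ccomp _ _ _ (p.map_comp f g).symm (by rw [p.map_comp, G.map_comp])

/-- 2-cells relating pseudococones on diagrams which are related by a natural transformation. -/
def Related {G' : J ⥤ S} (τ : G' ⟶ G) (b : PseudoCocone F G' e) (c : PseudoCocone F G e)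
    (κ : ∀ j, F.map (τ.app j).toLoc ≫ c.leg j ⟶ b.leg j) : Prop :=
  ∀ ⦃j k : J⦄ (f : j ⟶ k) (h : G'.obj j ⟶ G.obj k) (h₁ : G'.map f ≫ τ.app k = h)
    (h₂ : τ.app j ≫ G.map f = h),
    ccomp F h₁ (b.comm f).hom (κ k) = ccomp F h₂ (κ j) (c.comm f).hom

/-- The legs are precomposed with the components of `τ`. The relation then forces the transition
2-cells, and their coherence follows from that of `c` by associativity and cancellation of the
invertible `κ`. -/
lemma exists_related_of_target {G' : J ⥤ S} (τ : G' ⟶ G) (c : PseudoCocone F G e) :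
    ∃ (b : PseudoCocone F G' e) (κ : ∀ j, F.map (τ.app j).toLoc ≫ c.leg j ⟶ b.leg j),
      (∀ j, IsIso (κ j)) ∧ Related τ b c κ := by
  let κ (j) := 𝟙 (F.map (τ.app j).toLoc ≫ c.leg j)
  have hκ (j) : IsIso (κ j) := inferInstanceAs (IsIso (𝟙 _))
  have key {j k : J} (f : j ⟶ k) := exists_mcomp_right (F.mapComp' (G'.map f).toLoc
    (τ.app k).toLoc (G'.map f ≫ τ.app k).toLoc) (κ k) (hκ k)
    (ccomp F (τ.naturality f).symm (κ j) (c.comm f).hom)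
  choose β hβ using @key
  have hi {j k : J} (f : j ⟶ k) : IsIso (β f) := by
    have h1 : IsIso (ccomp F rfl (β f) (κ k)) := by
      rw [show ccomp F rfl (β f) (κ k) = _ from hβ f]
      exact isIso_mcomp _ _ _ (hκ j) inferInstance
    unfold ccomp mcomp at h1
    simpa [κ] using h1
  have hr {j k : J} (f : j ⟶ k) (h : G'.obj j ⟶ G.obj k) (h₁ : G'.map f ≫ τ.app k = h)
      (h₂ : τ.app j ≫ G.map f = h) :
      ccomp F h₁ (β f) (κ k) = ccomp F h₂ (κ j) (c.comm f).hom := by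
    subst h₁
    exact hβ f
  refine ⟨{ leg := fun j => F.map (τ.app j).toLoc ≫ c.leg j
            comm := fun f => @asIso _ _ _ _ (β f) (hi f)
            comm_id := fun j => ?_
            comm_comp := fun {j k l} f g => ?_ }, κ, hκ, fun j k f => hr f⟩
  · change β (𝟙 j) = cid F (G'.map_id j) _
    refine mcomp_cancel_right _ (κ j) (hκ j) ((hr (𝟙 j) (τ.app j) (by simp) (by simp)).trans ?_)
    rw [c.comm_eq_cid (𝟙 j) rfl (G.map_id j), ccomp_cid]
    exact (cid_ccomp F _ (by simp) _).symm
  · change β (f ≫ g) = ccomp F (G'.map_comp f g).symm (β f) (β g)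
    refine mcomp_cancel_right _ (κ l) (hκ l) ((hr (f ≫ g) _ rfl (τ.naturality _).symm).trans ?_)
    rw [c.comm_eq_ccomp f g _ rfl (G.map_comp f g).symm,
      ← ccomp_assoc F (τ.naturality f).symm (by simp), ← hr f _ rfl,
      ccomp_assoc F rfl (by simp) (τ.naturality g).symm (by simp), ← hr g _ rfl,
      ← ccomp_assoc F (G'.map_comp f g).symm]
    rfl

/-- A 1-cell is an equivalence, in the sense that precomposition with it is an equivalence of
categories. -/
def IsEquiv {a b : D} (f : a ⟶ b) : Prop := ∀ d : D, (precomp d f).IsEquivalence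

/-- In this direction the legs exist only up to isomorphism, by essential surjectivity of
precomposition with the components of `τ`. Fullness yields the transition 2-cells and faithfulness
their coherence. -/
lemma exists_related_of_source {G' : J ⥤ S} (τ : G' ⟶ G)
    (hτ : ∀ j, IsEquiv (F.map (τ.app j).toLoc)) (b : PseudoCocone F G' e) :
    ∃ (c : PseudoCocone F G e) (κ : ∀ j, F.map (τ.app j).toLoc ≫ c.leg j ⟶ b.leg j),
      (∀ j, IsIso (κ j)) ∧ Related τ b c κ := by
  have hκ' (j) : ∃ (l : F.obj ⟨G.obj j⟩ ⟶ e) (κ : F.map (τ.app j).toLoc ≫ l ⟶ b.leg j),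
      IsIso κ := by
    have := hτ j e
    let i := (precomp e (F.map (τ.app j).toLoc)).objObjPreimageIso (b.leg j)
    exact ⟨_, i.hom, i.isIso_hom⟩
  choose l κ hκ using hκ'
  have key {j k : J} (f : j ⟶ k) := exists_mcomp_left (F.mapComp' (τ.app j).toLoc
    (G.map f).toLoc (G'.map f ≫ τ.app k).toLoc
      (congrArg Quiver.Hom.toLoc (τ.naturality f).symm)) (hτ j) (κ j) (hκ j)
    (ccomp F rfl (b.comm f).hom (κ k))
  choose β hβ using @key
  have hr {j k : J} (f : j ⟶ k) (h : G'.obj j ⟶ G.obj k) (h₁ : G'.map f ≫ τ.app k = h)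
      (h₂ : τ.app j ≫ G.map f = h) :
      ccomp F h₁ (b.comm f).hom (κ k) = ccomp F h₂ (κ j) (β f) := by
    subst h₁
    exact (hβ f).symm
  have hi {j k : J} (f : j ⟶ k) : IsIso (β f) := by
    refine isIso_of_mcomp (F.mapComp' (τ.app j).toLoc
      (G.map f).toLoc (G'.map f ≫ τ.app k).toLoc
      (congrArg Quiver.Hom.toLoc (τ.naturality f).symm)) (hτ j) (κ j) (hκ j) _ ?_
    rw [hβ]
    exact isIso_mcomp _ _ _ inferInstance (hκ k)
  refine ⟨{ leg := l
            comm := fun f => @asIso _ _ _ _ (β f) (hi f)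
            comm_id := fun j => ?_
            comm_comp := fun {j k m} f g => ?_ }, κ, hκ, fun j k f => hr f⟩
  · change β (𝟙 j) = cid F (G.map_id j) _
    refine mcomp_cancel_left _ (hτ j) (κ j) (hκ j)
      ((hr (𝟙 j) (τ.app j) (by simp) (by simp)).symm.trans ?_)
    rw [b.comm_eq_cid (𝟙 j) rfl (G'.map_id j), cid_ccomp]
    exact (ccomp_cid F _ (by simp) _).symm
  · change β (f ≫ g) = ccomp F (G.map_comp f g).symm (β f) (β g)
    refine mcomp_cancel_left _ (hτ j) (κ j) (hκ j)
      ((hr (f ≫ g) _ rfl (τ.naturality _).symm).symm.trans ?_)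
    rw [b.comm_eq_ccomp f g _ rfl (G'.map_comp f g).symm,
      ccomp_assoc F (G'.map_comp f g).symm rfl rfl (by simp), hr g _ rfl (τ.naturality g).symm,
      ← ccomp_assoc F rfl (by simp) (τ.naturality g).symm (by simp),
      hr f _ rfl (τ.naturality f).symm,
      ccomp_assoc F (τ.naturality f).symm (by simp) (G.map_comp f g).symm]
    exact (τ.naturality _).symm

end PseudoCocone

end TwoCategorical

/-! ### Bicolimits in terms of compatible families of 2-cells. -/

section TwoCategorical

open Bicategory

namespace PseudoCocone

variable {S : Type w'} [Category.{v'} S] {D : Type w} [Bicategory.{v, t} D]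
  {F : LocallyDiscrete S ⥤ᵖ D} {e : D} {J : Type u} [Category.{u} J] {G : J ⥤ S}

/-- A family of 2-cells from the composites of the images of the legs `ι` with `ψ` to the legs of
a pseudococone is compatible if it respects the transition 2-cells. -/
def Compat {s : S} (ι : ∀ j, G.obj j ⟶ s) (c : PseudoCocone F G e) (ψ : F.obj ⟨s⟩ ⟶ e)
    (u : ∀ j, F.map (ι j).toLoc ≫ ψ ⟶ c.leg j) : Prop :=
  ∀ ⦃j k : J⦄ (f : j ⟶ k) (h : G.map f ≫ ι k = ι j), ccomp F h (c.comm f).hom (u k) = u j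

variable (F) in
/-- The property that the images of the legs `ι` form a bicolimit, in terms of compatible families
of 2-cells. -/
structure IsDescent {s : S} (ι : ∀ j, G.obj j ⟶ s) : Prop where
  existsUnique {e : D} {c : PseudoCocone F G e} {φ ψ : F.obj ⟨s⟩ ⟶ e}
    {u : ∀ j, F.map (ι j).toLoc ≫ ψ ⟶ c.leg j} {v : ∀ j, F.map (ι j).toLoc ≫ φ ⟶ c.leg j}
    (hu : ∀ j, IsIso (u j)) (hcu : Compat ι c ψ u) (hcv : Compat ι c φ v) :
    ∃! η : φ ⟶ ψ, ∀ j, F.map (ι j).toLoc ◁ η ≫ u j = v j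
  exists_compat {e : D} (c : PseudoCocone F G e) :
    ∃ (ψ : F.obj ⟨s⟩ ⟶ e) (u : ∀ j, F.map (ι j).toLoc ≫ ψ ⟶ c.leg j),
      (∀ j, IsIso (u j)) ∧ Compat ι c ψ u

section ofLegs

variable {s : S} (ι : ∀ j, G.obj j ⟶ s) (hι : ∀ {j k : J} (f : j ⟶ k), G.map f ≫ ι k = ι j)

lemma eq_associator_inv_comp_iff {x y z : D} {p : x ⟶ z} {f : x ⟶ y} {g : y ⟶ z} (m : p ≅ f ≫ g)
    {ψ : z ⟶ e} {χ : x ⟶ e} (α : f ≫ g ≫ ψ ⟶ χ) (β : p ≫ ψ ⟶ χ) :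
    α = ((α_ _ _ _).inv ≫ m.inv ▷ ψ) ≫ β ↔ m.hom ▷ ψ ≫ (α_ _ _ _).hom ≫ α = β := by
  constructor
  · rintro rfl
    simp
  · rintro rfl
    simp

lemma postcomp_ofLegs_naturality_iff (c : PseudoCocone F G e) (ψ : F.obj ⟨s⟩ ⟶ e)
    (u : ∀ j, F.map (ι j).toLoc ≫ ψ ⟶ c.leg j) {j k : J} (f : j ⟶ k) (h : G.map f ≫ ι k = ι j) :
    F.map (G.map f).toLoc ◁ u k ≫ (c.comm f).hom =
      ((((ofLegs F ι hι).postcomp e).obj ψ).comm f).hom ≫ u j ↔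
      ccomp F h (c.comm f).hom (u k) = u j := by
  exact eq_associator_inv_comp_iff (F.mapComp' (G.map f).toLoc (ι k).toLoc (ι j).toLoc
    (congrArg Quiver.Hom.toLoc h)) _ _

/-- The three parts of an equivalence are read off: uniqueness of 2-cells is faithfulness, their
existence is fullness, and existence of a compatible vertex is essential surjectivity. For the first
two, the comparison pseudococone is the image of `ψ`, with identity 2-cells. -/
lemma IsDescent.isBicolimit (h : IsDescent F ι) : (ofLegs F ι hι).IsBicolimit := by
  intro e
  have hcompat {c : PseudoCocone F G e} {ψ} (μ : ((ofLegs F ι hι).postcomp e).obj ψ ⟶ c) :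
      Compat ι c ψ μ.app := fun j k f h =>
    (postcomp_ofLegs_naturality_iff ι hι c ψ μ.app f h).1 (μ.naturality f)
  have key {φ ψ} (μ : ((ofLegs F ι hι).postcomp e).obj φ ⟶ ((ofLegs F ι hι).postcomp e).obj ψ) :
      ∃! η : φ ⟶ ψ, ∀ j, F.map (ι j).toLoc ◁ η = μ.app j := by
    have := h.existsUnique (fun j => inferInstanceAs (IsIso (𝟙 (F.map (ι j).toLoc ≫ ψ)))) (hcompat (𝟙 _)) (hcompat μ)
    refine (existsUnique_congr fun η => forall_congr' fun j => ?_).2 this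
    exact Eq.congr_left (Category.comp_id _).symm
  refine { faithful := ⟨fun {φ ψ η η'} heq => ?_⟩, full := ⟨fun {φ ψ} μ => ?_⟩,
           essSurj := ⟨fun c => ?_⟩ }
  · exact (key (((ofLegs F ι hι).postcomp e).map η)).unique (fun j => rfl)
      (fun j => (congrArg (fun μ => Hom.app μ j) heq).symm)
  · obtain ⟨η, hη, -⟩ := key μ
    exact ⟨η, Hom.ext (funext hη)⟩
  · obtain ⟨ψ, u, hu, hcu⟩ := h.exists_compat c
    let μ : ((ofLegs F ι hι).postcomp e).obj ψ ⟶ c :=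
      ⟨u, fun f => (postcomp_ofLegs_naturality_iff ι hι c ψ u f (hι f)).2 (hcu f (hι f))⟩
    have (j : J) : IsIso (μ.app j) := hu j
    exact ⟨ψ, ⟨isoMk μ⟩⟩

/-- Full faithfulness concerns only pseudococones obtained by postcomposition; the invertible family
`u` identifies an arbitrary `c` with one of these. -/
lemma isDescent_of_isBicolimit (h : (ofLegs F ι hι).IsBicolimit) : IsDescent F ι where
  existsUnique {e c φ ψ u v} hu hcu hcv := by
    have := h e
    let μ : ((ofLegs F ι hι).postcomp e).obj ψ ⟶ c :=
      ⟨u, fun f => (postcomp_ofLegs_naturality_iff ι hι c ψ u f (hι f)).2 (hcu f (hι f))⟩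
    let ν : ((ofLegs F ι hι).postcomp e).obj φ ⟶ c :=
      ⟨v, fun f => (postcomp_ofLegs_naturality_iff ι hι c φ v f (hι f)).2 (hcv f (hι f))⟩
    have (j : J) : IsIso (μ.app j) := hu j
    obtain ⟨η, hη⟩ := ((ofLegs F ι hι).postcomp e).map_surjective (ν ≫ (isoMk μ).inv)
    rw [Iso.eq_comp_inv] at hη
    refine ⟨η, fun j => congrArg (fun μ => Hom.app μ j) hη, fun η' hη' => ?_⟩
    apply ((ofLegs F ι hι).postcomp e).map_injective
    rw [← cancel_mono (isoMk μ).hom, hη]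
    exact Hom.ext (funext hη')
  exists_compat {e} c := by
    have := h e
    let i := ((ofLegs F ι hι).postcomp e).objObjPreimageIso c
    refine ⟨_, i.hom.app, fun j => ⟨i.inv.app j, congrArg (fun μ => Hom.app μ j) i.hom_inv_id,
      congrArg (fun μ => Hom.app μ j) i.inv_hom_id⟩, fun j k f h => ?_⟩
    exact (postcomp_ofLegs_naturality_iff ι hι c _ i.hom.app f h).1 (i.hom.naturality f)

end ofLegs

lemma Compat.restrict {s : S} {ι : ∀ j, G.obj j ⟶ s} {c : PseudoCocone F G e}
    {ψ : F.obj ⟨s⟩ ⟶ e} {u : ∀ j, F.map (ι j).toLoc ≫ ψ ⟶ c.leg j} (h : Compat ι c ψ u)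
    {J' : Type u} [Category.{u} J'] (p : J' ⥤ J) :
    Compat (G := p ⋙ G) (fun j => ι (p.obj j)) (c.restrict p) ψ (fun j => u (p.obj j)) :=
  fun _ _ f hf => h (p.map f) hf

lemma Related.ccomp_eq {G' : J ⥤ S} {τ : G' ⟶ G} {b : PseudoCocone F G' e} {c : PseudoCocone F G e}
    {κ : ∀ j, F.map (τ.app j).toLoc ≫ c.leg j ⟶ b.leg j} (hr : Related τ b c κ) {s : S}
    {ι : ∀ j, G.obj j ⟶ s} {ι' : ∀ j, G'.obj j ⟶ s} (hτι : ∀ j, τ.app j ≫ ι j = ι' j) {j k : J}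
    (f : j ⟶ k) (h' : G'.map f ≫ ι' k = ι' j) (h : G.map f ≫ ι k = ι j) {ψ : F.obj ⟨s⟩ ⟶ e}
    (u : F.map (ι k).toLoc ≫ ψ ⟶ c.leg k) :
    ccomp F h' (b.comm f).hom (ccomp F (hτι k) (κ k) u) =
      ccomp F (hτι j) (κ j) (ccomp F h (c.comm f).hom u) := by
  have h₂ : (τ.app j ≫ G.map f) ≫ ι k = ι' j := by
    rw [Category.assoc, h, hτι]
  rw [← ccomp_assoc F (τ.naturality f) h₂, hr f _ (τ.naturality f) rfl,
    ccomp_assoc F rfl h₂ h (hτι j)]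

lemma Related.compat {G' : J ⥤ S} {τ : G' ⟶ G} {b : PseudoCocone F G' e} {c : PseudoCocone F G e}
    {κ : ∀ j, F.map (τ.app j).toLoc ≫ c.leg j ⟶ b.leg j} (hr : Related τ b c κ) {s : S}
    {ι : ∀ j, G.obj j ⟶ s} (hι : ∀ {j k : J} (f : j ⟶ k), G.map f ≫ ι k = ι j)
    {ι' : ∀ j, G'.obj j ⟶ s} (hτι : ∀ j, τ.app j ≫ ι j = ι' j) {ψ : F.obj ⟨s⟩ ⟶ e}
    {u : ∀ j, F.map (ι j).toLoc ≫ ψ ⟶ c.leg j} (hcu : Compat ι c ψ u) :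
    Compat ι' b ψ (fun j => ccomp F (hτι j) (κ j) (u j)) := by
  intro j k f hf
  rw [hr.ccomp_eq hτι f hf (hι f), hcu f (hι f)]

namespace IsDescent

variable {s s' : S} {ι : ∀ j, G.obj j ⟶ s}

lemma isIso_of_forall (h : IsDescent F ι) {c : PseudoCocone F G e} {φ ψ : F.obj ⟨s⟩ ⟶ e}
    {u : ∀ j, F.map (ι j).toLoc ≫ ψ ⟶ c.leg j} {v : ∀ j, F.map (ι j).toLoc ≫ φ ⟶ c.leg j}
    (hu : ∀ j, IsIso (u j)) (hcu : Compat ι c ψ u) (hv : ∀ j, IsIso (v j)) (hcv : Compat ι c φ v)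
    {η : φ ⟶ ψ} (hη : ∀ j, F.map (ι j).toLoc ◁ η ≫ u j = v j) : IsIso η := by
  obtain ⟨θ, hθ, -⟩ := h.existsUnique hv hcv hcu
  refine ⟨θ, (h.existsUnique hv hcv hcv).unique (fun j => ?_) (fun j => by simp),
    (h.existsUnique hu hcu hcu).unique (fun j => ?_) (fun j => by simp)⟩
  · rw [Bicategory.whiskerLeft_comp, Category.assoc, hθ, hη]
  · rw [Bicategory.whiskerLeft_comp, Category.assoc, hη, hθ]

/-- 2-cells over a morphism `ρ` are determined by their composites with a compatible family of
invertible 2-cells. -/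
lemma existsUnique_ccomp (h : IsDescent F ι) {c : PseudoCocone F G e} {ψ : F.obj ⟨s⟩ ⟶ e}
    {u : ∀ j, F.map (ι j).toLoc ≫ ψ ⟶ c.leg j} (hu : ∀ j, IsIso (u j)) (hcu : Compat ι c ψ u)
    (ρ : s ⟶ s') {ι' : ∀ j, G.obj j ⟶ s'} (hρ : ∀ j, ι j ≫ ρ = ι' j) {χ : F.obj ⟨s'⟩ ⟶ e}
    {v : ∀ j, F.map (ι' j).toLoc ≫ χ ⟶ c.leg j} (hcv : Compat ι' c χ v) :
    ∃! η : F.map ρ.toLoc ≫ χ ⟶ ψ, ∀ j, ccomp F (hρ j) (u j) η = v j := by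
  -- Right composition with the identity of `F.map ρ.toLoc ≫ χ` turns 2-cells over `ι j` into
  -- 2-cells over `ι' j` bijectively. So `v` becomes a compatible family for the vertex `F.map
  -- ρ.toLoc ≫ χ`, and the descent property of `ι` applies.
  have hi : IsIso (𝟙 (F.map ρ.toLoc ≫ χ)) := inferInstance
  have key (j) := exists_mcomp_right (F.mapComp' (ι j).toLoc ρ.toLoc (ι' j).toLoc
    (congrArg Quiver.Hom.toLoc (hρ j))) _ hi (v j)
  choose v' hv' using key
  have hcv' : Compat ι c (F.map ρ.toLoc ≫ χ) v' := by
    intro j k f hf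
    have hf' : G.map f ≫ ι' k = ι' j := by rw [← hρ, ← hρ, ← Category.assoc, hf]
    refine mcomp_cancel_right _ _ hi (Eq.trans ?_ (hv' j).symm)
    rw [← hcv f hf', ← hv' k]
    exact ccomp_assoc F hf (hρ j) (hρ k) hf' _ _ _
  refine (existsUnique_congr fun η => forall_congr' fun j => ?_).2 (h.existsUnique hu hcu hcv')
  constructor
  · intro hη
    refine mcomp_cancel_right _ _ hi (Eq.trans ?_ (hv' j).symm)
    rw [mcomp_whiskerLeft_left, Category.id_comp]
    exact hη
  · intro hη
    rw [← hv' j, ← hη, mcomp_whiskerLeft_left, Category.id_comp]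

lemma isIso_of_forall_ccomp (h : IsDescent F ι) {c : PseudoCocone F G e} {ψ : F.obj ⟨s⟩ ⟶ e}
    {u : ∀ j, F.map (ι j).toLoc ≫ ψ ⟶ c.leg j} (hu : ∀ j, IsIso (u j)) (hcu : Compat ι c ψ u)
    (ρ : s ⟶ s') {ι' : ∀ j, G.obj j ⟶ s'} (hρ : ∀ j, ι j ≫ ρ = ι' j) {χ : F.obj ⟨s'⟩ ⟶ e}
    {v : ∀ j, F.map (ι' j).toLoc ≫ χ ⟶ c.leg j} (hv : ∀ j, IsIso (v j))
    {η : F.map ρ.toLoc ≫ χ ⟶ ψ} (hη : ∀ j, ccomp F (hρ j) (u j) η = v j) : IsIso η := by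
  refine h.isIso_of_forall hu hcu (v := fun j => F.map (ι j).toLoc ◁ η ≫ u j) (fun j => ?_)
    (fun j k f hf => ?_) (fun j => rfl)
  · have h1 : ccomp F (hρ j) (u j) η = _ := hη j
    have h2 : IsIso (ccomp F (hρ j) (u j) η) := h1 ▸ hv j
    unfold ccomp mcomp at h2
    rwa [isIso_comp_left_iff, isIso_comp_left_iff] at h2
  · refine Eq.trans ?_ (congrArg (_ ≫ ·) (hcu f hf))
    exact mcomp_whiskerLeft_right _ _ _ _

/-- Descent is invariant under replacing the diagram by an equivalent one. -/
lemma of_natTrans (h : IsDescent F ι) (hι : ∀ {j k : J} (f : j ⟶ k), G.map f ≫ ι k = ι j)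
    {G' : J ⥤ S} (τ : G' ⟶ G) (hτ : ∀ j, IsEquiv (F.map (τ.app j).toLoc))
    {ι' : ∀ j, G'.obj j ⟶ s} (hτι : ∀ j, τ.app j ≫ ι j = ι' j) : IsDescent F ι' := by
  have hι' {j k : J} (f : j ⟶ k) : G'.map f ≫ ι' k = ι' j := by
    rw [← hτι, ← hτι, ← hι f, τ.naturality_assoc]
  refine ⟨fun {e b φ ψ u v} hu hcu hcv => ?_, fun {e} b => ?_⟩
  -- The pseudococone `b` is transported to the diagram `G`. Left composition with `κ j` is
  -- bijective on 2-cells, so compatible families for `b` correspond to compatible families for `c`.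
  · obtain ⟨c, κ, hκ, hr⟩ := exists_related_of_source τ hτ b
    have key {ψ} (u : ∀ j, F.map (ι' j).toLoc ≫ ψ ⟶ b.leg j) (j) :=
      exists_mcomp_left (F.mapComp' (τ.app j).toLoc (ι j).toLoc (ι' j).toLoc
      (congrArg Quiver.Hom.toLoc (hτι j))) (hτ j) (κ j) (hκ j) (u j)
    have key' {ψ} {u : ∀ j, F.map (ι' j).toLoc ≫ ψ ⟶ b.leg j}
        {w : ∀ j, F.map (ι j).toLoc ≫ ψ ⟶ c.leg j}
        (hw : ∀ j, ccomp F (hτι j) (κ j) (w j) = u j) (hc : Compat ι' b ψ u) :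
        Compat ι c ψ w := by
      intro j k f hf
      refine mcomp_cancel_left _ (hτ j) (κ j) (hκ j) (((hr.ccomp_eq hτι f (hι' f) (hι f) _).symm.trans ?_).trans
        (hw j).symm)
      rw [← hc f (hι' f), hw]
    choose u' hu' using key u
    choose v' hv' using key v
    have hiu (j) : IsIso (u' j) := isIso_of_mcomp _ (hτ j) (κ j) (hκ j) _ ((hu' j).symm ▸ hu j)
    refine (existsUnique_congr fun η => forall_congr' fun j => ?_).2
      (h.existsUnique hiu (key' hu' hcu) (key' hv' hcv))
    rw [← hu', ← hv', ← mcomp_whiskerLeft_right]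
    exact ⟨fun hη => mcomp_cancel_left _ (hτ j) (κ j) (hκ j) hη, fun hη => by rw [hη]⟩
  · obtain ⟨c, κ, hκ, hr⟩ := exists_related_of_source τ hτ b
    obtain ⟨ψ, u, hu, hcu⟩ := h.exists_compat c
    refine ⟨ψ, fun j => ccomp F (hτι j) (κ j) (u j), fun j => isIso_mcomp _ _ _ (hκ j) (hu j),
      hr.compat hι hτι hcu⟩

/-- Descent is invariant under replacing the vertex by an equivalent one. -/
lemma comp (h : IsDescent F ι) (hι : ∀ {j k : J} (f : j ⟶ k), G.map f ≫ ι k = ι j)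
    (π : s ⟶ s') (hπ : IsEquiv (F.map π.toLoc)) {ι' : ∀ j, G.obj j ⟶ s'}
    (hιπ : ∀ j, ι j ≫ π = ι' j) : IsDescent F ι' := by
  have hι' {j k : J} (f : j ⟶ k) : G.map f ≫ ι' k = ι' j := by
    rw [← hιπ, ← hιπ, ← hι f, Category.assoc]
  refine ⟨fun {e c φ ψ u v} hu hcu hcv => ?_, fun {e} c => ?_⟩
  · have hi : IsIso (𝟙 (F.map π.toLoc ≫ ψ)) := inferInstance
    have key (j) := exists_mcomp_right (F.mapComp' (ι j).toLoc π.toLoc (ι' j).toLoc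
      (congrArg Quiver.Hom.toLoc (hιπ j))) _ hi (u j)
    choose u' hu' using key
    have hiu (j) : IsIso (u' j) := by
      have := hu j
      rw [← hu' j, mcomp, isIso_comp_left_iff, isIso_comp_left_iff, whiskerLeft_id,
        Category.id_comp] at this
      exact this
    have hcu' : Compat ι c (F.map π.toLoc ≫ ψ) u' := by
      intro j k f hf
      refine mcomp_cancel_right _ _ hi (Eq.trans ?_ (hu' j).symm)
      rw [← hcu f (hι' f), ← hu' k]
      exact ccomp_assoc F hf (hιπ j) (hιπ k) (hι' f) _ _ _
    have hmain := h.existsUnique_ccomp hiu hcu' π hιπ hcv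
    -- The unique 2-cell found so far has `F.map π.toLoc` whiskered on both sides; full faithfulness
    -- of precomposition with it removes the whiskering.
    have := hπ e
    have heq (η : φ ⟶ ψ) (j) : ccomp F (hιπ j) (u' j) (F.map π.toLoc ◁ η) =
        F.map (ι' j).toLoc ◁ η ≫ u j := by
      rw [← hu' j, ← mcomp_whiskerLeft_right, Category.comp_id]
    obtain ⟨η, hη, huniq⟩ := hmain
    obtain ⟨η, rfl⟩ := (precomp e (F.map π.toLoc)).map_surjective η
    refine ⟨η, fun j => (heq η j).symm.trans (hη j), fun η' hη' => ?_⟩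
    exact (precomp e (F.map π.toLoc)).map_injective (huniq _ fun j => (heq η' j).trans (hη' j))
  · obtain ⟨ψ, u, hu, hcu⟩ := h.exists_compat c
    have := hπ e
    let i : F.map π.toLoc ≫ (precomp e (F.map π.toLoc)).objPreimage ψ ≅ ψ :=
      (precomp e (F.map π.toLoc)).objObjPreimageIso ψ
    refine ⟨_, fun j => ccomp F (hιπ j) (u j) i.hom, fun j => isIso_mcomp _ _ _ (hu j)
      i.isIso_hom, fun j k f hf => ?_⟩
    rw [← ccomp_assoc F (hι f) (hιπ j), hcu f (hι f)]

end IsDescent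

end PseudoCocone

end TwoCategorical

/-! ### Related bicolimits and internal descent in terms of stars. -/

section TwoCategorical

open Bicategory

namespace PseudoCocone

variable {S : Type w'} [Category.{v'} S] {D : Type w} [Bicategory.{v, t} D]
  {F : LocallyDiscrete S ⥤ᵖ D} {d e : D} {J : Type u} [Category.{u} J] {G G' : J ⥤ S}
  {τ : G' ⟶ G}

/-- For related pseudococones, a family of 2-cells is natural if and only if the corresponding
family is. -/
lemma Related.naturality_iff (hτ : ∀ j, IsEquiv (F.map (τ.app j).toLoc))
    {b b' : PseudoCocone F G' e} {c c' : PseudoCocone F G e}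
    {κ : ∀ j, F.map (τ.app j).toLoc ≫ c.leg j ⟶ b.leg j}
    {κ' : ∀ j, F.map (τ.app j).toLoc ≫ c'.leg j ⟶ b'.leg j} (hr : Related τ b c κ)
    (hr' : Related τ b' c' κ') (hκ : ∀ j, IsIso (κ j)) (hκ' : ∀ j, IsIso (κ' j))
    {μ : ∀ j, c.leg j ⟶ c'.leg j} {ν : ∀ j, b.leg j ⟶ b'.leg j}
    (h : ∀ j, κ j ≫ ν j = F.map (τ.app j).toLoc ◁ μ j ≫ κ' j) {j k : J} (f : j ⟶ k) :
    F.map (G.map f).toLoc ◁ μ k ≫ (c'.comm f).hom = (c.comm f).hom ≫ μ j ↔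
      F.map (G'.map f).toLoc ◁ ν k ≫ (b'.comm f).hom = (b.comm f).hom ≫ ν j := by
  have e1 : ccomp F (τ.naturality f).symm (κ' j)
      (F.map (G.map f).toLoc ◁ μ k ≫ (c'.comm f).hom) =
      ccomp F rfl (F.map (G'.map f).toLoc ◁ ν k ≫ (b'.comm f).hom) (κ k) := by
    rw [ccomp, mcomp_whiskerLeft_right, ccomp, mcomp_whiskerLeft_left, h k,
      mcomp_whiskerLeft_right]
    exact congrArg (_ ≫ ·) (hr' f _ rfl (τ.naturality f).symm).symm
  have e2 : ccomp F (τ.naturality f).symm (κ' j) ((c.comm f).hom ≫ μ j) =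
      ccomp F rfl ((b.comm f).hom ≫ ν j) (κ k) := by
    rw [ccomp, ← mcomp_whiskerLeft_left, ← h j, ← mcomp_comp, ccomp, ← mcomp_comp]
    exact congrArg (· ≫ _) (hr f _ rfl (τ.naturality f).symm).symm
  constructor
  · intro h'
    exact mcomp_cancel_right _ (κ k) (hκ k) (e1.symm.trans ((congrArg _ h').trans e2))
  · intro h'
    exact mcomp_cancel_left _ (hτ j) (κ' j) (hκ' j)
      (e1.trans ((congrArg (fun α => ccomp F rfl α (κ k)) h').trans e2.symm))

lemma Related.postcomp {b : PseudoCocone F G' d} {c : PseudoCocone F G d}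
    {κ : ∀ j, F.map (τ.app j).toLoc ≫ c.leg j ⟶ b.leg j} (hr : Related τ b c κ) (φ : d ⟶ e) :
    Related τ ((b.postcomp e).obj φ) ((c.postcomp e).obj φ) (fun j => mpost (κ j) φ) := by
  intro j k f h h₁ h₂
  have := congrArg (mpost · φ) (hr f h h₁ h₂)
  simp only [ccomp, mpost_mcomp] at this
  exact this

section

variable {x y : D} {f : x ⟶ y} {ψ : y ⟶ d} {χ : x ⟶ d}

lemma mpost_comp_whiskerLeft (α : f ≫ ψ ⟶ χ) {φ φ' : d ⟶ e} (η : φ ⟶ φ') :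
    mpost α φ ≫ χ ◁ η = f ◁ ψ ◁ η ≫ mpost α φ' := by
  simp [mpost, ← whisker_exchange]

lemma isIso_mpost (α : f ≫ ψ ⟶ χ) (hα : IsIso α) (φ : d ⟶ e) : IsIso (mpost α φ) := by
  unfold mpost
  infer_instance

lemma whiskerLeft_eq_of_mpost (hf : IsEquiv f) {α : f ≫ ψ ⟶ χ} (hα : IsIso α) {φ φ' : d ⟶ e}
    {η η' : φ ⟶ φ'} (h : χ ◁ η = χ ◁ η') : ψ ◁ η = ψ ◁ η' := by
  have := hf e
  have := isIso_mpost α hα φ'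
  apply (precomp e f).map_injective
  change f ◁ ψ ◁ η = f ◁ ψ ◁ η'
  rw [← cancel_mono (mpost α φ'), ← mpost_comp_whiskerLeft, h, mpost_comp_whiskerLeft]

lemma exists_whiskerLeft_comp_eq (hf : IsEquiv f) {p q : y ⟶ e} {r r' : x ⟶ e} (α : f ≫ p ⟶ r)
    (β : f ≫ q ⟶ r') (hβ : IsIso β) (ν : r ⟶ r') : ∃ μ : p ⟶ q, α ≫ ν = f ◁ μ ≫ β := by
  have := hf e
  obtain ⟨μ, hμ⟩ := (precomp e f).map_surjective (X := p) (Y := q) (α ≫ ν ≫ inv β : f ≫ p ⟶ f ≫ q)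
  have hμ' : f ◁ μ = α ≫ ν ≫ inv β := hμ
  exact ⟨μ, by simp [hμ']⟩

lemma eq_whiskerLeft_of_mpost {α : f ≫ ψ ⟶ χ} (hα : IsIso α) {φ φ' : d ⟶ e} {η : φ ⟶ φ'}
    {ν : χ ≫ φ ⟶ χ ≫ φ'} (h : mpost α φ ≫ ν = f ◁ ψ ◁ η ≫ mpost α φ') : χ ◁ η = ν := by
  have := isIso_mpost α hα φ
  rw [← cancel_epi (mpost α φ), h, mpost_comp_whiskerLeft]

lemma exists_isIso_comp_eq {p q : y ⟶ e} {r r' : x ⟶ e} (α : f ≫ p ⟶ r) (hα : IsIso α)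
    (β : f ≫ q ⟶ r') (hβ : IsIso β) (i : p ⟶ q) (hi : IsIso i) :
    ∃ ν : r ⟶ r', IsIso ν ∧ α ≫ ν = f ◁ i ≫ β :=
  ⟨inv α ≫ f ◁ i ≫ β, inferInstance, by simp⟩

lemma mcomp_eq_mcomp {z y' : D} {h : x ⟶ z} {g : y ⟶ z} {f' : x ⟶ y'} {g' : y' ⟶ z}
    (m : h ≅ f ≫ g) (m' : h ≅ f' ≫ g') {p : x ⟶ e} {q : y ⟶ e} {q' : y' ⟶ e} {l : z ⟶ e}
    (α : f ≫ q ⟶ p) (β : g ≫ l ⟶ q) (α' : f' ≫ q' ⟶ p) (β' : g' ≫ l ⟶ q')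
    (H : f ◁ β ≫ α = (α_ _ _ _).inv ≫ m.inv ▷ l ≫ m'.hom ▷ l ≫ (α_ _ _ _).hom ≫
      f' ◁ β' ≫ α') : mcomp m α β = mcomp m' α' β' := by
  rw [mcomp, H]
  simp [mcomp]

end

/-- A pseudococone which is related to a bicolimit is a bicolimit. -/
lemma IsBicolimit.of_related {b : PseudoCocone F G' d} {c : PseudoCocone F G d}
    (hc : c.IsBicolimit) (hτ : ∀ j, IsEquiv (F.map (τ.app j).toLoc))
    {κ : ∀ j, F.map (τ.app j).toLoc ≫ c.leg j ⟶ b.leg j} (hκ : ∀ j, IsIso (κ j))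
    (hr : Related τ b c κ) : b.IsBicolimit := by
  intro e
  have := hc e
  have hi (φ : d ⟶ e) (j) : IsIso (mpost (κ j) φ) := isIso_mpost _ (hκ j) φ
  refine { faithful := ⟨fun {φ ψ η η'} heq => ?_⟩, full := ⟨fun {φ ψ} ν => ?_⟩,
           essSurj := ⟨fun b' => ?_⟩ }
  · apply (c.postcomp e).map_injective
    exact Hom.ext (funext fun j => whiskerLeft_eq_of_mpost (hτ j) (hκ j)
      (congrArg (fun μ => Hom.app μ j) heq))
  -- Since precomposition with the components of `τ` is full, the components of `ν` yield 2-cells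
  -- between the legs for `c`. Their naturality is equivalent to that of `ν`, and the bicolimit
  -- property of `c` then produces `η`.
  · have key (j) := exists_whiskerLeft_comp_eq (hτ j) (mpost (κ j) φ) (mpost (κ j) ψ) (hi ψ j)
      (ν.app j)
    choose μ hμ using key
    let μ' : (c.postcomp e).obj φ ⟶ (c.postcomp e).obj ψ :=
      ⟨μ, fun f => ((hr.postcomp φ).naturality_iff hτ (hr.postcomp ψ) (hi φ) (hi ψ) hμ f).2
        (ν.naturality f)⟩
    obtain ⟨η, hη⟩ := (c.postcomp e).map_surjective μ'
    refine ⟨η, Hom.ext (funext fun j => eq_whiskerLeft_of_mpost (hκ j) ((hμ j).trans ?_))⟩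
    exact congrArg (fun μ : c.leg j ≫ φ ⟶ c.leg j ≫ ψ => F.map (τ.app j).toLoc ◁ μ ≫
      mpost (κ j) ψ) (congrArg (fun μ => Hom.app μ j) hη).symm
  · obtain ⟨c', κ', hκ', hr'⟩ := exists_related_of_source τ hτ b'
    let i := (c.postcomp e).objObjPreimageIso c'
    have hij (j) : IsIso (i.hom.app j) := ⟨i.inv.app j,
      congrArg (fun μ => Hom.app μ j) i.hom_inv_id, congrArg (fun μ => Hom.app μ j) i.inv_hom_id⟩
    have key (j) := exists_isIso_comp_eq (mpost (κ j) ((c.postcomp e).objPreimage c')) (hi _ j)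
      (κ' j) (hκ' j) (i.hom.app j) (hij j)
    choose ν hν hν' using key
    let ν' : (b.postcomp e).obj ((c.postcomp e).objPreimage c') ⟶ b' :=
      ⟨ν, fun f => ((hr.postcomp _).naturality_iff hτ hr' (hi _) hκ' hν' f).1
        (i.hom.naturality f)⟩
    have (j : J) : IsIso (ν'.app j) := hν j
    exact ⟨_, ⟨isoMk ν'⟩⟩

end PseudoCocone

open PseudoCocone

variable {D : Type w} [Bicategory.{v, t} D] {Dat : LocallyDiscrete SchFin.{u} ⥤ᵖ D}

lemma IsGeometric₂.isEquiv (hD : IsGeometric₂ Dat) {X Y : SchFin.{u}} {f : X ⟶ Y}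
    (hf : SchFin.IsQcIso f) : IsEquiv (Dat.map f.toLoc) := by
  obtain ⟨E, hE⟩ := hD f hf
  intro d
  rw [← hE]
  exact isEquivalence_precomp E

/-- The coherence of the 2-cells `θ` is the relation along the projections from stars to points,
after moving the structural isomorphisms of the pseudofunctor to one side. -/
lemma IsInternal.exists_related {X : SchFin.{u}}
    {c : PseudoCocone Dat X.pointDiagram (Dat.obj ⟨X⟩)} (hc : IsInternal Dat c) :
    ∃ κ, (∀ j, IsIso (κ j)) ∧
      Related X.starToPoint (ofLegs Dat X.starLeg fun h => X.map_starLeg h) c κ := by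
  obtain ⟨θ, hθ⟩ := hc
  refine ⟨fun x => (θ x).hom, fun x => (θ x).isIso_hom, fun x y f h h₁ h₂ => ?_⟩
  subst h₁
  have h1 := hθ f
  rw [← Dat.mapComp'_eq_mapComp] at h1
  exact mcomp_eq_mcomp _ _ _ _ _ _ h1

/-- Internal descent, in terms of the stars of a schematic space. -/
lemma SatisfiesInternalDescent₂.isDescent (h : SatisfiesInternalDescent₂ Dat)
    (hD : IsGeometric₂ Dat) (Y : SchFin.{u}) : IsDescent Dat Y.starLeg := by
  obtain ⟨c, hc, hb⟩ := h Y
  obtain ⟨κ, hκ, hr⟩ := hc.exists_related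
  have hτ (x) : IsEquiv (Dat.map (Y.starToPoint.app x).toLoc) :=
    hD.isEquiv (Y.isQcIso_starπ x.unop)
  exact isDescent_of_isBicolimit Y.starLeg (fun h => Y.map_starLeg h) (hb.of_related hτ hκ hr)

end TwoCategorical

/-! ### External descent with values in a 2-category. -/

section TwoCategorical

open Bicategory PseudoCocone

variable {D : Type w} [Bicategory.{v, t} D] {Dat : LocallyDiscrete SchFin.{u} ⥤ᵖ D}

namespace SchFin.IsFlatCover

variable {P : Type u} [PartialOrder P] [Finite P] {G : Pᵒᵖ ⥤ SchFin.{u}} {c : Cocone G}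

/-- The cylinder relates each `(Δ, x)` to the image of `x` at any smaller index. Through these
relations the transition 2-cells of a pseudococone on `G` are seen by the cylinder. -/
lemma exists_hom (hc : IsFlatCover c) {i i' : Pᵒᵖ} (f : i ⟶ i') (x : (G.obj i : Type u)ᵒᵖ) :
    ∃ y : (G.obj i' : Type u)ᵒᵖ, Nonempty ((hc.incl i).obj x ⟶ (hc.incl i').obj y) := by
  refine ⟨op ((tr G (leOfHom f.unop)).hom.base x.unop), ⟨(homOfLE ?_).op⟩⟩
  exact ⟨leOfHom f.unop, le_refl _⟩

/-- This is internal descent for `G i`, with its stars replaced by the stars of the cylinder; the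
projections between them become equivalences because they are qc-isomorphisms. -/
lemma isDescent_toDiagram (hc : IsFlatCover c) (hD : IsGeometric₂ Dat)
    (h : SatisfiesInternalDescent₂ Dat) (i : Pᵒᵖ) :
    IsDescent Dat (G := hc.incl i ⋙ hc.space.starDiagram) (s := G.obj i)
      (fun x => hc.toDiagram.app ((hc.incl i).obj x)) := by
  have hτ (x) : IsEquiv (Dat.map ((hc.toStar i).app x).toLoc) :=
    hD.isEquiv (hc.isQcIso_starProj _)
  exact (h.isDescent hD (G.obj i)).of_natTrans (fun f => (G.obj i).map_starLeg f) (hc.toStar i) hτ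
    (fun x => hc.toStar_starLeg i x)

lemma isDescent_starLeg_proj (hc : IsFlatCover c) (hD : IsGeometric₂ Dat)
    (h : SatisfiesInternalDescent₂ Dat) :
    IsDescent Dat (G := hc.space.starDiagram) (s := c.pt)
      (fun k => hc.space.starLeg k ≫ hc.proj) :=
  (h.isDescent hD hc.space).comp (fun f => hc.space.map_starLeg f) hc.proj
    (hD.isEquiv hc.isQcIso_proj) (fun _ => rfl)

/-- Between points of the cylinder with the same index `i`, the transition 2-cell of `a` lies over
the identity of `G i` and is the unit, so the relation reduces to compatibility with the single leg
`a.leg i`. -/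
lemma compat_of_related (hc : IsFlatCover c) {e : D} {a : PseudoCocone Dat G e}
    {b : PseudoCocone Dat hc.space.starDiagram e}
    {κ : ∀ k, Dat.map (hc.toDiagram.app k).toLoc ≫ (a.restrict hc.idx).leg k ⟶ b.leg k}
    (hr : Related hc.toDiagram b (a.restrict hc.idx) κ) (i : Pᵒᵖ) :
    Compat (G := hc.incl i ⋙ hc.space.starDiagram) (s := G.obj i)
      (fun x => hc.toDiagram.app ((hc.incl i).obj x)) (b.restrict (hc.incl i)) (a.leg i)
      (fun x => κ ((hc.incl i).obj x)) := by
  intro x y f h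
  have hid (f : i ⟶ i) : G.map f = 𝟙 (G.obj i) := by
    rw [Subsingleton.elim f (𝟙 i), G.map_id]
  have h2 : G.map (hc.idx.map ((hc.incl i).map f)) = 𝟙 (G.obj i) := hid _
  have h1 : (hc.toDiagram.app ((hc.incl i).obj x) : _ ⟶ G.obj i) ≫
      G.map (hc.idx.map ((hc.incl i).map f)) = hc.toDiagram.app ((hc.incl i).obj x) :=
    (congrArg ((hc.toDiagram.app ((hc.incl i).obj x) : _ ⟶ G.obj i) ≫ ·) h2).trans
      (Category.comp_id _)
  refine (hr ((hc.incl i).map f) _ h h1).trans ?_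
  have h3 : (a.comm (hc.idx.map ((hc.incl i).map f))).hom = cid Dat h2 (a.leg i) :=
    a.comm_eq_cid (j := i) _ (Subsingleton.elim _ _) h2
  refine (congrArg (ccomp Dat h1 (κ ((hc.incl i).obj x))) h3).trans ?_
  exact ccomp_cid Dat h2 h1 (κ ((hc.incl i).obj x))

/-- External descent for flat covers, for geometric data with values in a 2-category. -/
theorem isBicolimit (hc : IsFlatCover c) (hD : IsGeometric₂ Dat)
    (h : SatisfiesInternalDescent₂ Dat) : (ofCocone Dat c).IsBicolimit := by
  have hτι (k) : hc.toDiagram.app k ≫ c.ι.app (hc.idx.obj k) = hc.space.starLeg k ≫ hc.proj :=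
    (hc.starLeg_proj k).symm
  refine IsDescent.isBicolimit (fun i => c.ι.app i) (fun f => c.w f) ⟨?_, ?_⟩
  · intro e a φ ψ u v hu hcu hcv
    -- The pseudococone `a` is reindexed along the cylinder and pulled back to its stars.
    -- Composition with `κ` makes the families `u` and `v` compatible families on the stars.
    obtain ⟨b, κ, hκ, hr⟩ := exists_related_of_target hc.toDiagram (a.restrict hc.idx)
    have hcompat {χ} {w : ∀ i, Dat.map (c.ι.app i).toLoc ≫ χ ⟶ a.leg i}
        (hcw : Compat (fun i => c.ι.app i) a χ w) :=
      hr.compat (fun f => c.w (hc.idx.map f)) hτι (hcw.restrict hc.idx)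
    have hwhisker (η : φ ⟶ ψ) (k) : Dat.map (hc.space.starLeg k ≫ hc.proj).toLoc ◁ η ≫
        ccomp Dat (hτι k) (κ k) (u (hc.idx.obj k)) =
        ccomp Dat (hτι k) (κ k) (Dat.map (c.ι.app (hc.idx.obj k)).toLoc ◁ η ≫
          u (hc.idx.obj k)) :=
      (mcomp_whiskerLeft_right _ _ _ _).symm
    obtain ⟨η, hη, huniq⟩ := (hc.isDescent_starLeg_proj hD h).existsUnique
      (fun k => isIso_mcomp _ _ _ (hκ k) (hu (hc.idx.obj k))) (hcompat hcu) (hcompat hcv)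
    refine ⟨η, fun i => ?_, fun η' hη' => huniq η' fun k => (hwhisker η' k).trans
      (congrArg (ccomp Dat (hτι k) (κ k)) (hη' (hc.idx.obj k)))⟩
    -- The equation for `η` is known on the stars of the cylinder only. For fixed `i`, descent for
    -- `G i` makes a 2-cell over `c.ι.app i` determined by its composites there.
    exact ((hc.isDescent_toDiagram hD h i).existsUnique_ccomp (fun x => hκ _)
      (hc.compat_of_related hr i) (c.ι.app i) (fun x => hτι ((hc.incl i).obj x))
      ((hcompat hcv).restrict (hc.incl i))).unique
      (fun x => (hwhisker η ((hc.incl i).obj x)).symm.trans (hη ((hc.incl i).obj x)))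
      (fun x => rfl)
  · intro e a
    obtain ⟨b, κ, hκ, hr⟩ := exists_related_of_target hc.toDiagram (a.restrict hc.idx)
    obtain ⟨ψ, u, hu, hcu⟩ := (hc.isDescent_starLeg_proj hD h).exists_compat b
    have key (i) := (hc.isDescent_toDiagram hD h i).existsUnique_ccomp
      (fun x => hκ _) (hc.compat_of_related hr i) (c.ι.app i)
      (fun x => hτι ((hc.incl i).obj x)) (hcu.restrict (hc.incl i))
    have hiso (i) {η} (hη) := (hc.isDescent_toDiagram hD h i).isIso_of_forall_ccomp
      (fun x => hκ _) (hc.compat_of_related hr i) (c.ι.app i)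
      (fun x => hτι ((hc.incl i).obj x)) (fun x => hu ((hc.incl i).obj x)) (η := η) hη
    choose η hη huniq using key
    -- The 2-cells `η i` are glued from the family on the stars over `i`. Compatibility along `f : i
    -- ⟶ i'` may be checked after composition with the 2-cells over the points `x` of `G i`. There
    -- `f` is the index of a relation `g` in the cylinder, and the family `u` is compatible along
    -- `g`.
    refine ⟨ψ, η, fun i => hiso i (hη i), fun i i' f hf => huniq i _ fun x => ?_⟩
    obtain ⟨y, ⟨g⟩⟩ := hc.exists_hom f x
    have h1 : hc.idx.map g = f := Subsingleton.elim _ _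
    subst h1
    have h2 : hc.space.starDiagram.map g ≫ hc.space.starLeg ((hc.incl i').obj y) ≫ hc.proj =
        hc.space.starLeg ((hc.incl i).obj x) ≫ hc.proj := by
      rw [← Category.assoc, hc.space.map_starLeg]
    refine (hr.ccomp_eq (ι := fun k => c.ι.app (hc.idx.obj k)) hτι g h2 hf (η i')).symm.trans ?_
    refine (congrArg (ccomp Dat h2 (b.comm g).hom) (hη i' y)).trans ?_
    exact hcu g h2

end SchFin.IsFlatCover

end TwoCategorical
theorem mainTheorem5 {X : SchFin.{u}} {I : Type u} {U : I → SchFin.{u}} (f : ∀ i, U i ⟶ X)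
    (hf : SchFin.IsCovering f) :
    (∀ (C : Type w) [Category.{v} C] (Dat : SchFin.{u} ⥤ C) (hD : IsGeometric Dat),
      SatisfiesInternalDescent Dat hD →
        Nonempty (IsColimit (Dat.mapCocone (SchFin.nerveCocone f)))) ∧
    (∀ (D : Type w) [Bicategory.{v, t} D] [Bicategory.Strict D]
      (Dat : Pseudofunctor (LocallyDiscrete SchFin.{u}) D),
      IsGeometric₂ Dat → SatisfiesInternalDescent₂ Dat →
        (PseudoCocone.ofCocone Dat (SchFin.nerveCocone f)).IsBicolimit) := by
  -- Finiteness of `I` makes the poset of non-empty subsets finite, so the cylinder of the nerve is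
  -- a finite ringed poset.
  have := hf.finite
  exact ⟨fun _ _ _ _ h => hf.isFlatCover.nonempty_isColimit h,
    fun _ _ _ _ hD h => hf.isFlatCover.isBicolimit hD h⟩
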